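/- **Setting.** Let $(\mathbf S,\mathbf M)$ be a marked surface (in the sense of Fomin–Shapiro–Thurston) and $T$ a triangulation of it all of whose arcs are tagged plain, given as a gluing of finitely many triangles; curves are considered up to isotopy, through the arcs of $T$ that they cross. Let $\alpha$ be a tagged arc. The pair $(T,\alpha)$ is *tidy* if: each triangle of $T$ has three distinct vertices and three distinct edges; $\alpha$ has two distinct endpoints; no arc of $T$ intersects the interior of $\alpha$ more than once; no arc of $T$ both intersects the interior of $\alpha$ and shares an endpoint with $\alpha$; and an arc of $T$ with the same two endpoints as $\alpha$ coincides with $\alpha$ except possibly for tagging. An arc $\gamma\in T$ is *exchangeable* with $\alpha$ if either they cross exactly once and have the same tags at common endpoints, or they do not cross, do not coincide up to tagging, have different tags at a common endpoint, and have the same tag at the other endpoint if they share it as well. **The poset.** $P_\alpha$ is a poset labeled by arcs of $T$; an element labeled $\beta$ has weight $\hat y_\beta=y_\beta\prod_{\delta\in T}x_\delta^{b_{\delta\beta}}$, where $(b_{\delta\beta})$ is the signed adjacency matrix of $T$. If $\alpha$ does not coincide with an arc of $T$ up to tagging, its elements are the crossings of $\alpha$ with arcs of $T$, where for consecutive crossings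 $e,f$ along $\alpha$ one has $e<f$ (resp. $e>f$) if the corner cut off from $e$ to $f$ is on the left (resp. right) of $\alpha$; moreover, at each notched end $p$ of $\alpha$ there is a chain consisting of all ends of arcs of $T$ at $p$, increasing counterclockwise around $p$ starting from $\alpha$, whose bottom is below and whose top is above the crossing of $\alpha$ nearest to $p$. If $\alpha$ coincides with $\beta\in T$ up to tagging, then $P_\alpha$ is: empty if both ends are plain; the chain of the ends at $p$ of the arcs other than $\beta$, increasing counterclockwise from $\beta$, if exactly one end $p$ is notched; and if both ends are notched, the union of the two chains running around the two endpoints from $\beta$ back to $\beta$, with minima identified and maxima identified (both labeled $\beta$), together with the relations making the atom of each chain smaller than the coatom of the other. For a finite weighted poset $P$ with weights $w$ let $F(P)=\sum_I\prod_{e\in I}w(e)$, the sum being over all order ideals $I$ of $P$. **The exchange relation.** If $\alpha$ and $\gamma$ cross, they (the purple arcs) are the diagonals of a quadrilateral, with one pair of opposite sides colored red and the other blue; a side has the tag of $\alpha$ at its endpoint on $\alpha$ and is plain at its endpoint on $\gamma$. If $\alpha$, notched at $p$, and $\gamma$ share the endpoint $p$, let $\ell$ be the loop that is based at the other endpoint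 $q$ of $\alpha$, follows $\alpha$, and goes around $p$; use the quadrilateral with diagonals $\ell$ and $\gamma$, again with one pair of opposite sides red and the other blue. Its two sides at $p$ (one of each color) coincide with $\alpha$ up to tagging and are only auxiliary (dotted); the other two, tagged as $\alpha$ at $q$ and plain at the endpoint of $\gamma$ other than $p$, are the red and the blue arc of the exchange relation. For $\delta\in T$ the elementary lamination $L_\delta$ follows $\delta$, and near each endpoint turns slightly to the right to end on the boundary or to spiral counterclockwise into a puncture; its spirals are reversed at the notched ends of $\alpha$, except at $p$ if $\gamma$ shares the endpoint $p$ with $\alpha$. The colors are chosen so that no $L_\delta$ with $\delta\in T$ crosses the quadrilateral from one red side through $\gamma$ to the opposite red side. $\hat y_{\mathrm{orange}}$ is the product of the $\hat y_\delta$ over all $\delta\in T$ such that $L_\delta$ crosses the quadrilateral from one blue side through $\gamma$ to the opposite blue side. $P_{\mathrm{blue}}$ (resp. $P_{\mathrm{red}}$) is the disjoint union of the weighted posets of the (non-dotted) blue (resp. red) arcs, boundary segments contributing the empty poset. **Proposition 3.1.** Suppose that $(T,\alpha)$ is tidy and that $\gamma\in T$ is exchangeable with $\alpha$. Then $P_\alpha$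 is a poset, and the exchange relation of $\alpha$ and $\gamma$ is defined: the required coloring exists, $L_\gamma$ crosses blue-purple-blue, and each $L_\delta$ with $\delta\in T$ has at most one blue-purple-blue crossing. There is exactly one element $e_\gamma$ of $P_\alpha$ labeled $\gamma$, and: * $P_{\mathrm{blue}}$ is isomorphic, as a labeled poset, to what is left of $P_\alpha$ after deleting all elements weakly above $e_\gamma$; * $P_{\mathrm{red}}$ is isomorphic, as a labeled poset, to what is left of $P_\alpha$ after deleting all elements weakly below $e_\gamma$; * $\hat y_{\mathrm{orange}}$ is the product of the weights of the elements of $P_\alpha$ weakly below $e_\gamma$. Hence $F(P_{\mathrm{blue}})$ is the weighted sum of the order ideals of $P_\alpha$ that do not contain $e_\gamma$, $\hat y_{\mathrm{orange}}\cdot F(P_{\mathrm{red}})$ is the weighted sum of those that contain $e_\gamma$, and $$F(P_\alpha)=F(P_{\mathrm{blue}})+\hat y_{\mathrm{orange}}\cdot F(P_{\mathrm{red}}).$$ -/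

import Mathlib

/-!
Triangulated marked surfaces, tagged arcs, the labeled posets `P_α`, elementary laminations and
the exchange relations of tidy pairs.

A marked surface with an ideal triangulation is given by its gluing data: finitely many oriented
triangles, glued along pairs of sides. Curves are taken up to isotopy, through the sequence of arcs
of the triangulation that they cross.
-/

namespace TidyExchange

/-- The hand on which a curve leaves a triangle it has entered. -/
inductive Turn
  | left
  | right

/-- The other hand (the same turn, seen by someone walking in the opposite direction). -/
def Turn.flip : Turn → Turn
  | .left => .right
  | .right => .left

/-- A tag at an end of a curve. -/
inductive Tag
  | plain
  | notched

/-! ### Triangulated surfaces -/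

/-- The gluing data of an ideal triangulation `T` (all arcs tagged plain) of an oriented marked
surface. `H` is the set of all sides of all triangles. Each side is directed along the
counterclockwise boundary of its triangle, `next` is the next side of the same triangle in
counterclockwise order, and `twin` is the side that a side is glued to (orientation-compatibly),
where `twin h = h` means that `h` is a boundary segment. -/
structure Triangulation (H : Type*) where
  next : H → H
  twin : H → H
  next_next_next : ∀ h, next (next (next h)) = h
  next_ne : ∀ h, next h ≠ h
  twin_twin : ∀ h, twin (twin h) = h

namespace Triangulation

variable {H : Type*} (T : Triangulation H)

/-- The previous side (in counterclockwise order) of the same triangle. -/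
def prev (h : H) : H := T.next (T.next h)

/-- The side `h` lies on the boundary of the surface. -/
def IsBoundary (h : H) : Prop := T.twin h = h

/-- Marked points: the source of a side `h` is glued to the target of `twin h`, that is, to the
source of `next (twin h)`. -/
def Vertex : Type _ := Quot fun a b : H => ¬ T.IsBoundary a ∧ b = T.next (T.twin a)

/-- The source of the side `h`. We also use `h` as a name for the corner of its triangle between
`prev h` and `h`, which lies at this marked point. -/
def vertex (h : H) : T.Vertex := Quot.mk _ h

/-- Edges of the triangulation: two sides that are glued form one edge. -/
def Edge : Type _ := Quot fun a b : H => b = T.twin a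

/-- The edge that contains the side `h`. -/
def edge (h : H) : T.Edge := Quot.mk _ h

/-- The arcs of `T` are the edges that are not boundary segments. -/
def IsArc (δ : T.Edge) : Prop := ∃ h, T.edge h = δ ∧ ¬ T.IsBoundary h

/-- `v` is an endpoint of the arc `δ`. -/
def HasEndpoint (δ : T.Edge) (v : T.Vertex) : Prop := ∃ h, T.edge h = δ ∧ T.vertex h = v

/-- A puncture is a marked point that does not lie on the boundary. -/
def IsPuncture (v : T.Vertex) : Prop :=
  ∀ h, T.vertex h = v → ¬ T.IsBoundary h ∧ ¬ T.IsBoundary (T.prev h)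

/-- The surface is connected. -/
def IsConnected : Prop :=
  ∀ a b : H, Relation.EqvGen (fun a b => b = T.next a ∨ b = T.twin a) a b

/-- Besides connectedness, the definition of a marked surface excludes: the sphere with at most
three punctures, the monogon with at most one puncture, the unpunctured digon, and the unpunctured
triangle. Those of them that consist of triangles are the unpunctured triangle and the
once-punctured monogon (the surfaces made of one triangle) and the sphere with three
punctures (a closed surface with two triangles, hence six sides, and three marked points). -/
def IsMarkedSurface : Prop :=
  T.IsConnected ∧ 3 < Nat.card H ∧
    ¬ ((∀ h, ¬ T.IsBoundary h) ∧ Nat.card H = 6 ∧ Nat.card T.Vertex = 3)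

/-! ### Curves -/

/-- The side through which a curve leaves a triangle that it entered through its side `h`. -/
def exit (h : H) : Turn → H
  | .left => T.prev h
  | .right => T.next h

/-- The `k`-th side crossed by a curve whose first crossing is out of a triangle through its side
`g`, and whose turns in the following triangles are `ts`. (Crossing `x`, the curve leaves a triangle
through the side `x` and enters the next one through the side `twin x`.) -/
def crossingAt (g : H) (ts : List Turn) (k : ℕ) : H :=
  (ts.take k).foldl (fun x t => T.exit (T.twin x) t) g

/-- The last side crossed. -/
def lastCrossing (g : H) (ts : List Turn) : H := T.crossingAt g ts ts.length

/-- All sides crossed, in order. -/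
def crossingList (g : H) (ts : List Turn) : List H :=
  (List.range (ts.length + 1)).map (T.crossingAt g ts)

/-- One step counterclockwise around the marked point at the corner `h`: the next corner at the
same marked point. The edge crossed in this step is the edge of `rot h`. -/
def rot (h : H) : H := T.twin (T.prev h)

/-- The number of ends of arcs at the puncture that lies at the corner `h`. -/
noncomputable def degree (h : H) : ℕ := Function.minimalPeriod T.rot h

end Triangulation

/-- A curve between marked points, up to isotopy and drawn with as few crossings as possible:
either it follows a side `h`, from the source to the target of `h`, or it starts at the corner
opposite to the side `g` of a triangle, crosses `g`, makes the turns `ts` in the following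
triangles, and after the last crossing ends at the opposite corner of the triangle just entered. -/
inductive Curve (H : Type*)
  | side (h : H)
  | cross (g : H) (ts : List Turn)

/-- A curve with tags at its two ends. -/
structure TaggedCurve (H : Type*) where
  curve : Curve H
  startTag : Tag
  finishTag : Tag

namespace Triangulation

variable {H : Type*} (T : Triangulation H)

/-- The marked point where a curve starts. -/
def start : Curve H → T.Vertex
  | .side h => T.vertex h
  | .cross g _ => T.vertex (T.prev g)

/-- The marked point where a curve ends. -/
def finish : Curve H → T.Vertex
  | .side h => T.vertex (T.next h)
  | .cross g ts => T.vertex (T.prev (T.twin (T.lastCrossing g ts)))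

/-- The sides crossed by a curve. -/
def crossings : Curve H → List H
  | .side _ => []
  | .cross g ts => T.crossingList g ts

/-- The curve coincides (up to isotopy, disregarding tags) with the edge `δ`. -/
def Coincides : Curve H → T.Edge → Prop
  | .side h, δ => T.edge h = δ
  | .cross _ _, _ => False

/-- The same tagged curve, traversed in the opposite direction. -/
def reverse (α : TaggedCurve H) : TaggedCurve H where
  curve := match α.curve with
    | .side h => .side (T.twin h)
    | .cross g ts => .cross (T.twin (T.lastCrossing g ts)) (ts.reverse.map Turn.flip)
  startTag := α.finishTag
  finishTag := α.startTag

/-- `α` is the combinatorial description of a curve in the surface that is not a boundary segment,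
tagged at its ends, and tagged plain at its ends on the boundary. Every tagged arc has such a
description. (A curve of this kind may cross itself, but for the tidy pairs below this does not
happen: there a curve visits each triangle at most once.) -/
def IsTaggedCurve (α : TaggedCurve H) : Prop :=
  (match α.curve with
    | .side h => ¬ T.IsBoundary h
    | .cross g ts => ∀ x ∈ T.crossingList g ts, ¬ T.IsBoundary x) ∧
  (α.startTag = .notched → T.IsPuncture (T.start α.curve)) ∧
  (α.finishTag = .notched → T.IsPuncture (T.finish α.curve))

/-- The pair `(T, α)` is tidy. (That `T` consists of plain-tagged arcs is built into
`Triangulation`.) -/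
structure Tidy (α : TaggedCurve H) : Prop where
  /-- each triangle of `T` has three distinct vertices -/
  vertices_ne : ∀ h, T.vertex h ≠ T.vertex (T.next h)
  /-- each triangle of `T` has three distinct edges -/
  edges_ne : ∀ h, T.edge h ≠ T.edge (T.next h)
  /-- `α` has two distinct endpoints -/
  ends_ne : T.start α.curve ≠ T.finish α.curve
  /-- no arc in `T` intersects the interior of `α` more than once -/
  cross_once : ((T.crossings α.curve).map T.edge).Nodup
  /-- no arc in `T` both intersects the interior of `α` and shares an endpoint with `α` -/
  cross_ends : ∀ x ∈ T.crossings α.curve,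
    ¬ T.HasEndpoint (T.edge x) (T.start α.curve) ∧ ¬ T.HasEndpoint (T.edge x) (T.finish α.curve)
  /-- an arc of `T` with the same two endpoints as `α` coincides with `α`, except possibly for
  tagging -/
  same_ends : ∀ h, ¬ T.IsBoundary h → T.vertex h = T.start α.curve →
    T.vertex (T.next h) = T.finish α.curve → T.Coincides α.curve (T.edge h)

end Triangulation

/-! ### Labeled posets -/

/-- A finite set with a reflexive and transitive relation and a labeling by `A`. It is a poset if
the relation is also antisymmetric (`IsPoset`). -/
structure LabeledOrder (A : Type*) where
  carrier : Type
  fintype : Fintype carrier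
  le : carrier → carrier → Prop
  refl : ∀ x, le x x
  trans : ∀ x y z, le x y → le y z → le x z
  label : carrier → A

namespace LabeledOrder

variable {A : Type*}

attribute [instance] LabeledOrder.fintype

def IsPoset (P : LabeledOrder A) : Prop := ∀ x y, P.le x y → P.le y x → x = y

/-- The order generated by the relations `r x y`, meaning `x < y`. -/
def generate {X : Type} [Fintype X] (r : X → X → Prop) (label : X → A) : LabeledOrder A where
  carrier := X
  fintype := inferInstance
  le := Relation.ReflTransGen r
  refl _ := .refl
  trans _ _ _ := .trans
  label := label

/-- Disjoint union (no relations between the two parts). -/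
def disjointUnion (P Q : LabeledOrder A) : LabeledOrder A where
  carrier := P.carrier ⊕ Q.carrier
  fintype := inferInstance
  le := Sum.LiftRel P.le Q.le
  refl x := by
    cases x
    · exact .inl (P.refl _)
    · exact .inr (Q.refl _)
  trans x y z h h' := by
    cases h <;> cases h'
    · exact .inl (P.trans _ _ _ ‹_› ‹_›)
    · exact .inr (Q.trans _ _ _ ‹_› ‹_›)
  label := Sum.elim P.label Q.label

/-- The empty poset. -/
def empty : LabeledOrder A where
  carrier := Empty
  fintype := inferInstance
  le _ _ := True
  refl _ := trivial
  trans _ _ _ _ _ := trivial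
  label := Empty.elim

open scoped Classical in
/-- The elements that satisfy `S`, with the induced order and labels. -/
noncomputable def restrict (P : LabeledOrder A) (S : P.carrier → Prop) : LabeledOrder A where
  carrier := {x // S x}
  fintype := inferInstance
  le x y := P.le x y
  refl x := P.refl x
  trans x y z := P.trans x y z
  label x := P.label x

/-- Label-preserving isomorphism. -/
def Iso (P Q : LabeledOrder A) : Prop :=
  ∃ f : P.carrier ≃ Q.carrier,
    (∀ x y, Q.le (f x) (f y) ↔ P.le x y) ∧ ∀ x, Q.label (f x) = P.label x

/-- Order ideals are the down-closed sets. -/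
def IsIdeal (P : LabeledOrder A) (I : Finset P.carrier) : Prop :=
  ∀ x ∈ I, ∀ y, P.le y x → y ∈ I

/-- The weight of a set of elements is the product of the weights of the elements. -/
def weight {K : Type*} [CommMonoid K] (P : LabeledOrder A) (w : A → K) (I : Finset P.carrier) : K :=
  ∏ e ∈ I, w (P.label e)

open scoped Classical in
/-- The weighted sum `F(P)` of all order ideals of `P`. -/
noncomputable def F {K : Type*} [CommSemiring K] (P : LabeledOrder A) (w : A → K) : K :=
  ∑ I : Finset P.carrier with P.IsIdeal I, P.weight w I

end LabeledOrder

namespace Triangulation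

variable {H : Type*} (T : Triangulation H)

/-! ### The poset of a tagged arc -/

/-- The size of a chain attached at an end tagged as indicated. -/
def chainSize (n : ℕ) : Tag → ℕ
  | .plain => 0
  | .notched => n

/-- The relations of `P_α` for a curve with `n` crossings and turns `ts`. Elements: the crossings in
order; the chain at the start of `α`, of size `a`; the chain at the end of `α`, of size `b`. Chains
are listed from bottom to top. Between consecutive crossings `e`, `f` there is the relation `e < f`
if the corner cut off is on the left of `α`, and `e > f` if it is on the right. The crossing next
to an end of `α` lies below the top and above the bottom of the chain attached at this end. -/
def crossRel (ts : List Turn) {n a b : ℕ} : Fin n ⊕ (Fin a ⊕ Fin b) → Fin n ⊕ (Fin a ⊕ Fin b) → Prop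
  | .inl i, .inl j => (i.val + 1 = j.val ∧ ts[i.val]? = some .left) ∨
      (j.val + 1 = i.val ∧ ts[j.val]? = some .right)
  | .inr (.inl i), .inr (.inl j) => i.val + 1 = j.val
  | .inr (.inr i), .inr (.inr j) => i.val + 1 = j.val
  | .inl i, .inr (.inl j) => i.val = 0 ∧ j.val + 1 = a
  | .inr (.inl j), .inl i => j.val = 0 ∧ i.val = 0
  | .inl i, .inr (.inr j) => i.val + 1 = n ∧ j.val + 1 = b
  | .inr (.inr j), .inl i => j.val = 0 ∧ i.val + 1 = n
  | .inr (.inl _), .inr (.inr _) => False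
  | .inr (.inr _), .inr (.inl _) => False

/-- `P_α` for a curve that crosses arcs of `T`. The chain attached at a notched end consists of
all ends of arcs at this puncture, ordered counterclockwise around it, starting from `α`. -/
noncomputable def crossPoset (g : H) (ts : List Turn) (s f : Tag) : LabeledOrder T.Edge :=
  let c := T.prev g
  let c' := T.prev (T.twin (T.lastCrossing g ts))
  LabeledOrder.generate
    (X := Fin (ts.length + 1) ⊕ (Fin (chainSize (T.degree c) s) ⊕ Fin (chainSize (T.degree c') f)))
    (crossRel ts) fun
      | .inl i => T.edge (T.crossingAt g ts i)
      | .inr (.inl i) => T.edge (T.rot^[i + 1] c)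
      | .inr (.inr i) => T.edge (T.rot^[i + 1] c')

/-- The relations of `P_α` when `α` coincides with an arc up to tags. Elements: for `d = 2`, a
minimum and a maximum (for `d = 0` there are none); two chains of sizes `a` and `b`. The bottom
element of each chain is below the top element of the other one. -/
def sideRel {d a b : ℕ} : Fin d ⊕ (Fin a ⊕ Fin b) → Fin d ⊕ (Fin a ⊕ Fin b) → Prop
  | .inl i, .inl j => i.val = 0 ∧ j.val = 1
  | .inl i, .inr _ => i.val = 0
  | .inr _, .inl i => i.val = 1
  | .inr (.inl i), .inr (.inl j) => i.val + 1 = j.val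
  | .inr (.inr i), .inr (.inr j) => i.val + 1 = j.val
  | .inr (.inl i), .inr (.inr j) => i.val = 0 ∧ j.val + 1 = b
  | .inr (.inr j), .inr (.inl i) => j.val = 0 ∧ i.val + 1 = a

/-- The number of elements of `P_α` labeled by `β`, when `α` coincides with `β` up to tags. -/
def extremeSize : Tag → Tag → ℕ
  | .notched, .notched => 2
  | _, _ => 0

/-- `P_α` for a curve that coincides, up to tags, with the edge `β` that contains `h`. It is empty
if both ends are plain. If one end is notched, it is the chain of all ends of arcs at
this puncture except that of `β`, ordered counterclockwise starting from `β`. If both are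
notched, it consists of the two chains, which go from `β` around each puncture back to `β`,
with their minima identified and their maxima identified (both labeled by `β`), and with two
additional relations, between the atom of each chain and the coatom of the other. -/
noncomputable def sidePoset (h : H) (s f : Tag) : LabeledOrder T.Edge :=
  let c' := T.twin h
  LabeledOrder.generate
    (X := Fin (extremeSize s f) ⊕
      (Fin (chainSize (T.degree h - 1) s) ⊕ Fin (chainSize (T.degree c' - 1) f)))
    sideRel fun
      | .inl _ => T.edge h
      | .inr (.inl i) => T.edge (T.rot^[i + 1] h)
      | .inr (.inr i) => T.edge (T.rot^[i + 1] c')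

/-- The labeled poset `P_α`: an element labeled by the arc `β` has the weight `ŷ_β`. (There are no
self-folded triangles, so that no other weights occur. For a boundary segment it is empty.) -/
noncomputable def poset (α : TaggedCurve H) : LabeledOrder T.Edge :=
  match α.curve with
  | .side h => T.sidePoset h α.startTag α.finishTag
  | .cross g ts => T.crossPoset g ts α.startTag α.finishTag

/-! ### The variables -/

section Variables

/-- The field of rational functions in variables `x_β` and `y_β`. (Only the variables of arcs are
used, not those of boundary segments.) -/
abbrev RatFunc : Type _ := FractionRing (MvPolynomial (T.Edge ⊕ T.Edge) ℚ)

/-- The initial cluster variables. -/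
noncomputable def x (β : T.Edge) : T.RatFunc :=
  algebraMap (MvPolynomial (T.Edge ⊕ T.Edge) ℚ) _ (MvPolynomial.X (.inl β))

/-- The tropical variables. -/
noncomputable def y (β : T.Edge) : T.RatFunc :=
  algebraMap (MvPolynomial (T.Edge ⊕ T.Edge) ℚ) _ (MvPolynomial.X (.inr β))

/-- The signed adjacency matrix (without self-folded triangles): a triangle with sides `β` and `γ`
contributes `1` to `b_{βγ}` if `γ` follows `β` in clockwise order, and `-1` if `γ` follows `β`
in counterclockwise order. -/
noncomputable def b (β γ : T.Edge) : ℤ :=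
  (Set.ncard {h : H | T.edge h = γ ∧ T.edge (T.next h) = β} : ℤ) -
    (Set.ncard {h : H | T.edge h = γ ∧ T.edge (T.prev h) = β} : ℤ)

noncomputable instance [Finite H] : Fintype T.Edge :=
  haveI : Finite T.Edge := Finite.of_surjective T.edge Quot.mk_surjective
  Fintype.ofFinite _

open scoped Classical in
/-- `ŷ_γ = y_γ ∏_β x_β ^ b_{βγ}`, the product being over all arcs `β` of `T`. -/
noncomputable def yhat [Finite H] (γ : T.Edge) : T.RatFunc :=
  T.y γ * ∏ β : T.Edge with T.IsArc β, T.x β ^ T.b β γ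

end Variables

/-! ### Elementary laminations -/

end Triangulation

/-- A curve that is infinite in both directions: it crosses `base`, leaving a triangle through this
side; `turn i` is its turn between its `i`-th and its `(i + 1)`-st crossing, the crossing of
`base` having number `0`. It stops where it meets the boundary. -/
structure Lamination (H : Type*) where
  base : H
  turn : ℤ → Turn

namespace Triangulation

variable {H : Type*} (T : Triangulation H)

/-- The side of crossing number `n`. -/
def forwardAt (L : Lamination H) : ℕ → H
  | 0 => L.base
  | n + 1 => T.exit (T.twin (forwardAt L n)) (L.turn n)

/-- The side of crossing number `-n` (traversed in the forward direction). -/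
def backwardAt (L : Lamination H) : ℕ → H
  | 0 => L.base
  | n + 1 => T.twin (T.exit (backwardAt L n) (L.turn (-(n + 1 : ℤ))).flip)

/-- The side of crossing number `i`. -/
def sideAt (L : Lamination H) : ℤ → H
  | .ofNat n => T.forwardAt L n
  | .negSucc n => T.backwardAt L (n + 1)

/-- The crossing number `i` is reached before the curve stops at the boundary. -/
def IsCrossing (L : Lamination H) (i : ℤ) : Prop :=
  ∀ j ∈ Set.uIcc 0 i, ¬ T.IsBoundary (T.sideAt L j)

open scoped Classical in
/-- The elementary lamination of the arc that contains the side `d`, with its spirals at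
the punctures in `R` reversed. It runs along the arc and near each endpoint it turns slightly to
the right (as seen by someone walking towards that endpoint) to end on a boundary segment or to
spiral counterclockwise into a puncture, that is, with the endpoint on its left; at an endpoint in
`R` it does so with left and right exchanged. If no spiral is reversed or both are, the curve
crosses the arc, on both sides then always turning to the same hand. If only one spiral is reversed,
then, next to the arc, the curve passes through the triangle on one side of the arc, crossing there
the other two edges. -/
noncomputable def elementary (R : Set T.Vertex) (d : H) : Lamination H :=
  if T.vertex d ∈ R then
    if T.vertex (T.next d) ∈ R then ⟨d, fun i => if 0 ≤ i then .right else .left⟩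
    else ⟨T.next (T.twin d), fun i => if i = -1 then .left else .right⟩
  else
    if T.vertex (T.next d) ∈ R then ⟨T.next d, fun i => if i = -1 then .left else .right⟩
    else ⟨d, fun i => if 0 ≤ i then .left else .right⟩

/-! ### Exchange relations -/

/-- A crossing of a curve with the arc `γ`, as seen from `γ`: the curve leaves a triangle through
its side `e`, which lies on `γ`; the turns from there to the end of the curve are `fwd`, and the
turns going back from there to its start are `bwd`.

The curve and `γ` are the diagonals of a quadrilateral. A curve issuing from `γ` to a side of it
sees one endpoint of `γ` on its left and one on its right. The pair of opposite sides of *left*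
hand consists of the side between the end of the curve and the endpoint of `γ` on the left looking
to the end, and the side between the start of the curve and the endpoint of `γ` on the left
looking to the start; similarly for the right hand. -/
structure Diagonal (H : Type*) where
  e : H
  fwd : List Turn
  bwd : List Turn

/-- The diagonal given by the crossing number `k` of the curve `cross g ts`. -/
def diagonalAt (g : H) (ts : List Turn) (k : ℕ) : Diagonal H where
  e := T.crossingAt g ts k
  fwd := ts.drop k
  bwd := (ts.take k).reverse.map Turn.flip

/-- An arc is entered through the side `h` of a triangle and a path with turns `ts` leads
from there to the vertex opposite to the last side crossed. `fanSide hand h ts tag` is the curve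
from the endpoint of `h` on the given hand (plain there) to the end of that path
(tagged by `tag` there), which follows the path, pulled tight: as long as the path goes
around the starting point of the curve, nothing is crossed. -/
def fanSide (hand : Turn) (h : H) (ts : List Turn) (tag : Tag) : TaggedCurve H :=
  match hand, ts with
  | .left, [] => ⟨.side (T.prev h), tag, .plain⟩
  | .right, [] => ⟨.side (T.next h), .plain, tag⟩
  | .left, .left :: ts => fanSide .left (T.twin (T.prev h)) ts tag
  | .right, .right :: ts => fanSide .right (T.twin (T.next h)) ts tag
  | .left, .right :: ts => ⟨.cross (T.next h) ts, .plain, tag⟩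
  | .right, .left :: ts => ⟨.cross (T.prev h) ts, .plain, tag⟩

/-- A path with turns `ts` that ends at the vertex opposite to the last side crossed, and an infinite
path with turns `r`, both starting from the same side. The hand on which the infinite path finally
leaves the finite path. -/
def leavingHand (r : ℕ → Turn) : List Turn → Turn
  | [] => r 0
  | .left :: ts => match r 0 with
    | .left => leavingHand (fun n => r (n + 1)) ts
    | .right => .right
  | .right :: ts => match r 0 with
    | .right => leavingHand (fun n => r (n + 1)) ts
    | .left => .left

/-- The turns of `L` after its crossing number `i`. -/
def turnsAfter (L : Lamination H) (i : ℤ) (n : ℕ) : Turn := L.turn (i + n)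

/-- The turns of `L` going back from its crossing number `i`. -/
def turnsBefore (L : Lamination H) (i : ℤ) (n : ℕ) : Turn := (L.turn (i - 1 - n)).flip

/-- The crossings of `L` with `γ` at which it passes through the whole quadrilateral with diagonals
`D` and `γ` from one of the two opposite sides of the given hand to the other one: on both sides of
`γ` the curve `L` leaves the diagonal `D` on this hand. (`L` may traverse `γ` in the direction of
`D` or in the opposite direction.) -/
def oppositeCrossings (D : Diagonal H) (hand : Turn) (L : Lamination H) : Set ℤ :=
  {i | T.IsCrossing L i ∧
    ((T.sideAt L i = D.e ∧ leavingHand (turnsAfter L i) D.fwd = hand ∧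
        leavingHand (turnsBefore L i) D.bwd = hand) ∨
      (T.sideAt L i = T.twin D.e ∧ leavingHand (turnsAfter L i) D.bwd = hand ∧
        leavingHand (turnsBefore L i) D.fwd = hand))}

/-- The loop that follows a curve `α` almost to its end, a puncture `p`, goes counterclockwise
around `p`, and returns along `α` to the start of `α`: its first crossing and its turns. -/
noncomputable def loopAroundFinish : Curve H → H × List Turn
  | .side h => (T.prev (T.twin h), List.replicate (T.degree (T.twin h) - 2) .left)
  | .cross g ts =>
    (g, ts ++ .right :: (List.replicate
        (T.degree (T.prev (T.twin (T.lastCrossing g ts))) - 1) .left ++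
      .right :: ts.reverse.map Turn.flip))

/-- The arc `γ` of `T` (tagged plain) and the tagged arc `α` can be exchanged: either
they cross exactly once and have the same tags at common endpoints, or they do not
cross and do not coincide up to tags, have different tags at a common endpoint, and have the same
tag at the other endpoint if they share it as well. -/
def Exchangeable (α : TaggedCurve H) (γ : T.Edge) : Prop :=
  ((∃! k : ℕ, ((T.crossings α.curve).map T.edge)[k]? = some γ) ∧
    (T.HasEndpoint γ (T.start α.curve) → α.startTag = .plain) ∧
    (T.HasEndpoint γ (T.finish α.curve) → α.finishTag = .plain)) ∨
  (γ ∉ (T.crossings α.curve).map T.edge ∧ ¬ T.Coincides α.curve γ ∧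
    ((T.HasEndpoint γ (T.start α.curve) ∧ α.startTag = .notched ∧
        (T.HasEndpoint γ (T.finish α.curve) → α.finishTag = .plain)) ∨
      (T.HasEndpoint γ (T.finish α.curve) ∧ α.finishTag = .notched ∧
        (T.HasEndpoint γ (T.start α.curve) → α.startTag = .plain))))

/-- The data of the exchange relation of `α` and `γ`: the curve which together with `γ` forms
the diagonals of the quadrilateral; the set of marked points where spirals of the
elementary laminations are reversed; and the (not dotted) colored arcs of each hand. -/
structure Exchange where
  diagonal : Diagonal H
  reversed : Set T.Vertex
  arcs : Turn → List (TaggedCurve H)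

/-- `X` is the exchange relation of `α` and `γ`.

* `crossing`: if `α` and `γ` cross, then they are the diagonals of a quadrilateral. Its sides at a
  notched end of `α` are notched there, and the spirals are reversed there.
* `common_end`: suppose that `α` and `γ` have a common endpoint `p` where `α` is notched. Going
  through `α` in the suitable direction, `p` is the end of `α`. The loop
  at the start of `α` around `p` and `γ` are the diagonals of a quadrilateral with one vertex at `p`.
  The two sides at `p` coincide with `α` up to tags; they are the dotted arcs. The other two sides,
  which together bound a digon around `p`, are the colored arcs. The side of left hand is found
  looking from `γ` back to the start of the loop (because `p` is to the left of the loop, the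
  side of left hand looking to the end of the loop is one at `p`). Spirals are only
  reversed at the endpoint of `α` that is not shared, if `α` is notched there. -/
inductive IsExchange (α : TaggedCurve H) (γ : T.Edge) : T.Exchange → Prop
  | crossing (g : H) (ts : List Turn) (k : ℕ) (hα : α.curve = .cross g ts) (hk : k ≤ ts.length)
      (hγ : T.edge (T.crossingAt g ts k) = γ) :
      IsExchange α γ
        { diagonal := T.diagonalAt g ts k
          reversed := {v | (α.startTag = .notched ∧ v = T.start α.curve) ∨
            (α.finishTag = .notched ∧ v = T.finish α.curve)}
          arcs := fun hand =>
            let D := T.diagonalAt g ts k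
            [T.fanSide hand (T.twin D.e) D.fwd α.finishTag, T.fanSide hand D.e D.bwd α.startTag] }
  | common_end (α' : TaggedCurve H) (hα : α' = α ∨ α' = T.reverse α)
      (hp : T.HasEndpoint γ (T.finish α'.curve)) (hn : α'.finishTag = .notched)
      (g : H) (ts : List Turn) (k : ℕ) (hl : T.loopAroundFinish α'.curve = (g, ts))
      (hk : k ≤ ts.length) (hγ : T.edge (T.crossingAt g ts k) = γ) :
      IsExchange α γ
        { diagonal := T.diagonalAt g ts k
          reversed := {v | α'.startTag = .notched ∧ v = T.start α'.curve}
          arcs := fun hand =>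
            let D := T.diagonalAt g ts k
            match hand with
            | .left => [T.fanSide .left D.e D.bwd α'.startTag]
            | .right => [T.fanSide .right (T.twin D.e) D.fwd α'.startTag] }

/-- The hand of the blue sides. The convention on colors is that no elementary lamination of an arc
of `T` crosses the quadrilateral from red to red. As the elementary lamination of `γ` crosses
it between the two opposite sides of left hand, these are the blue ones. -/
def _root_.TidyExchange.Turn.blue : Turn := .left

/-- The hand of the red sides. -/
def _root_.TidyExchange.Turn.red : Turn := .right

namespace Exchange

variable {T}

/-- The crossings at which the elementary lamination of the arc containing the side `d` passes
through the quadrilateral between the opposite sides of the given hand. -/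
def laminationCrossings (X : T.Exchange) (hand : Turn) (d : H) : Set ℤ :=
  T.oppositeCrossings X.diagonal hand (T.elementary X.reversed d)

/-- The disjoint union of the posets of the arcs of the given hand. -/
noncomputable def poset (X : T.Exchange) (hand : Turn) : LabeledOrder T.Edge :=
  ((X.arcs hand).map T.poset).foldr LabeledOrder.disjointUnion LabeledOrder.empty

/-- The elementary lamination of `δ` has a blue-purple-blue crossing with the quadrilateral. -/
def IsOrange (X : T.Exchange) (δ : T.Edge) : Prop :=
  ∃ d, T.edge d = δ ∧ ¬ T.IsBoundary d ∧ (X.laminationCrossings .blue d).Nonempty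

open scoped Classical in
/-- `ŷ_orange` -/
noncomputable def yhatOrange [Finite H] (X : T.Exchange) : T.RatFunc :=
  ∏ δ : T.Edge with X.IsOrange δ, T.yhat δ

end Exchange

end Triangulation

end TidyExchange

open TidyExchange

namespace TidyExchange

/-! Let `c` be the element of `P_α` labeled `γ`. An order ideal that misses `c` is an ideal of what
is left after deleting the elements above `c`. An ideal that contains `c` is the principal ideal of
`c` together with an ideal of what is left after deleting that principal ideal. So the identities
between sums (`F_of_iso_not_above`, `F_of_iso_not_below`, `F_eq_add`) follow once three things are
known: the blue arcs give the complement of the up-set of `c`, the red arcs give the complement of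
its down-set, and the labels of the down-set are the orange arcs, each occurring once.
`IsResolution` collects these facts.

Posets at a crossing. The arc `γ` cuts `α` into two halves, and `P_α` without `c` into two arms. A
side of left hand starts at an endpoint of `γ` and follows one half of `α`. While this half turns
left it circles that endpoint, and the side, pulled tight, crosses nothing; in `P_α` these crossings
climb up from `c` and are deleted. At the first right turn the half steps down, and everything from
there on is down-closed: it is the poset of the side. If no right turn comes, all crossings of the
half lie above `c`, and so does the top of a chain at a notched end; the rest of that chain is the
poset of an arc of `T` with one notched end. The right hand is the same upside down. See
`isLowerArm_after` and `isUpperArm_after`; the other half follows by reversing the curve.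

Posets at a common end. Now `c` belongs to the chain at the shared puncture. From `γ`, the loop runs
down the chain in one direction and up the chain in the other, and then goes on along `α`. So the
blue arc crosses the ends of arcs below `γ` and then what `α` crosses (`isLowerArm_chain`); dually
for red (`isUpperArm_chain`). If `α` lies on an arc `β` of `T`, the colored arc ends at the other
endpoint of `β`. If that end is notched, its chain of ends is the first chain of `P_α` with the
minimum or the maximum joined to it, and the additional relations between atoms and coatoms are
exactly those between this chain and the last crossing (`isLowerArm_side`, `isUpperArm_side`).

Laminations. Suppose that no spiral is reversed. From a crossing with `γ`, the elementary lamination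
of `δ` turns left for ever in one direction; in the other it turns right until it has met `δ`, and
left from then on. Hence it never crosses from red to red, and it crosses from blue to blue exactly
when the diagonal, starting at `γ`, turns right until it meets `δ`: that is the descending run below
`c`. At an endpoint where spirals are reversed the same analysis yields one further arc, when the
run goes on to this endpoint; it labels the next element below `c`. These are the positions `IsLow`.
The lemma `exists_elementary_iff` relates them to laminations, and `IsLowArm` relates them to
elements below `c`.

Tidiness makes the labels below `c` distinct, which gives at most one crossing for each lamination.
Antisymmetry comes from rank functions; the one configuration without a rank, a doubly notched arc
both of whose chains have one element, occurs only on the sphere with three punctures. -/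

lemma Turn.flip_flip (t : Turn) : t.flip.flip = t := by cases t <;> rfl

namespace Triangulation

variable {H : Type*} (T : Triangulation H)

/-! ### Sides, edges and vertices -/

@[simp] lemma next_prev (h : H) : T.next (T.prev h) = h := T.next_next_next h

@[simp] lemma prev_next (h : H) : T.prev (T.next h) = h := T.next_next_next h

@[simp] lemma prev_prev (h : H) : T.prev (T.prev h) = T.next h :=
  congrArg T.next (T.next_next_next h)

lemma next_next (h : H) : T.next (T.next h) = T.prev h := rfl

@[simp] lemma twin_twin' (h : H) : T.twin (T.twin h) = h := T.twin_twin h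

lemma twin_injective : Function.Injective T.twin := fun a b h => by
  rw [← T.twin_twin a, h, T.twin_twin]

lemma exit_exit_flip (x : H) (t : Turn) : T.exit (T.exit x t) t.flip = x := by
  cases t <;> simp [exit, Turn.flip]

lemma isBoundary_twin {h : H} : T.IsBoundary (T.twin h) ↔ T.IsBoundary h := by
  simp only [IsBoundary, twin_twin]
  exact eq_comm

/-- One step clockwise around the marked point at the corner `h`. -/
def unrot (h : H) : H := T.next (T.twin h)

@[simp] lemma rot_unrot (h : H) : T.rot (T.unrot h) = h := by simp [rot, unrot]

@[simp] lemma unrot_rot (h : H) : T.unrot (T.rot h) = h := by simp [rot, unrot]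

lemma rot_injective : Function.Injective T.rot := Function.LeftInverse.injective T.unrot_rot

lemma unrot_iterate_rot_iterate (n : ℕ) (h : H) : T.unrot^[n] (T.rot^[n] h) = h :=
  Function.LeftInverse.iterate T.unrot_rot n h

lemma rot_iterate_unrot_iterate (n : ℕ) (h : H) : T.rot^[n] (T.unrot^[n] h) = h :=
  Function.LeftInverse.iterate T.rot_unrot n h

lemma rot_iterate_eq_iff {n : ℕ} {a b : H} : T.rot^[n] a = b ↔ a = T.unrot^[n] b :=
  ⟨fun h => by rw [← h, unrot_iterate_rot_iterate], fun h => by rw [h, rot_iterate_unrot_iterate]⟩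

lemma unrot_iterate_rot_iterate_of_le {m n : ℕ} (hmn : m ≤ n) (h : H) :
    T.unrot^[m] (T.rot^[n] h) = T.rot^[n - m] h := by
  obtain ⟨k, rfl⟩ := Nat.exists_eq_add_of_le hmn
  rw [Function.iterate_add_apply, unrot_iterate_rot_iterate, Nat.add_sub_cancel_left]

lemma edge_eq_iff {a b : H} : T.edge a = T.edge b ↔ b = a ∨ b = T.twin a := by
  constructor
  · intro h
    have h' := Quot.eqvGen_exact h
    induction h' with
    | rel x y hxy => exact .inr hxy
    | refl x => exact .inl rfl
    | symm x y _ ih =>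
      rcases ih (Quot.eqvGen_sound ‹_›) with rfl | rfl
      · exact .inl rfl
      · exact .inr (by simp)
    | trans x y z h1 h2 ih1 ih2 =>
      rcases ih1 (Quot.eqvGen_sound h1) with rfl | rfl <;>
        rcases ih2 (Quot.eqvGen_sound h2) with rfl | rfl <;> simp
  · rintro (rfl | rfl)
    · rfl
    · exact Quot.sound rfl

@[simp] lemma edge_twin (a : H) : T.edge (T.twin a) = T.edge a :=
  (T.edge_eq_iff.2 (.inr rfl)).symm

lemma vertex_unrot {a : H} (ha : ¬ T.IsBoundary a) : T.vertex (T.unrot a) = T.vertex a :=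
  (Quot.sound ⟨ha, rfl⟩ : T.vertex a = T.vertex (T.unrot a)).symm

lemma vertex_twin {a : H} (ha : ¬ T.IsBoundary a) : T.vertex (T.twin a) = T.vertex (T.next a) := by
  have := T.vertex_unrot (a := T.twin a) (by rwa [isBoundary_twin])
  rw [← this]; simp [unrot]

lemma vertex_next_twin {a : H} (ha : ¬ T.IsBoundary a) :
    T.vertex (T.next (T.twin a)) = T.vertex a := T.vertex_unrot ha

lemma vertex_rot {a : H} (ha : ¬ T.IsBoundary (T.prev a)) : T.vertex (T.rot a) = T.vertex a := by
  simp [rot, T.vertex_twin ha]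

/-- Rotation about the marked points, as a permutation of the corners. -/
def rotPerm : Equiv.Perm H := ⟨T.rot, T.unrot, T.unrot_rot, T.rot_unrot⟩

/-- Each generating identification of corners is one inverse rotation, so corners at one marked
point lie in one cycle of `rotPerm`. Finiteness makes the exponent a natural number. -/
lemma exists_rot_iterate [Finite H] {a b : H} (h : T.vertex a = T.vertex b) :
    ∃ n, T.rot^[n] a = b := by
  have key : T.rotPerm.SameCycle a b := by
    have h' := Quot.eqvGen_exact h
    clear h
    induction h' with
    | rel x y hxy => exact ⟨-1, by rw [hxy.2]; rfl⟩
    | refl x => exact .refl _ _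
    | symm x y _ ih => exact ih.symm
    | trans x y z _ _ ih1 ih2 => exact ih1.trans ih2
  obtain ⟨n, hn⟩ := key.exists_nat_pow_eq
  refine ⟨n, ?_⟩
  rw [← hn, Equiv.Perm.coe_pow]; rfl

lemma rot_iterate_degree (c : H) : T.rot^[T.degree c] c = c := Function.iterate_minimalPeriod

lemma degree_pos [Finite H] (c : H) : 0 < T.degree c :=
  Function.minimalPeriod_pos_of_mem_periodicPts (T.rot_injective.mem_periodicPts c)

/-- The shift by one is that of the chains in `P_α`, whose element number `i` is the end `rot^[i +
1] c`. -/
lemma rot_iterate_inj {c : H} {i j : ℕ} (hi : i < T.degree c) (hj : j < T.degree c)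
    (h : T.rot^[i + 1] c = T.rot^[j + 1] c) : i = j := by
  rw [Function.iterate_succ_apply', Function.iterate_succ_apply'] at h
  exact Function.iterate_injOn_Iio_minimalPeriod hi hj (T.rot_injective h)

lemma degree_rot (c : H) : T.degree (T.rot c) = T.degree c := by
  by_cases h : c ∈ Function.periodicPts T.rot
  · exact Function.minimalPeriod_apply h
  · have h' : T.rot c ∉ Function.periodicPts T.rot := by
      rintro ⟨n, hn, hp⟩
      refine h ⟨n, hn, T.rot_injective ?_⟩
      have hp' : T.rot^[n] (T.rot c) = T.rot c := hp
      rwa [← Function.iterate_succ_apply, Function.iterate_succ_apply'] at hp'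
    simp [degree, Function.minimalPeriod, h, h']

lemma degree_unrot (c : H) : T.degree (T.unrot c) = T.degree c := by
  rw [← degree_rot, rot_unrot]

lemma IsPuncture.vertex_rot_iterate {T : Triangulation H} {c : H} (hc : T.IsPuncture (T.vertex c))
    (n : ℕ) : T.vertex (T.rot^[n] c) = T.vertex c := by
  induction n with
  | zero => rfl
  | succ n ih =>
    rw [Function.iterate_succ_apply', T.vertex_rot (hc _ ih).2, ih]

lemma IsPuncture.exists_rot_iterate [Finite H] {T : Triangulation H} {a c : H}
    (hac : T.vertex a = T.vertex c) : ∃ j < T.degree c, T.rot^[j + 1] c = a := by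
  have hd := T.degree_pos c
  obtain ⟨n, rfl⟩ := T.exists_rot_iterate hac.symm
  -- The index is `n - 1` modulo the degree; adding the degree first keeps the natural subtraction
  -- from truncating at `n = 0`.
  refine ⟨(n + T.degree c - 1) % T.degree c, Nat.mod_lt _ hd, ?_⟩
  have h1 : T.rot^[(n + T.degree c - 1) % T.degree c] c = T.rot^[n + T.degree c - 1] c :=
    Function.iterate_mod_minimalPeriod_eq
  rw [Function.iterate_succ_apply', h1, ← Function.iterate_succ_apply' T.rot,
    Nat.succ_eq_add_one, Nat.sub_add_cancel (by omega), Function.iterate_add_apply,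
    rot_iterate_degree]

/-- An arc has at most one end at a given marked point. -/
lemma eq_of_edge_eq_of_vertex_eq (hv : ∀ h, T.vertex h ≠ T.vertex (T.next h)) {a b : H}
    (ha : ¬ T.IsBoundary a) (he : T.edge a = T.edge b) (h : T.vertex a = T.vertex b) : a = b := by
  rcases T.edge_eq_iff.1 he with rfl | rfl
  · rfl
  · rw [T.vertex_twin ha] at h
    exact absurd h (hv a)

/-- If a single rotation returned to the corner, the two sides of the triangle at this corner would
be glued to each other and form one edge. -/
lemma two_le_degree [Finite H] (he : ∀ h, T.edge h ≠ T.edge (T.next h)) (c : H) :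
    2 ≤ T.degree c := by
  have h0 := T.degree_pos c
  by_contra h
  have h1 : T.degree c = 1 := by omega
  have := T.rot_iterate_degree c
  rw [h1] at this
  refine he (T.prev c) ?_
  rw [next_prev, ← T.edge_twin (T.prev c)]
  exact congrArg T.edge this

/-! ### Sequences of crossings -/

@[simp] lemma crossingAt_zero (g : H) (ts : List Turn) : T.crossingAt g ts 0 = g := by
  simp [crossingAt]

lemma crossingAt_cons_succ (g : H) (t : Turn) (ts : List Turn) (k : ℕ) :
    T.crossingAt g (t :: ts) (k + 1) = T.crossingAt (T.exit (T.twin g) t) ts k := by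
  simp [crossingAt]

lemma crossingAt_succ {g : H} {ts : List Turn} {k : ℕ} {t : Turn} (h : ts[k]? = some t) :
    T.crossingAt g ts (k + 1) = T.exit (T.twin (T.crossingAt g ts k)) t := by
  simp [crossingAt, List.take_add_one, h]

lemma crossingAt_append_left (g : H) (ts us : List Turn) {k : ℕ} (h : k ≤ ts.length) :
    T.crossingAt g (ts ++ us) k = T.crossingAt g ts k := by
  simp [crossingAt, List.take_append_of_le_length h]

lemma crossingAt_append_right (g : H) (ts us : List Turn) (k : ℕ) :
    T.crossingAt g (ts ++ us) (ts.length + k) = T.crossingAt (T.lastCrossing g ts) us k := by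
  simp [crossingAt, lastCrossing, List.take_append, List.take_of_length_le]

lemma crossingAt_drop (g : H) (ts : List Turn) {k : ℕ} (h : k ≤ ts.length) (j : ℕ) :
    T.crossingAt (T.crossingAt g ts k) (ts.drop k) j = T.crossingAt g ts (k + j) := by
  have h1 := T.crossingAt_append_right g (ts.take k) (ts.drop k) j
  rw [List.take_append_drop, List.length_take, min_eq_left h] at h1
  rw [h1]; simp [lastCrossing, crossingAt, h, List.take_take]

lemma lastCrossing_drop (g : H) (ts : List Turn) {k : ℕ} (h : k ≤ ts.length) :
    T.lastCrossing (T.crossingAt g ts k) (ts.drop k) = T.lastCrossing g ts := by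
  rw [lastCrossing, T.crossingAt_drop g ts h, lastCrossing, List.length_drop]
  congr 1; omega

lemma lastCrossing_append_cons (g : H) (ts us : List Turn) (t : Turn) :
    T.lastCrossing g (ts ++ t :: us) =
      T.lastCrossing (T.exit (T.twin (T.lastCrossing g ts)) t) us := by
  rw [lastCrossing, List.length_append, crossingAt_append_right, List.length_cons,
    crossingAt_cons_succ, lastCrossing, lastCrossing]

/-- Right turns circle the source of the side that is crossed first, clockwise; left turns circle
its target counterclockwise, which is why the next lemma speaks of the twins of the crossed sides.
-/
lemma crossingAt_right_run {g : H} {ts : List Turn} {m : ℕ}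
    (h : List.replicate m Turn.right <+: ts) : T.crossingAt g ts m = T.unrot^[m] g := by
  obtain ⟨us, rfl⟩ := h
  rw [crossingAt_append_left _ _ _ _ (by simp)]
  induction m generalizing g with
  | zero => simp
  | succ m ih =>
    rw [List.replicate_succ, crossingAt_cons_succ, ih]; rfl

lemma twin_crossingAt_left_run {g : H} {ts : List Turn} {m : ℕ}
    (h : List.replicate m Turn.left <+: ts) :
    T.twin (T.crossingAt g ts m) = T.rot^[m] (T.twin g) := by
  obtain ⟨us, rfl⟩ := h
  rw [crossingAt_append_left _ _ _ _ (by simp)]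
  induction m generalizing g with
  | zero => simp
  | succ m ih =>
    rw [List.replicate_succ, crossingAt_cons_succ, ih]; rfl

/-- Entering a triangle where a turn left it and turning to the other hand leads out where the turn
came in (`exit_exit_flip`); this is applied one triangle at a time. -/
lemma crossingAt_reverse (g : H) (ts : List Turn) {k : ℕ} (h : k ≤ ts.length) :
    T.crossingAt (T.twin (T.lastCrossing g ts)) (ts.reverse.map Turn.flip) k =
      T.twin (T.crossingAt g ts (ts.length - k)) := by
  induction k with
  | zero => simp [lastCrossing]
  | succ k ih =>
    obtain ⟨j, hj⟩ := Nat.exists_eq_add_of_le h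
    have h1 : ts.length - k = j + 1 := by omega
    have h2 : ts.length - (k + 1) = j := by omega
    have h3 : j < ts.length := by omega
    have h4 : (ts.reverse.map Turn.flip)[k]? = some (ts[j].flip) := by
      rw [List.getElem?_map, List.getElem?_reverse (by omega)]
      have : ts.length - 1 - k = j := by omega
      rw [this, List.getElem?_eq_getElem h3]; rfl
    rw [T.crossingAt_succ h4, ih (by omega), h1, h2,
      T.crossingAt_succ (List.getElem?_eq_getElem h3), twin_twin', exit_exit_flip]

lemma lastCrossing_reverse (g : H) (ts : List Turn) :
    T.lastCrossing (T.twin (T.lastCrossing g ts)) (ts.reverse.map Turn.flip) = T.twin g := by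
  have := T.crossingAt_reverse g ts le_rfl
  simpa [lastCrossing] using this

lemma mem_crossingList {g : H} {ts : List Turn} {x : H} :
    x ∈ T.crossingList g ts ↔ ∃ k ≤ ts.length, T.crossingAt g ts k = x := by
  simp [crossingList]

lemma edge_crossingAt_inj {g : H} {ts : List Turn}
    (h : ((T.crossingList g ts).map T.edge).Nodup) {i j : ℕ} (hi : i ≤ ts.length)
    (hj : j ≤ ts.length) (hij : T.edge (T.crossingAt g ts i) = T.edge (T.crossingAt g ts j)) :
    i = j := by
  rw [crossingList, List.map_map] at h
  exact (List.inj_on_of_nodup_map h) (List.mem_range.2 (by omega)) (List.mem_range.2 (by omega)) hij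

end Triangulation

namespace LabeledOrder

variable {A : Type*}

/-! ### Isomorphisms of labeled orders -/

/-- The opposite order. -/
def dual (P : LabeledOrder A) : LabeledOrder A where
  carrier := P.carrier
  fintype := P.fintype
  le x y := P.le y x
  refl := P.refl
  trans x y z hxy hyz := P.trans z y x hyz hxy
  label := P.label

/-- A bijection that preserves order and labels. -/
def IsIsom {P Q : LabeledOrder A} (f : P.carrier ≃ Q.carrier) : Prop :=
  (∀ x y, Q.le (f x) (f y) ↔ P.le x y) ∧ ∀ x, Q.label (f x) = P.label x

lemma IsIsom.symm {P Q : LabeledOrder A} {f : P.carrier ≃ Q.carrier} (h : IsIsom f) :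
    IsIsom (P := Q) (Q := P) f.symm :=
  ⟨fun x y => by rw [← h.1, f.apply_symm_apply, f.apply_symm_apply],
    fun x => by rw [← h.2, f.apply_symm_apply]⟩

lemma Iso.symm {P Q : LabeledOrder A} (h : P.Iso Q) : Q.Iso P :=
  let ⟨f, hf⟩ := h; ⟨f.symm, IsIsom.symm hf⟩

lemma Iso.trans {P Q R : LabeledOrder A} (h : P.Iso Q) (h' : Q.Iso R) : P.Iso R :=
  let ⟨f, hf, hl⟩ := h
  let ⟨g, hg, hl'⟩ := h'
  ⟨f.trans g, fun x y => (hg _ _).trans (hf x y), fun x => (hl' _).trans (hl x)⟩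

lemma IsIsom.iso_restrict {P Q : LabeledOrder A} {f : P.carrier ≃ Q.carrier} (h : IsIsom f)
    {S : P.carrier → Prop} {S' : Q.carrier → Prop} (hS : ∀ x, S x ↔ S' (f x)) :
    (P.restrict S).Iso (Q.restrict S') :=
  ⟨f.subtypeEquiv hS, fun x y => h.1 x.1 y.1, fun x => h.2 x.1⟩

/-- A function that increases strictly along the generating relations leaves no room for a cycle. -/
lemma isPoset_generate {X : Type} [Fintype X] {r : X → X → Prop} {label : X → A} (rank : X → ℤ)
    (h : ∀ x y, r x y → rank x < rank y) : (generate r label).IsPoset := by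
  have key : ∀ x y, Relation.ReflTransGen r x y → x = y ∨ rank x < rank y := by
    intro x y hxy
    induction hxy with
    | refl => exact .inl rfl
    | tail _ hbc ih =>
      have := h _ _ hbc
      rcases ih with rfl | ih
      · exact .inr this
      · exact .inr (ih.trans this)
  intro x y hxy hyx
  rcases key _ _ hxy with h1 | h1
  · exact h1
  · rcases key _ _ hyx with h2 | h2
    · exact h2.symm
    · exact absurd (h1.trans h2) (lt_irrefl _)

lemma isIsom_generate {X Y : Type} [Fintype X] [Fintype Y] {r : X → X → Prop} {r' : Y → Y → Prop}
    {label : X → A} {label' : Y → A} (f : X ≃ Y) (h : ∀ x y, r x y ↔ r' (f x) (f y))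
    (hl : ∀ x, label' (f x) = label x) :
    IsIsom (P := generate r label) (Q := generate r' label') f := by
  have key : ∀ x y : X, Relation.ReflTransGen r' (f x) (f y) → Relation.ReflTransGen r x y := by
    intro x y hxy
    have := Relation.ReflTransGen.lift (p := r) f.symm
      (fun a b hab => (h _ _).2 (by simpa using hab)) _ _ hxy
    simpa [Function.onFun] using this
  exact ⟨fun x y => ⟨key x y, Relation.ReflTransGen.lift f (fun a b => (h a b).1) x y⟩, hl⟩

/-! ### Removing the elements above or below an element -/

/-- `Q` is the part of `S` that remains after deleting the elements above `c`, and is down-closed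
in `P`. -/
def IsLowerArm (P : LabeledOrder A) (c : P.carrier) (S : Set P.carrier) (Q : LabeledOrder A) :
    Prop :=
  ∃ f : Q.carrier → P.carrier, Function.Injective f ∧ (∀ y, f y ∈ S) ∧
    (∀ x ∈ S, x ∈ Set.range f ∨ P.le c x) ∧ (∀ x y, P.le x (f y) → x ∈ Set.range f) ∧
    (∀ y y', Q.le y y' ↔ P.le (f y) (f y')) ∧ ∀ y, P.label (f y) = Q.label y

/-- `Q` is the part of `S` that remains after deleting the elements below `c`, and is up-closed
in `P`. -/
def IsUpperArm (P : LabeledOrder A) (c : P.carrier) (S : Set P.carrier) (Q : LabeledOrder A) :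
    Prop := IsLowerArm P.dual c S Q.dual

/-- All conditions are on generating relations. Since the image contains every generating
predecessor of its elements, a descending sequence that starts in the image never leaves it and can
be lifted to `Q` step by step. Arbitrary generating relations are allowed, rather than just
`generate`, so that the dual orders are covered by swapping the arguments. -/
lemma isLowerArm_of_generated {P Q : LabeledOrder A} {r : P.carrier → P.carrier → Prop}
    {r' : Q.carrier → Q.carrier → Prop} (hP : ∀ x y, P.le x y ↔ Relation.ReflTransGen r x y)
    (hQ : ∀ x y, Q.le x y ↔ Relation.ReflTransGen r' x y) {c : P.carrier} {S : Set P.carrier}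
    (f : Q.carrier → P.carrier) (hf : Function.Injective f) (hS : ∀ y, f y ∈ S)
    (hc : ∀ x ∈ S, x ∈ Set.range f ∨ P.le c x) (hr : ∀ x y, r x (f y) → x ∈ Set.range f)
    (h1 : ∀ y y', r' y y' → P.le (f y) (f y')) (h2 : ∀ y y', r (f y) (f y') → Q.le y y')
    (hl : ∀ y, P.label (f y) = Q.label y) : P.IsLowerArm c S Q := by
  have key : ∀ x y', P.le x (f y') → ∃ y, f y = x ∧ Q.le y y' := by
    intro x y' h
    rw [hP] at h
    induction h using Relation.ReflTransGen.head_induction_on with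
    | refl => exact ⟨y', rfl, Q.refl _⟩
    | head hab _ ih =>
      obtain ⟨z, rfl, hz⟩ := ih
      obtain ⟨y, rfl⟩ := hr _ _ hab
      exact ⟨y, rfl, Q.trans _ _ _ (h2 _ _ hab) hz⟩
  refine ⟨f, hf, hS, hc, fun x y h => ?_, fun y y' => ⟨fun h => ?_, fun h => ?_⟩, hl⟩
  · obtain ⟨z, hz, -⟩ := key _ _ h
    exact ⟨z, hz⟩
  · rw [hQ] at h
    induction h with
    | refl => exact P.refl _
    | tail _ hbc ih => exact P.trans _ _ _ ih (h1 _ _ hbc)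
  · obtain ⟨z, hz, hz'⟩ := key _ _ h
    rwa [hf hz] at hz'

lemma isLowerArm_generate {X Y : Type} [Fintype X] [Fintype Y] {r : X → X → Prop}
    {r' : Y → Y → Prop} {label : X → A} {label' : Y → A} {c : X} {S : Set X} (f : Y → X)
    (hf : Function.Injective f) (hS : ∀ y, f y ∈ S)
    (hc : ∀ x ∈ S, x ∈ Set.range f ∨ Relation.ReflTransGen r c x)
    (hr : ∀ x y, r x (f y) → x ∈ Set.range f)
    (h1 : ∀ y y', r' y y' → Relation.ReflTransGen r (f y) (f y'))
    (h2 : ∀ y y', r (f y) (f y') → Relation.ReflTransGen r' y y')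
    (hl : ∀ y, label (f y) = label' y) :
    IsLowerArm (generate r label) c S (generate r' label') :=
  isLowerArm_of_generated (P := generate r label) (Q := generate r' label') (r := r) (r' := r')
    (fun _ _ => Iff.rfl) (fun _ _ => Iff.rfl) f hf hS hc hr h1 h2 hl

lemma isUpperArm_generate {X Y : Type} [Fintype X] [Fintype Y] {r : X → X → Prop}
    {r' : Y → Y → Prop} {label : X → A} {label' : Y → A} {c : X} {S : Set X} (f : Y → X)
    (hf : Function.Injective f) (hS : ∀ y, f y ∈ S)
    (hc : ∀ x ∈ S, x ∈ Set.range f ∨ Relation.ReflTransGen r x c)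
    (hr : ∀ x y, r (f y) x → x ∈ Set.range f)
    (h1 : ∀ y y', r' y y' → Relation.ReflTransGen r (f y) (f y'))
    (h2 : ∀ y y', r (f y) (f y') → Relation.ReflTransGen r' y y')
    (hl : ∀ y, label (f y) = label' y) :
    IsUpperArm (generate r label) c S (generate r' label') :=
  isLowerArm_of_generated (P := (generate r label).dual) (Q := (generate r' label').dual)
    (r := fun x y => r y x) (r' := fun x y => r' y x)
    (fun _ _ => Relation.reflTransGen_swap.symm) (fun _ _ => Relation.reflTransGen_swap.symm)
    f hf hS hc hr (fun y y' h => h1 y' y h) (fun y y' h => h2 y' y h) hl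

lemma IsLowerArm.congr {P Q Q' : LabeledOrder A} {c : P.carrier} {S : Set P.carrier}
    (h : P.IsLowerArm c S Q) (e : Q.Iso Q') : P.IsLowerArm c S Q' := by
  obtain ⟨f, hf, hS, hc, hr, hle, hl⟩ := h
  obtain ⟨e, he, hel⟩ := e.symm
  have hrange : Set.range (f ∘ e) = Set.range f := e.surjective.range_comp f
  refine ⟨f ∘ e, hf.comp e.injective, fun y => hS _, ?_, ?_, fun y y' => ?_, fun y => ?_⟩
  · rwa [hrange]
  · rw [hrange]; exact fun x y => hr x (e y)
  · rw [← he]; exact hle _ _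
  · rw [← hel]; exact hl _

/-- Replace the deleted element `c` by a smaller one and enlarge the surroundings. -/
lemma IsLowerArm.mono {P Q : LabeledOrder A} {c c' : P.carrier} {S S' : Set P.carrier}
    (h : P.IsLowerArm c S Q) (hc : P.le c' c) (hS : S ⊆ S') (hS' : ∀ x ∈ S', x ∉ S → P.le c' x) :
    P.IsLowerArm c' S' Q := by
  obtain ⟨f, hf, hfS, hcov, hr, hle, hl⟩ := h
  refine ⟨f, hf, fun y => hS (hfS y), fun x hx => ?_, hr, hle, hl⟩
  by_cases hxS : x ∈ S
  · exact (hcov x hxS).imp id fun h => P.trans _ _ _ hc h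
  · exact .inr (hS' x hx hxS)

lemma IsUpperArm.mono {P Q : LabeledOrder A} {c c' : P.carrier} {S S' : Set P.carrier}
    (h : P.IsUpperArm c S Q) (hc : P.le c c') (hS : S ⊆ S') (hS' : ∀ x ∈ S', x ∉ S → P.le x c') :
    P.IsUpperArm c' S' Q :=
  IsLowerArm.mono (P := P.dual) h hc hS hS'

lemma IsLowerArm.of_isom {P P' Q : LabeledOrder A} {e : P.carrier ≃ P'.carrier} (he : IsIsom e)
    {c : P.carrier} {S : Set P'.carrier} (h : P.IsLowerArm c (e ⁻¹' S) Q) :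
    P'.IsLowerArm (e c) S Q := by
  obtain ⟨f, hf, hS, hc, hr, hle, hl⟩ := h
  refine ⟨e ∘ f, e.injective.comp hf, hS, fun x hx => ?_, fun x y h => ?_, fun y y' => ?_,
    fun y => ?_⟩
  · obtain ⟨x, rfl⟩ := e.surjective x
    rcases hc x hx with ⟨y, rfl⟩ | h
    · exact .inl ⟨y, rfl⟩
    · exact .inr ((he.1 _ _).2 h)
  · obtain ⟨x, rfl⟩ := e.surjective x
    obtain ⟨z, rfl⟩ := hr x y ((he.1 _ _).1 h)
    exact ⟨z, rfl⟩
  · rw [hle]; exact (he.1 _ _).symm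
  · rw [← hl]; exact he.2 _

/-- Serves to carry statements about the part after a crossing back along the reversal of the curve,
where they become statements about the part before it. -/
lemma IsLowerArm.comap {P P' Q : LabeledOrder A} {e : P.carrier ≃ P'.carrier} (he : IsIsom e)
    {c : P.carrier} {c' : P'.carrier} {S : Set P.carrier} {S' : Set P'.carrier}
    (h : P'.IsLowerArm c' S' Q) (hc : e c = c') (hS : ∀ x, e x ∈ S' ↔ x ∈ S) :
    P.IsLowerArm c S Q := by
  have hS' : e.symm ⁻¹' S = S' := by
    ext x
    rw [Set.mem_preimage, ← hS, e.apply_symm_apply]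
  have := IsLowerArm.of_isom (S := S) he.symm (by rwa [hS'])
  rwa [← hc, e.symm_apply_apply] at this

lemma IsUpperArm.comap {P P' Q : LabeledOrder A} {e : P.carrier ≃ P'.carrier} (he : IsIsom e)
    {c : P.carrier} {c' : P'.carrier} {S : Set P.carrier} {S' : Set P'.carrier}
    (h : P'.IsUpperArm c' S' Q) (hc : e c = c') (hS : ∀ x, e x ∈ S' ↔ x ∈ S) :
    P.IsUpperArm c S Q :=
  IsLowerArm.comap (P := P.dual) (P' := P'.dual) (e := e) ⟨fun x y => he.1 y x, he.2⟩ h hc hS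

lemma isLowerArm_empty (P : LabeledOrder A) (c : P.carrier) : P.IsLowerArm c ∅ empty :=
  ⟨Empty.elim, fun x => x.elim, fun x => x.elim, fun _ h => h.elim, fun _ y => y.elim,
    fun y => y.elim, fun y => y.elim⟩

/-- Both images are down-closed in `P` and they are disjoint, so no relation of `P` joins them, as
in a disjoint union. -/
lemma IsLowerArm.union {P Q Q' : LabeledOrder A} {c : P.carrier} {S S' : Set P.carrier}
    (h : P.IsLowerArm c S Q) (h' : P.IsLowerArm c S' Q') (hS : Disjoint S S') :
    P.IsLowerArm c (S ∪ S') (disjointUnion Q Q') := by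
  obtain ⟨f, hf, hfS, hc, hr, hle, hl⟩ := h
  obtain ⟨f', hf', hfS', hc', hr', hle', hl'⟩ := h'
  rw [Set.disjoint_left] at hS
  refine ⟨Sum.elim f f', ?_, ?_, ?_, ?_, ?_, ?_⟩
  · exact hf.sumElim hf' fun a b hab => hS (hfS a) (hab ▸ hfS' b)
  · rintro (y | y)
    · exact .inl (hfS y)
    · exact .inr (hfS' y)
  · rintro x (hx | hx)
    · exact (hc x hx).imp (fun ⟨y, hy⟩ => ⟨.inl y, hy⟩) id
    · exact (hc' x hx).imp (fun ⟨y, hy⟩ => ⟨.inr y, hy⟩) id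
  · rintro x (y | y) h
    · obtain ⟨z, hz⟩ := hr x y h
      exact ⟨.inl z, hz⟩
    · obtain ⟨z, hz⟩ := hr' x y h
      exact ⟨.inr z, hz⟩
  · rintro (y | y) (y' | y')
    · exact Sum.liftRel_inl_inl.trans (hle y y')
    · refine ⟨fun h => (Sum.not_liftRel_inl_inr h).elim, fun h => ?_⟩
      obtain ⟨z, hz⟩ := hr' _ _ h
      exact (hS (hfS y) ((show f' z = f y from hz) ▸ hfS' z)).elim
    · refine ⟨fun h => (Sum.not_liftRel_inr_inl h).elim, fun h => ?_⟩
      obtain ⟨z, hz⟩ := hr _ _ h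
      exact (hS (hfS z) ((show f z = f' y from hz) ▸ hfS' y)).elim
    · exact Sum.liftRel_inr_inr.trans (hle' y y')
  · rintro (y | y)
    · exact hl y
    · exact hl' y

lemma disjointUnion_dual (Q Q' : LabeledOrder A) :
    (disjointUnion Q.dual Q'.dual).Iso (disjointUnion Q Q').dual := by
  refine ⟨Equiv.refl _, ?_, ?_⟩
  · rintro (x | x) (y | y)
    · exact Sum.liftRel_inl_inl.trans (Sum.liftRel_inl_inl (r := Q.dual.le)).symm
    · exact iff_of_false Sum.not_liftRel_inr_inl Sum.not_liftRel_inl_inr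
    · exact iff_of_false Sum.not_liftRel_inl_inr Sum.not_liftRel_inr_inl
    · exact Sum.liftRel_inr_inr.trans (Sum.liftRel_inr_inr (s := Q'.dual.le)).symm
  · rintro (x | x) <;> rfl

lemma isUpperArm_empty (P : LabeledOrder A) (c : P.carrier) : P.IsUpperArm c ∅ empty :=
  isLowerArm_empty P.dual c

lemma IsUpperArm.union {P Q Q' : LabeledOrder A} {c : P.carrier} {S S' : Set P.carrier}
    (h : P.IsUpperArm c S Q) (h' : P.IsUpperArm c S' Q') (hS : Disjoint S S') :
    P.IsUpperArm c (S ∪ S') (disjointUnion Q Q') :=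
  (IsLowerArm.union (P := P.dual) h h' hS).congr (disjointUnion_dual Q Q')

/-- The image is down-closed and misses `c`, so nothing in it lies above `c`; and the covering
condition says that nothing else is missing. -/
lemma IsLowerArm.iso {P Q : LabeledOrder A} {c : P.carrier} (h : P.IsLowerArm c {x | x ≠ c} Q) :
    Q.Iso (P.restrict fun e => ¬ P.le c e) := by
  obtain ⟨f, hf, hS, hc, hr, hle, hl⟩ := h
  have hn : ∀ y, ¬ P.le c (f y) := fun y h => by
    obtain ⟨z, hz⟩ := hr _ _ h
    exact hS z hz
  refine ⟨Equiv.ofBijective (fun y => ⟨f y, hn y⟩) ⟨fun y y' h => hf (congrArg Subtype.val h), ?_⟩,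
    fun x y => (hle x y).symm, hl⟩
  rintro ⟨x, hx⟩
  rcases hc x (by rintro rfl; exact hx (P.refl _)) with ⟨y, rfl⟩ | h
  · exact ⟨y, rfl⟩
  · exact (hx h).elim

lemma IsUpperArm.iso {P Q : LabeledOrder A} {c : P.carrier} (h : P.IsUpperArm c {x | x ≠ c} Q) :
    Q.Iso (P.restrict fun e => ¬ P.le e c) := by
  obtain ⟨e, he, hl⟩ := IsLowerArm.iso (P := P.dual) h
  exact ⟨e, fun x y => he y x, hl⟩

/-- The summand `empty` is the initial value of the fold in `Exchange.poset`. -/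
lemma IsLowerArm.iso_disjointUnion {P Q Q' : LabeledOrder A} {c : P.carrier} {S S' : Set P.carrier}
    (h : P.IsLowerArm c S Q) (h' : P.IsLowerArm c S' Q') (hS : Disjoint S S') (hc : c ∉ S)
    (hc' : c ∉ S') (hcov : ∀ x, x = c ∨ x ∈ S ∨ x ∈ S') :
    (disjointUnion Q (disjointUnion Q' empty)).Iso (P.restrict fun e => ¬ P.le c e) := by
  have h1 := h.union (h'.union (isLowerArm_empty P c) (Set.disjoint_empty _)) (by simpa using hS)
  have h2 : S ∪ (S' ∪ ∅) = {x | x ≠ c} := by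
    ext x
    simp only [Set.union_empty, Set.mem_union, Set.mem_ofPred_eq, ne_eq]
    refine ⟨?_, fun hx => (hcov x).resolve_left hx⟩
    rintro (hx | hx) rfl
    · exact hc hx
    · exact hc' hx
  rw [h2] at h1
  exact h1.iso

lemma IsUpperArm.iso_disjointUnion {P Q Q' : LabeledOrder A} {c : P.carrier} {S S' : Set P.carrier}
    (h : P.IsUpperArm c S Q) (h' : P.IsUpperArm c S' Q') (hS : Disjoint S S') (hc : c ∉ S)
    (hc' : c ∉ S') (hcov : ∀ x, x = c ∨ x ∈ S ∨ x ∈ S') :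
    (disjointUnion Q (disjointUnion Q' empty)).Iso (P.restrict fun e => ¬ P.le e c) := by
  have h1 := h.union (h'.union (isUpperArm_empty P c) (Set.disjoint_empty _)) (by simpa using hS)
  have h2 : S ∪ (S' ∪ ∅) = {x | x ≠ c} := by
    ext x
    simp only [Set.union_empty, Set.mem_union, Set.mem_ofPred_eq, ne_eq]
    refine ⟨?_, fun hx => (hcov x).resolve_left hx⟩
    rintro (hx | hx) rfl
    · exact hc hx
    · exact hc' hx
  rw [h2] at h1
  exact h1.iso

lemma IsLowerArm.iso_disjointUnion_empty {P Q : LabeledOrder A} {c : P.carrier}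
    (h : P.IsLowerArm c {x | x ≠ c} Q) :
    (disjointUnion Q empty).Iso (P.restrict fun e => ¬ P.le c e) := by
  have h1 := h.union (isLowerArm_empty P c) (Set.disjoint_empty _)
  rw [Set.union_empty] at h1
  exact h1.iso

lemma IsUpperArm.iso_disjointUnion_empty {P Q : LabeledOrder A} {c : P.carrier}
    (h : P.IsUpperArm c {x | x ≠ c} Q) :
    (disjointUnion Q empty).Iso (P.restrict fun e => ¬ P.le e c) := by
  have h1 := h.union (isUpperArm_empty P c) (Set.disjoint_empty _)
  rw [Set.union_empty] at h1
  exact h1.iso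

/-! ### Weighted sums of order ideals -/

variable {K : Type*} [CommSemiring K]

lemma weight_map {P Q : LabeledOrder A} (w : A → K) (f : Q.carrier ↪ P.carrier)
    (hl : ∀ y, P.label (f y) = Q.label y) (I : Finset Q.carrier) :
    P.weight w (I.map f) = Q.weight w I := by
  simp [weight, hl]

open scoped Classical in
-- An ideal without `c` contains nothing above `c`, and an ideal of the remaining elements is
-- already down-closed in `P`, because these form a down-closed set.
lemma F_of_iso_not_above {P Q : LabeledOrder A} {c : P.carrier} (w : A → K)
    (h : Q.Iso (P.restrict fun e => ¬ P.le c e)) :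
    Q.F w = ∑ I : Finset P.carrier with P.IsIdeal I ∧ c ∉ I, P.weight w I := by
  obtain ⟨e, he, hl⟩ := h
  let f : Q.carrier ↪ P.carrier := e.toEmbedding.trans (.subtype _)
  have hf : ∀ y, ¬ P.le c (f y) := fun y => (e y).2
  have hsurj : ∀ x, ¬ P.le c x → ∃ y, f y = x := fun x hx =>
    ⟨e.symm ⟨x, hx⟩, congrArg Subtype.val (e.apply_symm_apply _)⟩
  have hle : ∀ y y', P.le (f y) (f y') ↔ Q.le y y' := he
  refine Finset.sum_bij (fun I _ => I.map f) ?_ ?_ ?_ ?_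
  · intro I hI
    simp only [Finset.mem_filter, Finset.mem_univ, true_and] at hI ⊢
    refine ⟨?_, fun hc => ?_⟩
    · intro x hx y hyx
      obtain ⟨x, hxI, rfl⟩ := Finset.mem_map.1 hx
      obtain ⟨y, rfl⟩ := hsurj y fun h => hf x (P.trans _ _ _ h hyx)
      exact Finset.mem_map_of_mem _ (hI x hxI y ((hle _ _).1 hyx))
    · obtain ⟨x, -, hx⟩ := Finset.mem_map.1 hc
      exact hf x (hx ▸ P.refl _)
  · intro I _ J _ h
    exact Finset.map_injective f h
  · intro J hJ
    simp only [Finset.mem_filter, Finset.mem_univ, true_and] at hJ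
    refine ⟨Finset.univ.filter fun y => f y ∈ J, ?_, ?_⟩
    · simp only [Finset.mem_filter, Finset.mem_univ, true_and]
      intro x hx y hyx
      simp only [Finset.mem_filter, Finset.mem_univ, true_and] at hx ⊢
      exact hJ.1 _ hx _ ((hle _ _).2 hyx)
    · ext x
      simp only [Finset.mem_map, Finset.mem_filter, Finset.mem_univ, true_and]
      constructor
      · rintro ⟨y, hy, rfl⟩; exact hy
      · intro hx
        obtain ⟨y, rfl⟩ := hsurj x fun h => hJ.2 (hJ.1 x hx c h)
        exact ⟨y, hx, rfl⟩
  · intro I _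
    exact (weight_map w f hl I).symm

open scoped Classical in
-- An ideal with `c` contains the whole principal ideal `D` of `c`. Removing `D` leaves an ideal of
-- the remaining elements, and the weight splits off the factor of `D`.
lemma F_of_iso_not_below {P Q : LabeledOrder A} {c : P.carrier} (w : A → K)
    (h : Q.Iso (P.restrict fun e => ¬ P.le e c)) :
    (∏ e : P.carrier with P.le e c, w (P.label e)) * Q.F w =
      ∑ I : Finset P.carrier with P.IsIdeal I ∧ c ∈ I, P.weight w I := by
  obtain ⟨e, he, hl⟩ := h
  let f : Q.carrier ↪ P.carrier := e.toEmbedding.trans (.subtype _)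
  have hf : ∀ y, ¬ P.le (f y) c := fun y => (e y).2
  have hsurj : ∀ x, ¬ P.le x c → ∃ y, f y = x := fun x hx =>
    ⟨e.symm ⟨x, hx⟩, congrArg Subtype.val (e.apply_symm_apply _)⟩
  have hle : ∀ y y', P.le (f y) (f y') ↔ Q.le y y' := he
  let D : Finset P.carrier := Finset.univ.filter fun e => P.le e c
  have hD : ∀ x, x ∈ D ↔ P.le x c := fun x => by simp [D]
  have hdisj : ∀ I : Finset Q.carrier, Disjoint D (I.map f) := by
    intro I
    rw [Finset.disjoint_left]
    intro x hx hx'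
    obtain ⟨y, -, rfl⟩ := Finset.mem_map.1 hx'
    exact hf y ((hD _).1 hx)
  rw [F, Finset.mul_sum]
  refine Finset.sum_bij (fun I _ => D ∪ I.map f) ?_ ?_ ?_ ?_
  · intro I hI
    simp only [Finset.mem_filter, Finset.mem_univ, true_and] at hI ⊢
    refine ⟨?_, Finset.mem_union_left _ ((hD c).2 (P.refl c))⟩
    intro x hx y hyx
    by_cases hyc : P.le y c
    · exact Finset.mem_union_left _ ((hD y).2 hyc)
    rcases Finset.mem_union.1 hx with hx | hx
    · exact absurd (P.trans _ _ _ hyx ((hD x).1 hx)) hyc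
    · obtain ⟨x, hxI, rfl⟩ := Finset.mem_map.1 hx
      obtain ⟨y, rfl⟩ := hsurj y hyc
      exact Finset.mem_union_right _ (Finset.mem_map_of_mem _ (hI x hxI y ((hle _ _).1 hyx)))
  · intro I _ J _ h
    apply Finset.map_injective f
    have h' : (D ∪ I.map f) \ D = (D ∪ J.map f) \ D := congrArg (· \ D) h
    rwa [Finset.union_sdiff_cancel_left (hdisj I), Finset.union_sdiff_cancel_left (hdisj J)] at h'
  · intro J hJ
    simp only [Finset.mem_filter, Finset.mem_univ, true_and] at hJ
    refine ⟨Finset.univ.filter fun y => f y ∈ J, ?_, ?_⟩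
    · simp only [Finset.mem_filter, Finset.mem_univ, true_and]
      intro x hx y hyx
      simp only [Finset.mem_filter, Finset.mem_univ, true_and] at hx ⊢
      exact hJ.1 _ hx _ ((hle _ _).2 hyx)
    · ext x
      simp only [Finset.mem_union, hD, Finset.mem_map, Finset.mem_filter, Finset.mem_univ,
        true_and]
      constructor
      · rintro (h | ⟨y, hy, rfl⟩)
        · exact hJ.1 c hJ.2 x h
        · exact hy
      · intro hx
        by_cases hxc : P.le x c
        · exact .inl hxc
        · obtain ⟨y, rfl⟩ := hsurj x hxc
          exact .inr ⟨y, hx, rfl⟩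
  · intro I _
    rw [← weight_map w f hl I, weight, weight, Finset.prod_union (hdisj I)]

open scoped Classical in
lemma F_eq_add (P : LabeledOrder A) (w : A → K) (c : P.carrier) :
    P.F w = ∑ I : Finset P.carrier with P.IsIdeal I ∧ c ∉ I, P.weight w I +
      ∑ I : Finset P.carrier with P.IsIdeal I ∧ c ∈ I, P.weight w I := by
  rw [F, add_comm, ← Finset.filter_filter, ← Finset.filter_filter,
    Finset.sum_filter_add_sum_filter_not]

end LabeledOrder

namespace Triangulation

variable {H : Type*} (T : Triangulation H)

/-! ### The hand on which an infinite path leaves a finite one -/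

lemma leavingHand_left {r : ℕ → Turn} (hr : ∀ n, r n = .left) (ts : List Turn) :
    leavingHand r ts = .left := by
  induction ts generalizing r with
  | nil => exact hr 0
  | cons t ts ih =>
    cases t
    · simp only [leavingHand, hr 0]
      exact ih fun n => hr (n + 1)
    · simp only [leavingHand, hr 0]

lemma leavingHand_right {r : ℕ → Turn} (hr : ∀ n, r n = .right) (ts : List Turn) :
    leavingHand r ts = .right := by
  induction ts generalizing r with
  | nil => exact hr 0
  | cons t ts ih =>
    cases t
    · simp only [leavingHand, hr 0]
    · simp only [leavingHand, hr 0]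
      exact ih fun n => hr (n + 1)

/-- If the finite path turns left or ends while `r` still turns right, then `r` leaves it on the
right. Once both have made all `m` right turns, `r` turns only left and can only leave on the left.
-/
lemma leavingHand_right_left {r : ℕ → Turn} {m : ℕ} (h1 : ∀ n < m, r n = .right)
    (h2 : ∀ n, m ≤ n → r n = .left) (ts : List Turn) :
    leavingHand r ts = .left ↔ List.replicate m Turn.right <+: ts := by
  induction m generalizing r ts with
  | zero => simp [leavingHand_left fun n => h2 n (Nat.zero_le _)]
  | succ m ih =>
    have h0 := h1 0 (Nat.succ_pos _)
    cases ts with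
    | nil => simp [leavingHand, h0]
    | cons t ts =>
      cases t
      · simp [leavingHand, h0, List.replicate_succ]
      · simp only [leavingHand, h0, List.replicate_succ, List.cons_prefix_cons, true_and]
        exact ih (fun n hn => h1 _ (by omega)) (fun n hn => h2 _ (by omega)) ts

/-- This is the pattern of a lamination with one reversed spiral. After `m` common right turns, the
left turn of `r` separates the paths unless the finite one also turns left; in that case `r` turns
only right afterwards and leaves on the right. -/
lemma leavingHand_right_left_right {r : ℕ → Turn} {m : ℕ} (h1 : ∀ n < m, r n = .right)
    (h2 : r m = .left) (h3 : ∀ n, m < n → r n = .right) (ts : List Turn) :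
    leavingHand r ts = .left ↔ List.replicate m Turn.right <+: ts ∧ ts[m]? ≠ some .left := by
  induction m generalizing r ts with
  | zero =>
    cases ts with
    | nil => simp [leavingHand, h2]
    | cons t ts =>
      cases t
      · simp [leavingHand, h2, leavingHand_right fun n => h3 (n + 1) (by omega)]
      · simp [leavingHand, h2]
  | succ m ih =>
    have h0 := h1 0 (Nat.succ_pos _)
    cases ts with
    | nil => simp [leavingHand, h0]
    | cons t ts =>
      cases t
      · simp [leavingHand, h0, List.replicate_succ]
      · simp only [leavingHand, h0, List.replicate_succ, List.cons_prefix_cons, true_and,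
          List.getElem?_cons_succ]
        exact ih (r := fun n => r (n + 1)) (fun n hn => h1 _ (by omega)) h2
          (fun n hn => h3 _ (by omega)) ts

/-! ### Crossings of laminations -/

lemma sideAt_natCast (L : Lamination H) (n : ℕ) : T.sideAt L n = T.forwardAt L n := rfl

lemma sideAt_neg_natCast (L : Lamination H) (n : ℕ) : T.sideAt L (-n) = T.backwardAt L n := by
  cases n <;> rfl

lemma isCrossing_neg_natCast {L : Lamination H} {n : ℕ} :
    T.IsCrossing L (-n) ↔ ∀ j ≤ n, ¬ T.IsBoundary (T.backwardAt L j) := by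
  constructor
  · intro h j hj
    rw [← sideAt_neg_natCast]
    exact h (-j) (by rw [Set.uIcc_of_ge (by omega)]; exact ⟨by omega, by omega⟩)
  · intro h j hj
    rw [Set.uIcc_of_ge (by omega)] at hj
    obtain ⟨k, rfl⟩ : ∃ k : ℕ, j = -k := ⟨(-j).toNat, by have := hj.2; omega⟩
    rw [sideAt_neg_natCast]
    exact h k (by have := hj.1; omega)

/-- At its crossing number `i`, `L` leaves a triangle through `e` and then leaves the path `fwd` on
the given hand, as it does with the path `bwd` in the opposite direction. -/
def PassesThrough (L : Lamination H) (i : ℤ) (hand : Turn) (e : H) (fwd bwd : List Turn) : Prop :=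
  T.sideAt L i = e ∧ leavingHand (turnsAfter L i) fwd = hand ∧
    leavingHand (turnsBefore L i) bwd = hand

lemma mem_oppositeCrossings {D : Diagonal H} {hand : Turn} {L : Lamination H} {i : ℤ} :
    i ∈ T.oppositeCrossings D hand L ↔ T.IsCrossing L i ∧
      (T.PassesThrough L i hand D.e D.fwd D.bwd ∨
        T.PassesThrough L i hand (T.twin D.e) D.bwd D.fwd) := Iff.rfl

/-- The lamination that circles both endpoints of the arc of `d` with these on its left. -/
def plainLamination (d : H) : Lamination H := ⟨d, fun i => if 0 ≤ i then .left else .right⟩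

/-- The lamination that passes next to the arc of `d`, circling the source of `d` with it on its
right and the target with it on its left. -/
def mixedLamination (d : H) : Lamination H :=
  ⟨T.next (T.twin d), fun i => if i = -1 then .left else .right⟩

/-- Forward, the lamination goes counterclockwise around the target of `d`; backward, it goes
counterclockwise around the source. Both families of crossings are thus iterates of `rot`, up to
`twin`. -/
lemma forwardAt_plainLamination (d : H) (n : ℕ) :
    T.forwardAt (plainLamination d) n = T.twin (T.rot^[n] (T.twin d)) := by
  induction n with
  | zero => simp [forwardAt, plainLamination]
  | succ n ih =>
    rw [forwardAt, ih, Function.iterate_succ_apply']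
    simp [plainLamination, exit, rot]

lemma backwardAt_plainLamination (d : H) (n : ℕ) :
    T.backwardAt (plainLamination d) n = T.rot^[n] d := by
  induction n with
  | zero => rfl
  | succ n ih =>
    rw [backwardAt, ih, Function.iterate_succ_apply']
    have h : ¬ (0 : ℤ) ≤ -((n : ℤ) + 1) := by omega
    simp only [plainLamination, if_neg h]
    rfl

/-- The crossings with nonnegative number are ends of arcs at the source of `d`, taken clockwise;
those with negative number are ends at its target. The passage beside `d` is the turn between the
numbers `-1` and `0`. -/
lemma forwardAt_mixedLamination (d : H) (n : ℕ) :
    T.forwardAt (T.mixedLamination d) n = T.unrot^[n + 1] d := by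
  induction n with
  | zero => rfl
  | succ n ih =>
    rw [forwardAt, ih, Function.iterate_succ_apply' T.unrot (n + 1)]
    have h : ¬ (n : ℤ) = -1 := by omega
    simp only [mixedLamination, if_neg h]
    rfl

lemma backwardAt_mixedLamination (d : H) (n : ℕ) :
    T.backwardAt (T.mixedLamination d) (n + 1) = T.rot^[n + 1] (T.twin d) := by
  induction n with
  | zero =>
    simp [backwardAt, mixedLamination, Turn.flip, exit, rot, next_next]
  | succ n ih =>
    rw [backwardAt, ih, Function.iterate_succ_apply' T.rot (n + 1)]
    have h : ¬ (-(((n + 1 : ℕ) : ℤ) + 1)) = -1 := by omega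
    simp only [mixedLamination, if_neg h]
    rfl

lemma leavingHand_after_plainLamination (d : H) (m : ℕ) (ts : List Turn) :
    leavingHand (turnsAfter (plainLamination d) m) ts = .left :=
  leavingHand_left (fun n => by
    have : (0 : ℤ) ≤ m + n := by omega
    simp [turnsAfter, plainLamination, this]) ts

lemma leavingHand_before_plainLamination_neg (d : H) (m : ℕ) (ts : List Turn) :
    leavingHand (turnsBefore (plainLamination d) (-m)) ts = .left :=
  leavingHand_left (fun n => by
    have : ¬ (0 : ℤ) ≤ -m - 1 - n := by omega
    simp only [turnsBefore, plainLamination, if_neg this]; rfl) ts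

lemma leavingHand_before_plainLamination (d : H) (m : ℕ) (ts : List Turn) :
    leavingHand (turnsBefore (plainLamination d) m) ts = .left ↔
      List.replicate m Turn.right <+: ts := by
  refine leavingHand_right_left (fun n hn => ?_) (fun n hn => ?_) ts
  · have : (0 : ℤ) ≤ m - 1 - n := by omega
    simp only [turnsBefore, plainLamination, if_pos this]; rfl
  · have : ¬ (0 : ℤ) ≤ m - 1 - n := by omega
    simp only [turnsBefore, plainLamination, if_neg this]; rfl

lemma leavingHand_after_plainLamination_neg (d : H) (m : ℕ) (ts : List Turn) :
    leavingHand (turnsAfter (plainLamination d) (-m)) ts = .left ↔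
      List.replicate m Turn.right <+: ts := by
  refine leavingHand_right_left (fun n hn => ?_) (fun n hn => ?_) ts
  · have : ¬ (0 : ℤ) ≤ -m + n := by omega
    simp only [turnsAfter, plainLamination, if_neg this]
  · have : (0 : ℤ) ≤ -m + n := by omega
    simp only [turnsAfter, plainLamination, if_pos this]

lemma leavingHand_before_mixedLamination_neg (d : H) (m : ℕ) (ts : List Turn) :
    leavingHand (turnsBefore (T.mixedLamination d) (-(m + 1 : ℕ))) ts = .left :=
  leavingHand_left (fun n => by
    have : ¬ (-(m + 1 : ℕ) - 1 - n : ℤ) = -1 := by omega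
    simp only [turnsBefore, mixedLamination, if_neg this]; rfl) ts

lemma leavingHand_after_mixedLamination_neg (d : H) (m : ℕ) (ts : List Turn) :
    leavingHand (turnsAfter (T.mixedLamination d) (-(m + 1 : ℕ))) ts = .left ↔
      List.replicate m Turn.right <+: ts ∧ ts[m]? ≠ some .left := by
  refine leavingHand_right_left_right (fun n hn => ?_) ?_ (fun n hn => ?_) ts
  · have : ¬ (-(m + 1 : ℕ) + n : ℤ) = -1 := by omega
    simp only [turnsAfter, mixedLamination, if_neg this]
  · have : (-(m + 1 : ℕ) + m : ℤ) = -1 := by omega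
    simp only [turnsAfter, mixedLamination, if_pos this]
  · have : ¬ (-(m + 1 : ℕ) + n : ℤ) = -1 := by omega
    simp only [turnsAfter, mixedLamination, if_neg this]

lemma passesThrough_plainLamination {d e : H} {fwd bwd : List Turn} (m : ℕ) :
    T.PassesThrough (plainLamination d) m .left e fwd bwd ↔
      T.rot^[m] (T.twin d) = T.twin e ∧ List.replicate m Turn.right <+: bwd := by
  rw [PassesThrough, sideAt_natCast, forwardAt_plainLamination, leavingHand_after_plainLamination,
    leavingHand_before_plainLamination]
  have : T.twin (T.rot^[m] (T.twin d)) = e ↔ T.rot^[m] (T.twin d) = T.twin e :=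
    ⟨fun h => by rw [← h, twin_twin'], fun h => by rw [h, twin_twin']⟩
  simp [this]

lemma passesThrough_plainLamination_neg {d e : H} {fwd bwd : List Turn} (m : ℕ) :
    T.PassesThrough (plainLamination d) (-m) .left e fwd bwd ↔
      T.rot^[m] d = e ∧ List.replicate m Turn.right <+: fwd := by
  rw [PassesThrough, sideAt_neg_natCast, backwardAt_plainLamination,
    leavingHand_before_plainLamination_neg, leavingHand_after_plainLamination_neg]
  simp

lemma passesThrough_mixedLamination_neg {d e : H} {fwd bwd : List Turn} (m : ℕ) :
    T.PassesThrough (T.mixedLamination d) (-(m + 1 : ℕ)) .left e fwd bwd ↔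
      T.rot^[m + 1] (T.twin d) = e ∧ List.replicate m Turn.right <+: fwd ∧
        fwd[m]? ≠ some .left := by
  rw [PassesThrough, sideAt_neg_natCast, backwardAt_mixedLamination,
    leavingHand_before_mixedLamination_neg, leavingHand_after_mixedLamination_neg]
  simp

/-- Seen from any of its crossings, this lamination turns left for ever in at least one of the two
directions, and there it leaves every finite path on the left. -/
lemma not_passesThrough_plainLamination_right {d e : H} {fwd bwd : List Turn} (i : ℤ) :
    ¬ T.PassesThrough (plainLamination d) i .right e fwd bwd := by
  rintro ⟨-, h1, h2⟩
  obtain ⟨m, rfl | rfl⟩ := i.eq_nat_or_neg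
  · rw [leavingHand_after_plainLamination] at h1; cases h1
  · rw [leavingHand_before_plainLamination_neg] at h2; cases h2

end Triangulation

namespace Triangulation

variable {H : Type*} (T : Triangulation H)

/-! ### Elementary laminations crossing a quadrilateral -/

/-- The arcs crossed by a path are not boundary segments and have no endpoint in `R`. -/
def Avoids (R : Set T.Vertex) (e : H) (ts : List Turn) : Prop :=
  ∀ k ≤ ts.length, ¬ T.IsBoundary (T.crossingAt e ts k) ∧ T.vertex (T.crossingAt e ts k) ∉ R ∧
    T.vertex (T.twin (T.crossingAt e ts k)) ∉ R

/-- The path with turns `ts` after `e` starts with `m` right turns; or it consists of `m - 1` right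
turns and ends at a marked point in `R`. -/
def IsLow (R : Set T.Vertex) (e : H) (ts : List Turn) (m : ℕ) : Prop :=
  List.replicate m Turn.right <+: ts ∨
    ∃ n, m = n + 1 ∧ ts = List.replicate n .right ∧ T.vertex (T.next (T.unrot^[m] e)) ∈ R

/-- The conditions on a diagonal and the set `R` of marked points at which spirals are reversed under
which the crossings of elementary laminations are as expected. -/
structure IsAdmissible (R : Set T.Vertex) (D : Diagonal H) : Prop where
  puncture : ∀ v ∈ R, T.IsPuncture v
  no_arc : ∀ d, ¬ T.IsBoundary d → T.vertex d ∈ R → T.vertex (T.next d) ∉ R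
  avoids_fwd : T.Avoids R D.e D.fwd
  avoids_bwd : T.Avoids R (T.twin D.e) D.bwd
  inj_fwd : ∀ m n, T.IsLow R D.e D.fwd m → T.IsLow R D.e D.fwd n →
    T.edge (T.unrot^[m] D.e) = T.edge (T.unrot^[n] D.e) → m = n
  inj_bwd : ∀ m n, T.IsLow R (T.twin D.e) D.bwd m → T.IsLow R (T.twin D.e) D.bwd n →
    T.edge (T.unrot^[m] (T.twin D.e)) = T.edge (T.unrot^[n] (T.twin D.e)) → m = n
  inj_both : ∀ m n, T.IsLow R D.e D.fwd m → T.IsLow R (T.twin D.e) D.bwd n →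
    T.edge (T.unrot^[m] D.e) = T.edge (T.unrot^[n] (T.twin D.e)) → m = 0 ∧ n = 0

/-- The same diagonal, traversed in the opposite direction. -/
def Diagonal.swap (D : Diagonal H) : Diagonal H := ⟨T.twin D.e, D.bwd, D.fwd⟩

variable {T}

lemma oppositeCrossings_swap (D : Diagonal H) (hand : Turn) (L : Lamination H) :
    T.oppositeCrossings (D.swap T) hand L = T.oppositeCrossings D hand L := by
  ext i
  rw [mem_oppositeCrossings, mem_oppositeCrossings, or_comm]
  simp [Diagonal.swap]

lemma IsAdmissible.swap {R : Set T.Vertex} {D : Diagonal H} (h : T.IsAdmissible R D) :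
    T.IsAdmissible R (D.swap T) where
  puncture := h.puncture
  no_arc := h.no_arc
  avoids_fwd := h.avoids_bwd
  avoids_bwd := by simpa [Diagonal.swap] using h.avoids_fwd
  inj_fwd := h.inj_bwd
  inj_bwd := by simpa [Diagonal.swap] using h.inj_fwd
  inj_both m n hm hn he := by
    simp only [Diagonal.swap, twin_twin'] at hm hn he
    exact (h.inj_both n m hn hm he.symm).symm

lemma elementary_of_notMem {R : Set T.Vertex} {d : H} (h1 : T.vertex d ∉ R)
    (h2 : T.vertex (T.next d) ∉ R) : T.elementary R d = plainLamination d := by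
  simp [elementary, h1, h2, plainLamination]

lemma elementary_of_source_mem {R : Set T.Vertex} {d : H} (h1 : T.vertex d ∈ R)
    (h2 : T.vertex (T.next d) ∉ R) : T.elementary R d = T.mixedLamination d := by
  simp [elementary, h1, h2, mixedLamination]

lemma elementary_of_target_mem {R : Set T.Vertex} {d : H} (h1 : T.vertex d ∉ R)
    (h2 : T.vertex (T.next d) ∈ R) : T.elementary R d = T.mixedLamination (T.twin d) := by
  simp [elementary, h1, h2, mixedLamination]

lemma Avoids.right_run {R : Set T.Vertex} {e : H} {ts : List Turn} (h : T.Avoids R e ts) {m : ℕ}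
    (hm : List.replicate m Turn.right <+: ts) : ¬ T.IsBoundary (T.unrot^[m] e) ∧
      T.vertex (T.unrot^[m] e) ∉ R ∧ T.vertex (T.twin (T.unrot^[m] e)) ∉ R := by
  have := h m (by simpa using hm.length_le)
  rwa [T.crossingAt_right_run hm] at this

lemma replicate_prefix_of_le {ts : List Turn} {m n : ℕ} (hmn : m ≤ n)
    (h : List.replicate n Turn.right <+: ts) : List.replicate m Turn.right <+: ts := by
  refine List.IsPrefix.trans ⟨List.replicate (n - m) .right, ?_⟩ h
  rw [List.replicate_append_replicate, Nat.add_sub_cancel' hmn]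

lemma IsAdmissible.notMem {R : Set T.Vertex} {D : Diagonal H} (h : T.IsAdmissible R D) :
    T.vertex D.e ∉ R ∧ T.vertex (T.twin D.e) ∉ R := by
  simpa using (h.avoids_fwd 0 (Nat.zero_le _)).2

lemma IsPuncture.vertex_unrot_iterate {c : H} (hc : T.IsPuncture (T.vertex c)) (n : ℕ) :
    T.vertex (T.unrot^[n] c) = T.vertex c := by
  induction n with
  | zero => rfl
  | succ n ih => rw [Function.iterate_succ_apply', T.vertex_unrot (hc _ ih).1, ih]

/-- Beside a side `d` whose source is in `R`, the path ends after `m` right turns if it does not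
continue with a left turn. -/
lemma Avoids.eq_replicate {R : Set T.Vertex} {e d : H} {ts : List Turn} (h : T.Avoids R e ts)
    {m : ℕ} (hd : T.vertex d ∈ R) (he : T.rot^[m + 1] (T.twin d) = e) :
    List.replicate m Turn.right <+: ts ∧ ts[m]? ≠ some .left ↔ ts = List.replicate m .right := by
  constructor
  · rintro ⟨⟨us, rfl⟩, h2⟩
    rcases us with _ | ⟨_ | _, us⟩
    · simp
    · simp at h2
    · have hp : List.replicate (m + 1) Turn.right <+: List.replicate m .right ++ .right :: us :=
        ⟨us, by simp [List.replicate_succ']⟩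
      have := (h.right_run hp).2.2
      rw [← he, unrot_iterate_rot_iterate, twin_twin'] at this
      exact absurd hd this
  · rintro rfl
    simp

/-- The crossings of the elementary lamination of an arc whose source is in `R`. -/
lemma IsAdmissible.mem_mixedLamination {R : Set T.Vertex} {D : Diagonal H} (h : T.IsAdmissible R D)
    {d : H} (hd : T.vertex d ∈ R) {i : ℤ} :
    i ∈ T.oppositeCrossings D .left (T.mixedLamination d) ↔ ∃ m : ℕ, i = -(m + 1 : ℕ) ∧
      (T.rot^[m + 1] (T.twin d) = D.e ∧ D.fwd = List.replicate m .right ∨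
        T.rot^[m + 1] (T.twin d) = T.twin D.e ∧ D.bwd = List.replicate m .right) := by
  have hp := h.puncture _ hd
  -- The lamination has not met the boundary: crossing number `0` is at the puncture where `d`
  -- starts, and the others, down to the passage through `γ`, are crossings of the diagonal.
  have hbd : ∀ {m : ℕ} {e : H} {ts : List Turn}, T.Avoids R e ts →
      T.rot^[m + 1] (T.twin d) = e → ts = List.replicate m .right →
      T.IsCrossing (T.mixedLamination d) (-(m + 1 : ℕ)) := by
    intro m e ts ha he hts
    rw [isCrossing_neg_natCast]
    rintro (_ | j) hj
    · exact (hp _ (hp.vertex_unrot_iterate 1)).1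
    · rw [backwardAt_mixedLamination]
      have h1 : T.rot^[j + 1] (T.twin d) = T.unrot^[m - j] e := by
        rw [← he, T.unrot_iterate_rot_iterate_of_le (by omega)]
        congr 1; omega
      rw [h1]
      exact (ha.right_run (replicate_prefix_of_le (Nat.sub_le m j) (hts ▸ List.prefix_rfl))).1
  rw [mem_oppositeCrossings]
  constructor
  · rintro ⟨-, hi⟩
    -- Crossings with number at least `0` are ends at the source of `d`, which is in `R`, whereas
    -- `γ` has no endpoint in `R`. The number `0` turns up again as `-0` in the second case.
    obtain ⟨n, rfl | rfl⟩ := i.eq_nat_or_neg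
    · have hv := hp.vertex_unrot_iterate (n + 1)
      have hn := h.notMem
      rcases hi with hi | hi <;> have h1 := hi.1 <;>
        rw [sideAt_natCast, forwardAt_mixedLamination] at h1 <;> rw [h1] at hv
      · exact absurd (hv ▸ hd) hn.1
      · exact absurd (hv ▸ hd) hn.2
    · cases n with
      | zero =>
        have hv := hp.vertex_unrot_iterate 1
        have hn := h.notMem
        rcases hi with hi | hi <;> have h1 := hi.1 <;>
          rw [sideAt_neg_natCast] at h1 <;> change T.unrot^[1] d = _ at h1 <;> rw [h1] at hv
        · exact absurd (hv ▸ hd) hn.1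
        · exact absurd (hv ▸ hd) hn.2
      | succ m =>
        refine ⟨m, rfl, ?_⟩
        rw [passesThrough_mixedLamination_neg, passesThrough_mixedLamination_neg] at hi
        rcases hi with ⟨h1, h2⟩ | ⟨h1, h2⟩
        · exact .inl ⟨h1, (h.avoids_fwd.eq_replicate hd h1).1 h2⟩
        · exact .inr ⟨h1, (h.avoids_bwd.eq_replicate hd h1).1 h2⟩
  · rintro ⟨m, rfl, ⟨h1, h2⟩ | ⟨h1, h2⟩⟩
    · refine ⟨hbd h.avoids_fwd h1 h2, .inl ?_⟩
      rw [passesThrough_mixedLamination_neg]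
      exact ⟨h1, (h.avoids_fwd.eq_replicate hd h1).2 h2⟩
    · refine ⟨hbd h.avoids_bwd h1 h2, .inr ?_⟩
      rw [passesThrough_mixedLamination_neg]
      exact ⟨h1, (h.avoids_bwd.eq_replicate hd h1).2 h2⟩

/-- At a nonnegative number the crossed arc ends in `R`, so it is not `γ`; at a negative one the
lamination, followed backward, turns left for ever. -/
lemma IsAdmissible.mixedLamination_right {R : Set T.Vertex} {D : Diagonal H}
    (h : T.IsAdmissible R D) {d : H} (hd : T.vertex d ∈ R) :
    T.oppositeCrossings D .right (T.mixedLamination d) = ∅ := by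
  have hp := h.puncture _ hd
  have hn := h.notMem
  have key : ∀ i e fwd bwd, T.vertex e ∉ R →
      ¬ T.PassesThrough (T.mixedLamination d) i .right e fwd bwd := by
    rintro i e fwd bwd he ⟨h1, -, h3⟩
    obtain ⟨n, rfl | rfl⟩ := i.eq_nat_or_neg
    · rw [sideAt_natCast, forwardAt_mixedLamination] at h1
      have hv := hp.vertex_unrot_iterate (n + 1)
      rw [h1] at hv
      exact he (hv ▸ hd)
    · cases n with
      | zero =>
        have hv := hp.vertex_unrot_iterate 1
        change T.unrot^[1] d = _ at h1
        rw [h1] at hv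
        exact he (hv ▸ hd)
      | succ m => rw [leavingHand_before_mixedLamination_neg] at h3; cases h3
  rw [Set.eq_empty_iff_forall_notMem]
  intro i
  rw [mem_oppositeCrossings]
  rintro ⟨-, hi | hi⟩
  · exact key _ _ _ _ hn.1 hi
  · exact key _ _ _ _ hn.2 hi

lemma plainLamination_right (D : Diagonal H) (d : H) :
    T.oppositeCrossings D .right (plainLamination d) = ∅ := by
  rw [Set.eq_empty_iff_forall_notMem]
  intro i
  rw [mem_oppositeCrossings]
  rintro ⟨-, hi | hi⟩ <;> exact T.not_passesThrough_plainLamination_right i hi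

/-- No elementary lamination passes between the sides of right hand. -/
lemma IsAdmissible.elementary_right {R : Set T.Vertex} {D : Diagonal H}
    (h : T.IsAdmissible R D) {d : H} (hd : ¬ T.IsBoundary d) :
    T.oppositeCrossings D .right (T.elementary R d) = ∅ := by
  by_cases h1 : T.vertex d ∈ R
  · rw [elementary_of_source_mem h1 (h.no_arc d hd h1)]
    exact h.mixedLamination_right h1
  · by_cases h2 : T.vertex (T.next d) ∈ R
    · rw [elementary_of_target_mem h1 h2]
      exact h.mixedLamination_right (by rwa [T.vertex_twin hd])
    · rw [elementary_of_notMem h1 h2]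
      exact plainLamination_right _ _

/-- `x` is `m` steps away from the centre of the diagonal, among the low positions. -/
def LowAt (R : Set T.Vertex) (D : Diagonal H) (x : H) (m : ℕ) : Prop :=
  (T.rot^[m] x = D.e ∧ T.IsLow R D.e D.fwd m) ∨
    (T.rot^[m] x = T.twin D.e ∧ T.IsLow R (T.twin D.e) D.bwd m)

/-- The three injectivity conditions of `IsAdmissible` in terms of positions. The centre is
exceptional because both sides of `γ`, `D.e` and its twin, are there at distance `0`. -/
lemma IsAdmissible.lowAt_unique {R : Set T.Vertex} {D : Diagonal H} (h : T.IsAdmissible R D)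
    {x y : H} {m n : ℕ} (hx : T.LowAt R D x m) (hy : T.LowAt R D y n)
    (he : T.edge x = T.edge y) : m = n ∧ (m ≠ 0 → x = y) := by
  rcases hx with ⟨hx, hm⟩ | ⟨hx, hm⟩ <;> rcases hy with ⟨hy, hn⟩ | ⟨hy, hn⟩ <;>
    rw [rot_iterate_eq_iff] at hx hy <;> subst hx <;> subst hy
  · obtain rfl := h.inj_fwd m n hm hn he
    exact ⟨rfl, fun _ => rfl⟩
  · obtain ⟨rfl, rfl⟩ := h.inj_both m n hm hn he
    simp
  · obtain ⟨rfl, rfl⟩ := h.inj_both n m hn hm he.symm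
    simp
  · obtain rfl := h.inj_bwd m n hm hn he
    exact ⟨rfl, fun _ => rfl⟩

lemma lowAt_of_plainLamination {R : Set T.Vertex} {D : Diagonal H} {d : H} {i : ℤ}
    (hi : i ∈ T.oppositeCrossings D .left (plainLamination d)) :
    ∃ m : ℕ, (i = m ∧ T.LowAt R D (T.twin d) m) ∨ (i = -m ∧ T.LowAt R D d m) := by
  rw [mem_oppositeCrossings] at hi
  replace hi := hi.2
  obtain ⟨m, rfl | rfl⟩ := i.eq_nat_or_neg
  · refine ⟨m, .inl ⟨rfl, ?_⟩⟩
    rw [passesThrough_plainLamination, passesThrough_plainLamination, twin_twin'] at hi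
    rcases hi with ⟨h1, h2⟩ | ⟨h1, h2⟩
    · exact .inr ⟨h1, .inl h2⟩
    · exact .inl ⟨h1, .inl h2⟩
  · refine ⟨m, .inr ⟨rfl, ?_⟩⟩
    rw [passesThrough_plainLamination_neg, passesThrough_plainLamination_neg] at hi
    rcases hi with ⟨h1, h2⟩ | ⟨h1, h2⟩
    · exact .inl ⟨h1, .inl h2⟩
    · exact .inr ⟨h1, .inl h2⟩

lemma IsAdmissible.lowAt_of_mixedLamination {R : Set T.Vertex} {D : Diagonal H}
    (h : T.IsAdmissible R D) {d : H} (hd : T.vertex d ∈ R) {i : ℤ}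
    (hi : i ∈ T.oppositeCrossings D .left (T.mixedLamination d)) :
    ∃ m : ℕ, i = -m ∧ T.LowAt R D (T.twin d) m := by
  have hb := ((h.puncture _ hd) d rfl).1
  rw [h.mem_mixedLamination hd] at hi
  obtain ⟨m, rfl, ⟨h1, h2⟩ | ⟨h1, h2⟩⟩ := hi
  · refine ⟨m + 1, rfl, .inl ⟨h1, .inr ⟨m, rfl, h2, ?_⟩⟩⟩
    rw [← h1, unrot_iterate_rot_iterate, T.vertex_next_twin hb]
    exact hd
  · refine ⟨m + 1, rfl, .inr ⟨h1, .inr ⟨m, rfl, h2, ?_⟩⟩⟩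
    rw [← h1, unrot_iterate_rot_iterate, T.vertex_next_twin hb]
    exact hd

lemma IsAdmissible.lowAt_of_elementary {R : Set T.Vertex} {D : Diagonal H}
    (h : T.IsAdmissible R D) {d : H} (hd : ¬ T.IsBoundary d) {i : ℤ}
    (hi : i ∈ T.oppositeCrossings D .left (T.elementary R d)) :
    ∃ m x, (x = d ∨ x = T.twin d) ∧ T.LowAt R D x m := by
  by_cases h1 : T.vertex d ∈ R
  · rw [elementary_of_source_mem h1 (h.no_arc d hd h1)] at hi
    obtain ⟨m, -, hm⟩ := h.lowAt_of_mixedLamination h1 hi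
    exact ⟨m, _, .inr rfl, hm⟩
  · by_cases h2 : T.vertex (T.next d) ∈ R
    · rw [elementary_of_target_mem h1 h2] at hi
      obtain ⟨m, -, hm⟩ := h.lowAt_of_mixedLamination (by rwa [T.vertex_twin hd]) hi
      rw [twin_twin'] at hm
      exact ⟨m, _, .inl rfl, hm⟩
    · rw [elementary_of_notMem h1 h2] at hi
      obtain ⟨m, ⟨-, hm⟩ | ⟨-, hm⟩⟩ := lowAt_of_plainLamination hi
      · exact ⟨m, _, .inr rfl, hm⟩
      · exact ⟨m, _, .inl rfl, hm⟩

/-- An elementary lamination passes at most once between the sides of left hand. -/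
lemma IsAdmissible.subsingleton {R : Set T.Vertex} {D : Diagonal H}
    (h : T.IsAdmissible R D) {d : H} (hd : ¬ T.IsBoundary d) :
    (T.oppositeCrossings D .left (T.elementary R d)).Subsingleton := by
  have hmixed : ∀ d, T.vertex d ∈ R →
      (T.oppositeCrossings D .left (T.mixedLamination d)).Subsingleton := by
    intro d hd i hi j hj
    obtain ⟨m, rfl, hm⟩ := h.lowAt_of_mixedLamination hd hi
    obtain ⟨n, rfl, hn⟩ := h.lowAt_of_mixedLamination hd hj
    rw [(h.lowAt_unique hm hn rfl).1]
  by_cases h1 : T.vertex d ∈ R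
  · rw [elementary_of_source_mem h1 (h.no_arc d hd h1)]
    exact hmixed d h1
  · by_cases h2 : T.vertex (T.next d) ∈ R
    · rw [elementary_of_target_mem h1 h2]
      exact hmixed _ (by rwa [T.vertex_twin hd])
    · rw [elementary_of_notMem h1 h2]
      intro i hi j hj
      obtain ⟨m, ⟨rfl, hm⟩ | ⟨rfl, hm⟩⟩ := lowAt_of_plainLamination hi <;>
        obtain ⟨n, ⟨rfl, hn⟩ | ⟨rfl, hn⟩⟩ := lowAt_of_plainLamination hj <;>
        obtain ⟨rfl, hne⟩ := h.lowAt_unique hm hn (by simp)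
      · rfl
      -- The numbers `m` and `-m`: away from the centre the two positions coincide, which would make
      -- `d` its own twin, a boundary segment.
      · by_cases hm0 : m = 0
        · simp [hm0]
        · exact absurd (hne hm0) hd
      · by_cases hm0 : m = 0
        · simp [hm0]
        · exact absurd (hne hm0).symm hd
      · rfl

/-- If the position is reached by right turns, its arc has no end in `R`, and its plain lamination
passes `γ` at number `-m`. The position beyond the last crossing belongs to an arc ending in `R`,
and its mixed lamination passes `γ` at number `-(n + 1)`. -/
lemma IsAdmissible.exists_elementary_of_isLow {R : Set T.Vertex} {D : Diagonal H}
    (h : T.IsAdmissible R D) {m : ℕ} (hm : T.IsLow R D.e D.fwd m) :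
    ∃ d, T.edge d = T.edge (T.unrot^[m] D.e) ∧ ¬ T.IsBoundary d ∧
      (T.oppositeCrossings D .left (T.elementary R d)).Nonempty := by
  rcases hm with hm | ⟨n, rfl, hfwd, hR⟩
  · obtain ⟨hb, h1, h2⟩ := h.avoids_fwd.right_run hm
    refine ⟨_, rfl, hb, -m, ?_⟩
    rw [elementary_of_notMem h1 (by rwa [← T.vertex_twin hb]), mem_oppositeCrossings,
      passesThrough_plainLamination_neg, isCrossing_neg_natCast]
    refine ⟨fun j hj => ?_, .inl ⟨rot_iterate_unrot_iterate _ _ _, hm⟩⟩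
    rw [backwardAt_plainLamination]
    obtain ⟨k, rfl⟩ := Nat.exists_eq_add_of_le hj
    rw [Function.iterate_add_apply, rot_iterate_unrot_iterate]
    exact (h.avoids_fwd.right_run (replicate_prefix_of_le (by omega) hm)).1
  · set x := T.unrot^[n + 1] D.e with hx
    have hxb : ¬ T.IsBoundary x := by
      have := (h.puncture _ hR (T.next x) rfl).2
      rwa [prev_next] at this
    have hv : T.vertex (T.twin x) ∈ R := by rwa [T.vertex_twin hxb]
    have hxb' : ¬ T.IsBoundary (T.twin x) := by rwa [isBoundary_twin]
    refine ⟨T.twin x, T.edge_twin x, hxb', -(n + 1 : ℕ), ?_⟩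
    rw [elementary_of_source_mem hv (h.no_arc _ hxb' hv), h.mem_mixedLamination hv]
    refine ⟨n, rfl, .inl ⟨?_, hfwd⟩⟩
    rw [twin_twin', hx, rot_iterate_unrot_iterate]

/-- The arcs whose elementary laminations pass between the sides of left hand are those at the low
positions. -/
lemma IsAdmissible.exists_elementary_iff {R : Set T.Vertex} {D : Diagonal H}
    (h : T.IsAdmissible R D) {δ : T.Edge} :
    (∃ d, T.edge d = δ ∧ ¬ T.IsBoundary d ∧
      (T.oppositeCrossings D .left (T.elementary R d)).Nonempty) ↔
    ∃ m, (T.IsLow R D.e D.fwd m ∧ T.edge (T.unrot^[m] D.e) = δ) ∨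
      (T.IsLow R (T.twin D.e) D.bwd m ∧ T.edge (T.unrot^[m] (T.twin D.e)) = δ) := by
  constructor
  · rintro ⟨d, rfl, hd, i, hi⟩
    obtain ⟨m, x, hx, hm⟩ := h.lowAt_of_elementary hd hi
    have hxd : T.edge x = T.edge d := by rcases hx with rfl | rfl <;> simp
    refine ⟨m, ?_⟩
    rcases hm with ⟨h1, h2⟩ | ⟨h1, h2⟩ <;> rw [rot_iterate_eq_iff] at h1 <;> rw [h1] at hxd
    · exact .inl ⟨h2, hxd⟩
    · exact .inr ⟨h2, hxd⟩
  · rintro ⟨m, ⟨h1, rfl⟩ | ⟨h1, rfl⟩⟩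
    · exact h.exists_elementary_of_isLow h1
    · obtain ⟨d, h2, h3, h4⟩ := h.swap.exists_elementary_of_isLow h1
      rw [oppositeCrossings_swap] at h4
      exact ⟨d, h2, h3, h4⟩

end Triangulation

namespace Triangulation

variable {H : Type*} (T : Triangulation H)

/-! ### The poset of a curve that crosses arcs -/

/-- The height of the crossing number `i` of a curve with turns `ts`. -/
def height (ts : List Turn) (i : ℕ) : ℤ :=
  ((ts.take i).map fun | .left => (1 : ℤ) | .right => -1).sum

lemma height_succ_left {ts : List Turn} {i : ℕ} (h : ts[i]? = some .left) :
    height ts (i + 1) = height ts i + 1 := by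
  simp [height, List.take_add_one, h]

lemma height_succ_right {ts : List Turn} {i : ℕ} (h : ts[i]? = some .right) :
    height ts (i + 1) = height ts i - 1 := by
  simp [height, List.take_add_one, h, sub_eq_add_neg]

/-- In a chain with a single element, bottom and top would agree, and this element would be both
below and above the adjacent crossing. -/
lemma chainSize_ne_one {d : ℕ} (hd : 2 ≤ d) (t : Tag) : chainSize d t ≠ 1 := by
  cases t <;> simp [chainSize]; omega

lemma isPoset_crossRel {A : Type*} {ts : List Turn} {n a b : ℕ} (ha : a ≠ 1) (hb : b ≠ 1)
    (label : Fin n ⊕ (Fin a ⊕ Fin b) → A) :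
    (LabeledOrder.generate (crossRel ts) label).IsPoset := by
  -- Crossings are ranked by height. Relative to the adjacent crossing, the bottom of a chain gets
  -- `-1` and element `j > 0` gets `j`; the top is not the bottom, so it ranks above the crossing.
  let rank : Fin n ⊕ (Fin a ⊕ Fin b) → ℤ := fun
    | .inl i => height ts i
    | .inr (.inl j) => height ts 0 + if j.val = 0 then -1 else (j.val : ℤ)
    | .inr (.inr j) => height ts (n - 1) + if j.val = 0 then -1 else (j.val : ℤ)
  refine LabeledOrder.isPoset_generate rank ?_
  have hchain : ∀ {i j : ℕ}, i + 1 = j →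
      (if i = 0 then -1 else (i : ℤ)) < if j = 0 then -1 else (j : ℤ) := by
    intro i j h; split_ifs <;> omega
  rintro (i | i | i) (j | j | j) h <;> simp only [crossRel] at h <;> simp only [rank]
  · rcases h with ⟨h1, h2⟩ | ⟨h1, h2⟩
    · rw [← h1, height_succ_left h2]; omega
    · rw [← h1, height_succ_right h2]; omega
  · have := j.2
    rw [h.1, if_neg (by omega)]; omega
  · have := j.2
    have h1 : n - 1 = i.val := by omega
    rw [h1, if_neg (by omega)]; omega
  · rw [h.2, if_pos h.1]; omega
  · have := hchain h; omega
  · have h1 : n - 1 = j.val := by omega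
    rw [h1, if_pos h.1]; omega
  · have := hchain h; omega

/-- Exchange of the two ends, in the elements of `P_α`. -/
def crossReverse {n n' a a' b b' : ℕ} (hn : n = n') (ha : a = a') (hb : b = b') :
    Fin n ⊕ (Fin a ⊕ Fin b) ≃ Fin n' ⊕ (Fin b' ⊕ Fin a') :=
  Equiv.sumCongr ((Fin.revPerm).trans (finCongr hn))
    ((Equiv.sumComm _ _).trans (Equiv.sumCongr (finCongr hb) (finCongr ha)))

lemma getElem?_reverse_flip {ts : List Turn} {i j : ℕ} (h : i + j + 1 = ts.length) (t : Turn) :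
    (ts.reverse.map Turn.flip)[i]? = some t.flip ↔ ts[j]? = some t := by
  rw [List.getElem?_map, List.getElem?_reverse (by omega)]
  have h1 : ts.length - 1 - i = j := by omega
  rw [h1, List.getElem?_eq_getElem (by omega)]
  simp only [Option.map_some, Option.some.injEq]
  constructor
  · intro h; rw [← Turn.flip_flip ts[j], h, Turn.flip_flip]
  · intro h; rw [h]

/-- Walking backward exchanges the order of two consecutive crossings and also left and right, and
the two changes cancel. -/
lemma crossRel_crossReverse {ts : List Turn} {n n' a a' b b' : ℕ} (hn : n = n') (ha : a = a')
    (hb : b = b') (hts : n = ts.length + 1) (x y : Fin n ⊕ (Fin a ⊕ Fin b)) :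
    crossRel ts x y ↔ crossRel (ts.reverse.map Turn.flip) (crossReverse hn ha hb x)
      (crossReverse hn ha hb y) := by
  subst hn ha hb
  rcases x with i | i | i <;> rcases y with j | j | j <;>
    simp only [crossReverse, Equiv.sumCongr_apply, Sum.map_inl, Sum.map_inr, Equiv.trans_apply,
      Equiv.sumComm_apply, Sum.swap_inl, Sum.swap_inr, finCongr_refl, Equiv.refl_apply, crossRel,
      Fin.revPerm_apply, Fin.val_rev]
  · have hi := i.2
    have hj := j.2
    have key1 : i.val + 1 = j.val → ((ts.reverse.map Turn.flip)[n - (j.val + 1)]? = some .right ↔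
        ts[i.val]? = some .left) := fun h => getElem?_reverse_flip (by omega) .left
    have key2 : j.val + 1 = i.val → ((ts.reverse.map Turn.flip)[n - (i.val + 1)]? = some .left ↔
        ts[j.val]? = some .right) := fun h => getElem?_reverse_flip (by omega) .right
    constructor
    · rintro (⟨h1, h2⟩ | ⟨h1, h2⟩)
      · exact .inr ⟨by omega, (key1 h1).2 h2⟩
      · exact .inl ⟨by omega, (key2 h1).2 h2⟩
    · rintro (⟨h1, h2⟩ | ⟨h1, h2⟩)
      · have h : j.val + 1 = i.val := by omega
        exact .inr ⟨h, (key2 h).1 h2⟩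
      · have h : i.val + 1 = j.val := by omega
        exact .inl ⟨h, (key1 h).1 h2⟩
  all_goals omega

lemma length_reverse_flip (ts : List Turn) : ts.length = (ts.reverse.map Turn.flip).length := by
  simp

/-- The reversal of a curve, on the elements of its poset. -/
noncomputable def crossPosetReverse (g : H) (ts : List Turn) (s f : Tag) :
    (T.crossPoset g ts s f).carrier ≃
      (T.crossPoset (T.twin (T.lastCrossing g ts)) (ts.reverse.map Turn.flip) f s).carrier :=
  crossReverse (congrArg (· + 1) (length_reverse_flip ts))
    (by rw [T.lastCrossing_reverse, twin_twin']) rfl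

lemma isIsom_crossPosetReverse (g : H) (ts : List Turn) (s f : Tag) :
    LabeledOrder.IsIsom (T.crossPosetReverse g ts s f) := by
  refine LabeledOrder.isIsom_generate (crossReverse (congrArg (· + 1) (length_reverse_flip ts))
    (by rw [T.lastCrossing_reverse, twin_twin']) rfl) (crossRel_crossReverse _ _ _ rfl) ?_
  rintro (i | i | i) <;>
    simp only [crossReverse, Equiv.sumCongr_apply, Sum.map_inl, Sum.map_inr, Equiv.trans_apply,
      Equiv.sumComm_apply, Sum.swap_inl, Sum.swap_inr, Fin.revPerm_apply, Fin.val_rev,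
      finCongr_apply, Fin.val_cast]
  · have hi := i.2
    rw [T.crossingAt_reverse _ _ (by omega), edge_twin]
    congr 2; omega
  · rw [T.lastCrossing_reverse, twin_twin']

/-! ### The poset of a curve that coincides with an arc -/

lemma isPoset_sideRel {A : Type*} {d a b : ℕ} (hab : ¬ (a = 1 ∧ b = 1))
    (label : Fin d ⊕ (Fin a ⊕ Fin b) → A) :
    (LabeledOrder.generate sideRel label).IsPoset := by
  -- The chains climb in even steps from `0`. A one-element chain is put at `1`, strictly between
  -- the atom `0` and the coatom of the other chain, which has at least two elements and so a coatom
  -- of rank at least `2`.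
  let rank : Fin d ⊕ (Fin a ⊕ Fin b) → ℤ := fun
    | .inl i => if i.val = 0 then -1 else 2 * (a + b) + 5
    | .inr (.inl j) => if a = 1 then 1 else 2 * j.val
    | .inr (.inr j) => if b = 1 then 1 else 2 * j.val
  refine LabeledOrder.isPoset_generate rank ?_
  rintro (i | i | i) (j | j | j) h <;> simp only [sideRel] at h <;> simp only [rank] <;>
    have hi := i.2 <;> have hj := j.2 <;> split_ifs <;> omega

/-- Exchange of the two ends, in the elements of `P_α`. -/
def sideReverse {d d' a a' b b' : ℕ} (hd : d = d') (ha : a = a') (hb : b = b') :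
    Fin d ⊕ (Fin a ⊕ Fin b) ≃ Fin d' ⊕ (Fin b' ⊕ Fin a') :=
  Equiv.sumCongr (finCongr hd)
    ((Equiv.sumComm _ _).trans (Equiv.sumCongr (finCongr hb) (finCongr ha)))

lemma isIsom_sidePosetReverse (h : H) (s f : Tag) :
    (T.sidePoset h s f).Iso (T.sidePoset (T.twin h) f s) := by
  refine ⟨sideReverse (by cases s <;> cases f <;> rfl) (by rw [twin_twin']) rfl,
    LabeledOrder.isIsom_generate (sideReverse (by cases s <;> cases f <;> rfl)
      (by rw [twin_twin']) rfl) ?_ ?_⟩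
  · rintro (i | i | i) (j | j | j) <;>
      simp only [sideReverse, Equiv.sumCongr_apply, Sum.map_inl, Sum.map_inr, Equiv.trans_apply,
        Equiv.sumComm_apply, Sum.swap_inl, Sum.swap_inr, finCongr_apply, Fin.val_cast, sideRel,
        twin_twin']
  · rintro (i | i | i) <;>
      simp only [sideReverse, Equiv.sumCongr_apply, Sum.map_inl, Sum.map_inr, Equiv.trans_apply,
        Equiv.sumComm_apply, Sum.swap_inl, Sum.swap_inr, finCongr_apply, Fin.val_cast, edge_twin,
        twin_twin']

lemma poset_iso_reverse (α : TaggedCurve H) : (T.poset α).Iso (T.poset (T.reverse α)) := by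
  obtain ⟨h | ⟨g, ts⟩, s, f⟩ := α
  · exact T.isIsom_sidePosetReverse h s f
  · exact ⟨_, T.isIsom_crossPosetReverse g ts s f⟩

/-! ### Fans -/

/-- `fanSide` discards an initial run of turns to its own hand; the two alternatives decide whether
the result is an arc of `T` or a curve that crosses arcs. -/
lemma exists_left_run (ts : List Turn) : (∃ m, ts = List.replicate m .left) ∨
    ∃ m us, ts = List.replicate m .left ++ .right :: us := by
  induction ts with
  | nil => exact .inl ⟨0, rfl⟩
  | cons t ts ih =>
    cases t
    · rcases ih with ⟨m, rfl⟩ | ⟨m, us, rfl⟩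
      · exact .inl ⟨m + 1, rfl⟩
      · exact .inr ⟨m + 1, us, rfl⟩
    · exact .inr ⟨0, ts, rfl⟩

lemma exists_right_run (ts : List Turn) : (∃ m, ts = List.replicate m .right) ∨
    ∃ m us, ts = List.replicate m .right ++ .left :: us := by
  induction ts with
  | nil => exact .inl ⟨0, rfl⟩
  | cons t ts ih =>
    cases t
    · exact .inr ⟨0, ts, rfl⟩
    · rcases ih with ⟨m, rfl⟩ | ⟨m, us, rfl⟩
      · exact .inl ⟨m + 1, rfl⟩
      · exact .inr ⟨m + 1, us, rfl⟩

lemma fanSide_left_replicate (x : H) (m : ℕ) (tag : Tag) :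
    T.fanSide .left (T.twin x) (List.replicate m .left) tag =
      ⟨.side (T.prev (T.twin (T.lastCrossing x (List.replicate m .left)))), tag, .plain⟩ := by
  induction m generalizing x with
  | zero => simp [fanSide, lastCrossing]
  | succ m ih =>
    rw [List.replicate_succ, fanSide, ih]
    simp [lastCrossing, crossingAt_cons_succ, exit]

lemma fanSide_right_replicate (x : H) (m : ℕ) (tag : Tag) :
    T.fanSide .right (T.twin x) (List.replicate m .right) tag =
      ⟨.side (T.next (T.twin (T.lastCrossing x (List.replicate m .right)))), .plain, tag⟩ := by
  induction m generalizing x with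
  | zero => simp [fanSide, lastCrossing]
  | succ m ih =>
    rw [List.replicate_succ, fanSide, ih]
    simp [lastCrossing, crossingAt_cons_succ, exit]

/-- The left turns only circle the starting point of the side. The next turn takes the path away
from there, so the first crossing that remains has number `m + 1`. -/
lemma fanSide_left_append (x : H) (m : ℕ) (us : List Turn) (tag : Tag) :
    T.fanSide .left (T.twin x) (List.replicate m .left ++ .right :: us) tag =
      ⟨.cross (T.crossingAt x (List.replicate m .left ++ .right :: us) (m + 1)) us,
        .plain, tag⟩ := by
  induction m generalizing x with
  | zero => simp [fanSide, crossingAt_cons_succ, exit]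
  | succ m ih =>
    rw [List.replicate_succ, List.cons_append, fanSide, ih, crossingAt_cons_succ]
    rfl

lemma fanSide_right_append (x : H) (m : ℕ) (us : List Turn) (tag : Tag) :
    T.fanSide .right (T.twin x) (List.replicate m .right ++ .left :: us) tag =
      ⟨.cross (T.crossingAt x (List.replicate m .right ++ .left :: us) (m + 1)) us,
        .plain, tag⟩ := by
  induction m generalizing x with
  | zero => simp [fanSide, crossingAt_cons_succ, exit]
  | succ m ih =>
    rw [List.replicate_succ, List.cons_append, fanSide, ih, crossingAt_cons_succ]
    rfl

end Triangulation

namespace Triangulation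

variable {H : Type*} (T : Triangulation H)

/-! ### The two arms of `P_α` at a crossing -/

/-- The elements of `P_α` that come after the crossing number `k`. -/
def after {n a b : ℕ} (k : ℕ) : Set (Fin n ⊕ (Fin a ⊕ Fin b)) :=
  {x | match x with
    | .inl i => k < i.val
    | .inr (.inl _) => False
    | .inr (.inr _) => True}

/-- The elements of `P_α` that come before the crossing number `k`. -/
def before {n a b : ℕ} (k : ℕ) : Set (Fin n ⊕ (Fin a ⊕ Fin b)) :=
  {x | match x with
    | .inl i => i.val < k
    | .inr (.inl _) => True
    | .inr (.inr _) => False}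

lemma getElem?_of_drop_eq {ts us : List Turn} {k : ℕ} (h : ts.drop k = us) (j : ℕ) :
    ts[k + j]? = us[j]? := by
  rw [← h, List.getElem?_drop]

lemma crossRel_left_run {ts : List Turn} {n a b k m : ℕ} (hk : k + m < n)
    (h : ∀ j < m, ts[k + j]? = some .left) :
    Relation.ReflTransGen (crossRel (n := n) (a := a) (b := b) ts) (.inl ⟨k, by omega⟩)
      (.inl ⟨k + m, hk⟩) := by
  induction m with
  | zero => exact .refl
  | succ m ih =>
    exact (ih (by omega) fun j hj => h j (by omega)).tail (.inl ⟨rfl, h m (by omega)⟩)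

lemma crossRel_right_run {ts : List Turn} {n a b k m : ℕ} (hk : k + m < n)
    (h : ∀ j < m, ts[k + j]? = some .right) :
    Relation.ReflTransGen (crossRel (n := n) (a := a) (b := b) ts) (.inl ⟨k + m, hk⟩)
      (.inl ⟨k, by omega⟩) := by
  induction m with
  | zero => exact .refl
  | succ m ih =>
    refine .trans (.single ?_) (ih (by omega) fun j hj => h j (by omega))
    exact .inr ⟨rfl, h m (by omega)⟩

section Arms

variable {T} {g : H} {ts us : List Turn} {s f : Tag} {k m : ℕ}

/-- The left turns make the crossings `k, …, k + m` climb, so all of them are above `c` and get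
deleted. The right turn puts crossing `k + m + 1` below crossing `k + m`; hence the rest of the arm,
with the chain at its end, is down-closed. -/
lemma isLowerArm_after_of_append (hk : k ≤ ts.length)
    (h : ts.drop k = List.replicate m .left ++ .right :: us) :
    (T.crossPoset g ts s f).IsLowerArm (.inl ⟨k, Nat.lt_succ_of_le hk⟩) (after k)
      (T.crossPoset (T.crossingAt g ts (k + (m + 1))) us .plain f) := by
  have hlen : ts.length = k + (m + 1) + us.length := by
    have := congrArg List.length h
    simp at this; omega
  have hleft : ∀ j < m, ts[k + j]? = some .left := fun j hj => by
    rw [getElem?_of_drop_eq h, List.getElem?_append_left (by simpa)]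
    simp [hj]
  have hright : ts[k + m]? = some .right := by
    rw [getElem?_of_drop_eq h]; simp
  have hdrop : ts.drop (k + (m + 1)) = us := by
    rw [← List.drop_drop, h, List.drop_append]; simp
  have hus : ∀ i, ts[k + (m + 1) + i]? = us[i]? := getElem?_of_drop_eq hdrop
  have hcr : ∀ i, T.crossingAt (T.crossingAt g ts (k + (m + 1))) us i =
      T.crossingAt g ts (k + (m + 1) + i) := fun i => by
    have := T.crossingAt_drop g ts (k := k + (m + 1)) (by omega) i
    rwa [hdrop] at this
  have hlast : T.lastCrossing (T.crossingAt g ts (k + (m + 1))) us = T.lastCrossing g ts := by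
    rw [lastCrossing, hcr, lastCrossing, hlen]
  have hb : chainSize (T.degree (T.prev (T.twin
      (T.lastCrossing (T.crossingAt g ts (k + (m + 1))) us)))) f =
      chainSize (T.degree (T.prev (T.twin (T.lastCrossing g ts)))) f := by rw [hlast]
  -- Crossings of the side are those of `α` shifted by `k + (m + 1)`. The side is plain at its
  -- start, so that chain is empty there; the chain at the end is unchanged.
  refine LabeledOrder.isLowerArm_generate (fun
    | .inl i => .inl ⟨k + (m + 1) + i.val, by have := i.2; omega⟩
    | .inr (.inl j) => j.elim0
    | .inr (.inr j) => .inr (.inr ⟨j.val, j.2.trans_eq hb⟩)) ?_ ?_ ?_ ?_ ?_ ?_ ?_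
  · rintro (i | i | i) (j | j | j) hij
    · simp only [Sum.inl.injEq, Fin.mk.injEq, Nat.add_left_cancel_iff] at hij
      rw [Fin.ext hij]
    · exact j.elim0
    · cases hij
    · exact i.elim0
    · exact i.elim0
    · exact i.elim0
    · cases hij
    · exact j.elim0
    · simp only [Sum.inr.injEq, Fin.mk.injEq] at hij
      rw [Fin.ext hij]
  · rintro (i | i | i)
    · change k < k + (m + 1) + i.val; omega
    · exact i.elim0
    · trivial
  · rintro (i | i | i) hi
    · change k < i.val at hi
      have hi2 := i.2
      by_cases hi' : i.val ≤ k + m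
      · right
        have h1 := crossRel_left_run (ts := ts) (n := ts.length + 1)
          (a := chainSize (T.degree (T.prev g)) s)
          (b := chainSize (T.degree (T.prev (T.twin (T.lastCrossing g ts)))) f) (k := k)
          (m := i.val - k) (by omega) fun j hj => hleft j (by omega)
        convert h1 using 3
        omega
      · exact .inl ⟨.inl ⟨i.val - (k + (m + 1)), by omega⟩, congrArg Sum.inl (Fin.ext (by
          change _ + (_ - _) = _; omega))⟩
    · exact hi.elim
    · exact .inl ⟨.inr (.inr ⟨i.val, i.2.trans_eq hb.symm⟩), rfl⟩
  · rintro (i | i | i) (j | j | j) hij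
    · have hi := i.2
      have hmem : k + (m + 1) ≤ i.val := by
        rcases hij with ⟨h1, h2⟩ | ⟨h1, h2⟩
        · change i.val + 1 = k + (m + 1) + j.val at h1
          -- Only crossing `k + m` could enter from outside; that would take a left turn, but the
          -- turn there is right.
          by_contra hlt
          have : i.val = k + m := by omega
          rw [this, hright] at h2
          simp at h2
        · change k + (m + 1) + j.val + 1 = i.val at h1
          omega
      exact ⟨.inl ⟨i.val - (k + (m + 1)), by omega⟩, congrArg Sum.inl (Fin.ext (by
          change _ + (_ - _) = _; omega))⟩
    · exact j.elim0
    · have h1 : i.val + 1 = ts.length + 1 := hij.1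
      exact ⟨.inl ⟨us.length, by omega⟩, congrArg Sum.inl (Fin.ext (by
          change k + (m + 1) + us.length = _; omega))⟩
    · have h1 : k + (m + 1) + j.val = 0 := hij.2
      omega
    · exact j.elim0
    · exact hij.elim
    · exact ⟨.inr (.inr ⟨i.val, i.2.trans_eq hb.symm⟩), rfl⟩
    · exact j.elim0
    · exact ⟨.inr (.inr ⟨i.val, i.2.trans_eq hb.symm⟩), rfl⟩
  · rintro (i | i | i) (j | j | j) hij
    · refine .single ?_
      rcases hij with ⟨h1, h2⟩ | ⟨h1, h2⟩
      · exact .inl ⟨by change k + (m + 1) + i.val + 1 = k + (m + 1) + j.val; omega,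
          (hus _).trans h2⟩
      · exact .inr ⟨by change k + (m + 1) + j.val + 1 = k + (m + 1) + i.val; omega,
          (hus _).trans h2⟩
    · exact j.elim0
    · refine .single ⟨?_, ?_⟩
      · have h1 : i.val + 1 = us.length + 1 := hij.1
        change k + (m + 1) + i.val + 1 = ts.length + 1; omega
      · exact hij.2.trans hb
    · exact i.elim0
    · exact i.elim0
    · exact i.elim0
    · refine .single ⟨hij.1, ?_⟩
      have h1 : j.val + 1 = us.length + 1 := hij.2
      change k + (m + 1) + j.val + 1 = ts.length + 1; omega
    · exact j.elim0
    · exact .single hij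
  · rintro (i | i | i) (j | j | j) hij
    · refine .single ?_
      rcases hij with ⟨h1, h2⟩ | ⟨h1, h2⟩
      · change k + (m + 1) + i.val + 1 = k + (m + 1) + j.val at h1
        exact .inl ⟨by omega, (hus _).symm.trans h2⟩
      · change k + (m + 1) + j.val + 1 = k + (m + 1) + i.val at h1
        exact .inr ⟨by omega, (hus _).symm.trans h2⟩
    · exact j.elim0
    · refine .single ⟨?_, ?_⟩
      · have h1 : k + (m + 1) + i.val + 1 = ts.length + 1 := hij.1
        omega
      · exact hij.2.trans hb.symm
    · exact i.elim0
    · exact i.elim0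
    · exact i.elim0
    · refine .single ⟨hij.1, ?_⟩
      have h1 : k + (m + 1) + j.val + 1 = ts.length + 1 := hij.2
      omega
    · exact j.elim0
    · exact .single hij
  · rintro (i | i | i)
    · exact congrArg T.edge (hcr i).symm
    · exact i.elim0
    · simp only [hlast]

/-- The previous lemma upside down: right turns descend from `c`, and the first left turn starts an
up-closed remainder. -/
lemma isUpperArm_after_of_append (hk : k ≤ ts.length)
    (h : ts.drop k = List.replicate m .right ++ .left :: us) :
    (T.crossPoset g ts s f).IsUpperArm (.inl ⟨k, Nat.lt_succ_of_le hk⟩) (after k)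
      (T.crossPoset (T.crossingAt g ts (k + (m + 1))) us .plain f) := by
  have hlen : ts.length = k + (m + 1) + us.length := by
    have := congrArg List.length h
    simp at this; omega
  have hright : ∀ j < m, ts[k + j]? = some .right := fun j hj => by
    rw [getElem?_of_drop_eq h, List.getElem?_append_left (by simpa)]
    simp [hj]
  have hleft : ts[k + m]? = some .left := by
    rw [getElem?_of_drop_eq h]; simp
  have hdrop : ts.drop (k + (m + 1)) = us := by
    rw [← List.drop_drop, h, List.drop_append]; simp
  have hus : ∀ i, ts[k + (m + 1) + i]? = us[i]? := getElem?_of_drop_eq hdrop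
  have hcr : ∀ i, T.crossingAt (T.crossingAt g ts (k + (m + 1))) us i =
      T.crossingAt g ts (k + (m + 1) + i) := fun i => by
    have := T.crossingAt_drop g ts (k := k + (m + 1)) (by omega) i
    rwa [hdrop] at this
  have hlast : T.lastCrossing (T.crossingAt g ts (k + (m + 1))) us = T.lastCrossing g ts := by
    rw [lastCrossing, hcr, lastCrossing, hlen]
  have hb : chainSize (T.degree (T.prev (T.twin
      (T.lastCrossing (T.crossingAt g ts (k + (m + 1))) us)))) f =
      chainSize (T.degree (T.prev (T.twin (T.lastCrossing g ts)))) f := by rw [hlast]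
  refine LabeledOrder.isUpperArm_generate (fun
    | .inl i => .inl ⟨k + (m + 1) + i.val, by have := i.2; omega⟩
    | .inr (.inl j) => j.elim0
    | .inr (.inr j) => .inr (.inr ⟨j.val, j.2.trans_eq hb⟩)) ?_ ?_ ?_ ?_ ?_ ?_ ?_
  · rintro (i | i | i) (j | j | j) hij
    · simp only [Sum.inl.injEq, Fin.mk.injEq, Nat.add_left_cancel_iff] at hij
      rw [Fin.ext hij]
    · exact j.elim0
    · cases hij
    · exact i.elim0
    · exact i.elim0
    · exact i.elim0
    · cases hij
    · exact j.elim0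
    · simp only [Sum.inr.injEq, Fin.mk.injEq] at hij
      rw [Fin.ext hij]
  · rintro (i | i | i)
    · change k < k + (m + 1) + i.val; omega
    · exact i.elim0
    · trivial
  · rintro (i | i | i) hi
    · change k < i.val at hi
      have hi2 := i.2
      by_cases hi' : i.val ≤ k + m
      · right
        have h1 := crossRel_right_run (ts := ts) (n := ts.length + 1)
          (a := chainSize (T.degree (T.prev g)) s)
          (b := chainSize (T.degree (T.prev (T.twin (T.lastCrossing g ts)))) f) (k := k)
          (m := i.val - k) (by omega) fun j hj => hright j (by omega)
        convert h1 using 3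
        omega
      · exact .inl ⟨.inl ⟨i.val - (k + (m + 1)), by omega⟩, congrArg Sum.inl (Fin.ext (by
          change _ + (_ - _) = _; omega))⟩
    · exact hi.elim
    · exact .inl ⟨.inr (.inr ⟨i.val, i.2.trans_eq hb.symm⟩), rfl⟩
  · rintro (i | i | i) (j | j | j) hij
    · have hi := i.2
      have hmem : k + (m + 1) ≤ i.val := by
        rcases hij with ⟨h1, h2⟩ | ⟨h1, h2⟩
        · change k + (m + 1) + j.val + 1 = i.val at h1
          omega
        · change i.val + 1 = k + (m + 1) + j.val at h1
          by_contra hlt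
          have : i.val = k + m := by omega
          rw [this, hleft] at h2
          simp at h2
      exact ⟨.inl ⟨i.val - (k + (m + 1)), by omega⟩, congrArg Sum.inl (Fin.ext (by
          change _ + (_ - _) = _; omega))⟩
    · exact j.elim0
    · have h1 : i.val + 1 = ts.length + 1 := hij.2
      exact ⟨.inl ⟨us.length, by omega⟩, congrArg Sum.inl (Fin.ext (by
          change k + (m + 1) + us.length = _; omega))⟩
    · have h1 : k + (m + 1) + j.val = 0 := hij.1
      omega
    · exact j.elim0
    · exact hij.elim
    · exact ⟨.inr (.inr ⟨i.val, i.2.trans_eq hb.symm⟩), rfl⟩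
    · exact j.elim0
    · exact ⟨.inr (.inr ⟨i.val, i.2.trans_eq hb.symm⟩), rfl⟩
  · rintro (i | i | i) (j | j | j) hij
    · refine .single ?_
      rcases hij with ⟨h1, h2⟩ | ⟨h1, h2⟩
      · exact .inl ⟨by change k + (m + 1) + i.val + 1 = k + (m + 1) + j.val; omega,
          (hus _).trans h2⟩
      · exact .inr ⟨by change k + (m + 1) + j.val + 1 = k + (m + 1) + i.val; omega,
          (hus _).trans h2⟩
    · exact j.elim0
    · refine .single ⟨?_, ?_⟩
      · have h1 : i.val + 1 = us.length + 1 := hij.1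
        change k + (m + 1) + i.val + 1 = ts.length + 1; omega
      · exact hij.2.trans hb
    · exact i.elim0
    · exact i.elim0
    · exact i.elim0
    · refine .single ⟨hij.1, ?_⟩
      have h1 : j.val + 1 = us.length + 1 := hij.2
      change k + (m + 1) + j.val + 1 = ts.length + 1; omega
    · exact j.elim0
    · exact .single hij
  · rintro (i | i | i) (j | j | j) hij
    · refine .single ?_
      rcases hij with ⟨h1, h2⟩ | ⟨h1, h2⟩
      · change k + (m + 1) + i.val + 1 = k + (m + 1) + j.val at h1
        exact .inl ⟨by omega, (hus _).symm.trans h2⟩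
      · change k + (m + 1) + j.val + 1 = k + (m + 1) + i.val at h1
        exact .inr ⟨by omega, (hus _).symm.trans h2⟩
    · exact j.elim0
    · refine .single ⟨?_, ?_⟩
      · have h1 : k + (m + 1) + i.val + 1 = ts.length + 1 := hij.1
        omega
      · exact hij.2.trans hb.symm
    · exact i.elim0
    · exact i.elim0
    · exact i.elim0
    · refine .single ⟨hij.1, ?_⟩
      have h1 : k + (m + 1) + j.val + 1 = ts.length + 1 := hij.2
      omega
    · exact j.elim0
    · exact .single hij
  · rintro (i | i | i)
    · exact congrArg T.edge (hcr i).symm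
    · exact i.elim0
    · simp only [hlast]

lemma drop_eq_replicate_length {t : Turn} (hk : k ≤ ts.length)
    (h : ts.drop k = List.replicate m t) : ts.length = k + m := by
  have := congrArg List.length h
  simp at this; omega

/-- With left turns only, every later crossing is above `c`, and so is the top of a chain at the
end, which lies above the last crossing. What survives is this chain without its top: the ends of
arcs other than the side, counted from the side. -/
lemma isLowerArm_after_of_replicate [Finite H] (hk : k ≤ ts.length)
    (h : ts.drop k = List.replicate m .left) :
    (T.crossPoset g ts s f).IsLowerArm (.inl ⟨k, Nat.lt_succ_of_le hk⟩) (after k)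
      (T.sidePoset (T.prev (T.twin (T.lastCrossing g ts))) f .plain) := by
  have hlen := drop_eq_replicate_length hk h
  have hleft : ∀ j < m, ts[k + j]? = some .left := fun j hj => by
    rw [getElem?_of_drop_eq h]; simp [hj]
  have hrun : ∀ i : Fin (ts.length + 1), k ≤ i.val →
      Relation.ReflTransGen (crossRel (n := ts.length + 1) (a := chainSize (T.degree (T.prev g)) s)
        (b := chainSize (T.degree (T.prev (T.twin (T.lastCrossing g ts)))) f) ts)
        (.inl ⟨k, Nat.lt_succ_of_le hk⟩) (.inl i) := by
    intro i hi
    have hi2 := i.2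
    have h1 := crossRel_left_run (ts := ts) (n := ts.length + 1)
      (a := chainSize (T.degree (T.prev g)) s)
      (b := chainSize (T.degree (T.prev (T.twin (T.lastCrossing g ts)))) f) (k := k)
      (m := i.val - k) (by omega) fun j hj => hleft j (by omega)
    convert h1 using 3
    omega
  cases f with
  | plain =>
    refine LabeledOrder.isLowerArm_generate (fun
      | .inl i => i.elim0
      | .inr (.inl i) => i.elim0
      | .inr (.inr i) => i.elim0) ?_ ?_ ?_ ?_ ?_ ?_ ?_
    · rintro (i | i | i) <;> exact i.elim0
    · rintro (i | i | i) <;> exact i.elim0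
    · rintro (i | i | i) hi
      · exact .inr (hrun i (le_of_lt hi))
      · exact hi.elim
      · exact i.elim0
    · rintro x (i | i | i) <;> exact i.elim0
    · rintro (i | i | i) <;> exact i.elim0
    · rintro (i | i | i) <;> exact i.elim0
    · rintro (i | i | i) <;> exact i.elim0
  | notched =>
    have hd := T.degree_pos (T.prev (T.twin (T.lastCrossing g ts)))
    refine LabeledOrder.isLowerArm_generate (fun
      | .inl i => i.elim0
      | .inr (.inl i) => .inr (.inr ⟨i.val, i.2.trans_le (Nat.sub_le _ _)⟩)
      | .inr (.inr i) => i.elim0) ?_ ?_ ?_ ?_ ?_ ?_ ?_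
    · rintro (i | i | i) (j | j | j) hij
      all_goals try first | exact i.elim0 | exact j.elim0
      simp only [Sum.inr.injEq, Fin.mk.injEq] at hij
      rw [Fin.ext hij]
    · rintro (i | i | i)
      · exact i.elim0
      · trivial
      · exact i.elim0
    · rintro (i | i | i) hi
      · exact .inr (hrun i (le_of_lt hi))
      · exact hi.elim
      · have hi2 : i.val < T.degree (T.prev (T.twin (T.lastCrossing g ts))) := i.2
        by_cases hi' : i.val < T.degree (T.prev (T.twin (T.lastCrossing g ts))) - 1
        · exact .inl ⟨.inr (.inl ⟨i.val, hi'⟩), rfl⟩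
        -- This is the top element, whose number is the degree minus one.
        · refine .inr ((hrun ⟨ts.length, Nat.lt_succ_self _⟩ hk).tail ⟨rfl, ?_⟩)
          change i.val + 1 = T.degree (T.prev (T.twin (T.lastCrossing g ts)))
          omega
    · rintro (i | i | i) (j | j | j) hij
      all_goals try exact j.elim0
      · have h1 : j.val + 1 = T.degree (T.prev (T.twin (T.lastCrossing g ts))) := hij.2
        have h2 : j.val < T.degree (T.prev (T.twin (T.lastCrossing g ts))) - 1 := j.2
        omega
      · exact hij.elim
      · have h1 : i.val + 1 = j.val := hij
        exact ⟨.inr (.inl ⟨i.val, by have := j.2; omega⟩), rfl⟩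
    · rintro (i | i | i) (j | j | j) hij
      all_goals try first | exact i.elim0 | exact j.elim0
      exact .single hij
    · rintro (i | i | i) (j | j | j) hij
      all_goals try first | exact i.elim0 | exact j.elim0
      exact .single hij
    · rintro (i | i | i)
      · exact i.elim0
      · rfl
      · exact i.elim0

/-- Here the bottom of the chain is the element that lies below the last crossing and is deleted
with it. -/
lemma isUpperArm_after_of_replicate [Finite H] (hk : k ≤ ts.length)
    (h : ts.drop k = List.replicate m .right) :
    (T.crossPoset g ts s f).IsUpperArm (.inl ⟨k, Nat.lt_succ_of_le hk⟩) (after k)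
      (T.sidePoset (T.next (T.twin (T.lastCrossing g ts))) .plain f) := by
  have hlen := drop_eq_replicate_length hk h
  have hright : ∀ j < m, ts[k + j]? = some .right := fun j hj => by
    rw [getElem?_of_drop_eq h]; simp [hj]
  have hrun : ∀ i : Fin (ts.length + 1), k ≤ i.val →
      Relation.ReflTransGen (crossRel (n := ts.length + 1) (a := chainSize (T.degree (T.prev g)) s)
        (b := chainSize (T.degree (T.prev (T.twin (T.lastCrossing g ts)))) f) ts)
        (.inl i) (.inl ⟨k, Nat.lt_succ_of_le hk⟩) := by
    intro i hi
    have hi2 := i.2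
    have h1 := crossRel_right_run (ts := ts) (n := ts.length + 1)
      (a := chainSize (T.degree (T.prev g)) s)
      (b := chainSize (T.degree (T.prev (T.twin (T.lastCrossing g ts)))) f) (k := k)
      (m := i.val - k) (by omega) fun j hj => hright j (by omega)
    convert h1 using 3
    omega
  cases f with
  | plain =>
    refine LabeledOrder.isUpperArm_generate (fun
      | .inl i => i.elim0
      | .inr (.inl i) => i.elim0
      | .inr (.inr i) => i.elim0) ?_ ?_ ?_ ?_ ?_ ?_ ?_
    · rintro (i | i | i) <;> exact i.elim0
    · rintro (i | i | i) <;> exact i.elim0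
    · rintro (i | i | i) hi
      · exact .inr (hrun i (le_of_lt hi))
      · exact hi.elim
      · exact i.elim0
    · rintro x (i | i | i) <;> exact i.elim0
    · rintro (i | i | i) <;> exact i.elim0
    · rintro (i | i | i) <;> exact i.elim0
    · rintro (i | i | i) <;> exact i.elim0
  | notched =>
    -- The side is itself the first end counterclockwise from `α`. Counting from the side instead of
    -- `α` shifts the index by one.
    have hrot : T.twin (T.next (T.twin (T.lastCrossing g ts))) =
        T.rot (T.prev (T.twin (T.lastCrossing g ts))) := by simp [rot]
    have hdeg : T.degree (T.twin (T.next (T.twin (T.lastCrossing g ts)))) =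
        T.degree (T.prev (T.twin (T.lastCrossing g ts))) := by rw [hrot, degree_rot]
    refine LabeledOrder.isUpperArm_generate (fun
      | .inl i => i.elim0
      | .inr (.inl i) => i.elim0
      | .inr (.inr i) => .inr (.inr ⟨i.val + 1, by
          have h1 : i.val < T.degree (T.twin (T.next (T.twin (T.lastCrossing g ts)))) - 1 := i.2
          change i.val + 1 < T.degree (T.prev (T.twin (T.lastCrossing g ts)))
          omega⟩)) ?_ ?_ ?_ ?_ ?_ ?_ ?_
    · rintro (i | i | i) (j | j | j) hij
      all_goals try first | exact i.elim0 | exact j.elim0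
      simp only [Sum.inr.injEq, Fin.mk.injEq, Nat.add_right_cancel_iff] at hij
      rw [Fin.ext hij]
    · rintro (i | i | i)
      · exact i.elim0
      · exact i.elim0
      · trivial
    · rintro (i | i | i) hi
      · exact .inr (hrun i (le_of_lt hi))
      · exact hi.elim
      · have hi2 : i.val < T.degree (T.prev (T.twin (T.lastCrossing g ts))) := i.2
        by_cases hi' : i.val = 0
        · refine .inr (.trans (.single ?_) (hrun ⟨ts.length, Nat.lt_succ_self _⟩ hk))
          exact ⟨hi', rfl⟩
        · refine .inl ⟨.inr (.inr ⟨i.val - 1, ?_⟩), congrArg (Sum.inr ∘ Sum.inr) (Fin.ext ?_)⟩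
          · change i.val - 1 < T.degree (T.twin (T.next (T.twin (T.lastCrossing g ts)))) - 1
            omega
          · change i.val - 1 + 1 = i.val
            omega
    · rintro (i | i | i) (j | j | j) hij
      all_goals try exact j.elim0
      · have h1 : j.val + 1 = 0 := hij.1
        omega
      · exact hij.elim
      · have h1 : j.val + 1 + 1 = i.val := hij
        have hi2 : i.val < T.degree (T.prev (T.twin (T.lastCrossing g ts))) := i.2
        refine ⟨.inr (.inr ⟨i.val - 1, ?_⟩), congrArg (Sum.inr ∘ Sum.inr) (Fin.ext ?_)⟩
        · change i.val - 1 < T.degree (T.twin (T.next (T.twin (T.lastCrossing g ts)))) - 1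
          omega
        · change i.val - 1 + 1 = i.val
          omega
    · rintro (i | i | i) (j | j | j) hij
      all_goals try first | exact i.elim0 | exact j.elim0
      exact .single (congrArg (· + 1) (show i.val + 1 = j.val from hij))
    · rintro (i | i | i) (j | j | j) hij
      all_goals try first | exact i.elim0 | exact j.elim0
      exact .single (Nat.succ_injective (show i.val + 1 + 1 = j.val + 1 from hij))
    · rintro (i | i | i)
      · exact i.elim0
      · exact i.elim0
      · change T.edge (T.rot^[i.val + 1 + 1] _) = T.edge (T.rot^[i.val + 1] _)
        rw [Function.iterate_succ_apply]
        exact congrArg (fun c => T.edge (T.rot^[i.val + 1] c)) hrot.symm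

lemma isLowerArm_after [Finite H] (hk : k ≤ ts.length) :
    (T.crossPoset g ts s f).IsLowerArm (.inl ⟨k, Nat.lt_succ_of_le hk⟩) (after k)
      (T.poset (T.fanSide .left (T.twin (T.crossingAt g ts k)) (ts.drop k) f)) := by
  rcases exists_left_run (ts.drop k) with ⟨m, h⟩ | ⟨m, us, h⟩
  · have := T.lastCrossing_drop g ts hk
    rw [h, fanSide_left_replicate, ← h, this]
    exact isLowerArm_after_of_replicate hk h
  · have := T.crossingAt_drop g ts hk (m + 1)
    rw [h, fanSide_left_append, ← h, this]
    exact isLowerArm_after_of_append hk h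

lemma isUpperArm_after [Finite H] (hk : k ≤ ts.length) :
    (T.crossPoset g ts s f).IsUpperArm (.inl ⟨k, Nat.lt_succ_of_le hk⟩) (after k)
      (T.poset (T.fanSide .right (T.twin (T.crossingAt g ts k)) (ts.drop k) f)) := by
  rcases exists_right_run (ts.drop k) with ⟨m, h⟩ | ⟨m, us, h⟩
  · have := T.lastCrossing_drop g ts hk
    rw [h, fanSide_right_replicate, ← h, this]
    exact isUpperArm_after_of_replicate hk h
  · have := T.crossingAt_drop g ts hk (m + 1)
    rw [h, fanSide_right_append, ← h, this]
    exact isUpperArm_after_of_append hk h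

end Arms

end Triangulation

namespace Triangulation

variable {H : Type*} {T : Triangulation H}

/-! ### The elements of `P_α` below a given one -/

lemma isLow_zero (R : Set T.Vertex) (e : H) (ts : List Turn) : T.IsLow R e ts 0 :=
  .inl (List.nil_prefix)

lemma IsLow.of_succ {R : Set T.Vertex} {e : H} {ts : List Turn} {m : ℕ}
    (h : T.IsLow R e ts (m + 1)) : T.IsLow R e ts m := by
  rcases h with h | ⟨n, hn, rfl, -⟩
  · exact .inl (replicate_prefix_of_le (Nat.le_succ m) h)
  · obtain rfl : m = n := by omega
    exact .inl List.prefix_rfl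

lemma isLow_right_cons_succ {R : Set T.Vertex} {e : H} {ts : List Turn} {m : ℕ} :
    T.IsLow R e (.right :: ts) (m + 1) ↔ T.IsLow R (T.unrot e) ts m := by
  simp only [IsLow, List.replicate_succ, List.cons_prefix_cons, true_and,
    Function.iterate_succ_apply]
  refine or_congr Iff.rfl ⟨?_, ?_⟩
  · rintro ⟨n, hn, h1, h2⟩
    obtain rfl : m = n := by omega
    cases m with
    | zero => simp at h1
    | succ m =>
      rw [List.replicate_succ, List.cons.injEq] at h1
      exact ⟨m, rfl, h1.2, h2⟩
  · rintro ⟨n, rfl, rfl, h2⟩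
    exact ⟨n + 1, rfl, by rw [List.replicate_succ], h2⟩

lemma isLow_left_cons {R : Set T.Vertex} {e : H} {ts : List Turn} {m : ℕ} :
    T.IsLow R e (.left :: ts) m ↔ m = 0 := by
  constructor
  · rintro (h | ⟨n, rfl, h, -⟩)
    · cases m with
      | zero => rfl
      | succ m => simp [List.replicate_succ] at h
    · cases n <;> simp [List.replicate_succ] at h
  · rintro rfl
    exact isLow_zero _ _ _

lemma isLow_right_append_left {R : Set T.Vertex} {e : H} {ts : List Turn} {n m : ℕ} :
    T.IsLow R e (List.replicate n .right ++ .left :: ts) m ↔ m ≤ n := by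
  induction n generalizing e m with
  | zero => simpa using isLow_left_cons
  | succ n ih =>
    rw [List.replicate_succ, List.cons_append]
    cases m with
    | zero => simp [isLow_zero]
    | succ m => rw [isLow_right_cons_succ, ih, Nat.add_le_add_iff_right]

/-- The elements of `S` below `c` are, from top to bottom, those at the low positions of a path. -/
def IsLowArm (P : LabeledOrder T.Edge) (c : P.carrier) (S : Set P.carrier) (R : Set T.Vertex)
    (e : H) (ts : List Turn) : Prop :=
  ∃ φ : ℕ → P.carrier, φ 0 = c ∧
    (∀ m, T.IsLow R e ts m →
      P.label (φ m) = T.edge (T.unrot^[m] e) ∧ P.le (φ m) c ∧ (m ≠ 0 → φ m ∈ S)) ∧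
    (∀ m n, T.IsLow R e ts m → T.IsLow R e ts n → φ m = φ n → m = n) ∧
    ∀ x ∈ S, P.le x c → ∃ m, T.IsLow R e ts m ∧ φ m = x

lemma isLowArm_of_forall {X : Type} [Fintype X] {r : X → X → Prop} {label : X → T.Edge} {c : X}
    {S : Set X} {R : Set T.Vertex} {e : H} {ts : List Turn} (φ : ℕ → X) (h0 : φ 0 = c)
    (hlabel : ∀ m, T.IsLow R e ts m → label (φ m) = T.edge (T.unrot^[m] e))
    (hmem : ∀ m, T.IsLow R e ts (m + 1) → φ (m + 1) ∈ S)
    (hinj : ∀ m n, T.IsLow R e ts m → T.IsLow R e ts n → φ m = φ n → m = n)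
    (hstep : ∀ m, T.IsLow R e ts (m + 1) → Relation.ReflTransGen r (φ (m + 1)) (φ m))
    (hall : ∀ x ∈ S, Relation.ReflTransGen r x c → ∃ n, T.IsLow R e ts n ∧ φ n = x) :
    IsLowArm (.generate r label) c S R e ts := by
  refine ⟨φ, h0, fun m hm => ⟨hlabel m hm, ?_, fun h => ?_⟩, hinj, hall⟩
  · change Relation.ReflTransGen r (φ m) c
    rw [← h0]
    induction m with
    | zero => exact .refl
    | succ m ih => exact (hstep m hm).trans (ih hm.of_succ)
  · obtain ⟨n, rfl⟩ := Nat.exists_eq_succ_of_ne_zero h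
    exact hmem n hm

/-- Local conditions suffice. On a way up from `S` to `c`, one stays in `S` until `c` is reached
(`hleave`); following this way from its top down, each element directly below a low one is low again
(`hback`). -/
lemma isLowArm_generate {X : Type} [Fintype X] {r : X → X → Prop} {label : X → T.Edge} {c : X}
    {S : Set X} {R : Set T.Vertex} {e : H} {ts : List Turn} (φ : ℕ → X) (h0 : φ 0 = c)
    (hlabel : ∀ m, T.IsLow R e ts m → label (φ m) = T.edge (T.unrot^[m] e))
    (hmem : ∀ m, T.IsLow R e ts (m + 1) → φ (m + 1) ∈ S)
    (hinj : ∀ m n, T.IsLow R e ts m → T.IsLow R e ts n → φ m = φ n → m = n)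
    (hstep : ∀ m, T.IsLow R e ts (m + 1) → r (φ (m + 1)) (φ m))
    (hleave : ∀ x ∈ S, ∀ z, r x z → z ∈ S ∨ z = c)
    (hback : ∀ x ∈ S, ∀ m, T.IsLow R e ts m → r x (φ m) → ∃ n, T.IsLow R e ts n ∧ φ n = x) :
    IsLowArm (.generate r label) c S R e ts := by
  refine isLowArm_of_forall φ h0 hlabel hmem hinj (fun m hm => .single (hstep m hm)) ?_
  intro x hx h
  induction h using Relation.ReflTransGen.head_induction_on with
  | refl => exact ⟨0, isLow_zero _ _ _, h0⟩
  | head hxz _ ih =>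
    rcases hleave _ hx _ hxz with hz | rfl
    · obtain ⟨m, hm, rfl⟩ := ih hz
      exact hback _ hx m hm hxz
    · exact hback _ hx 0 (isLow_zero _ _ _) (h0 ▸ hxz)

lemma IsLowArm.of_isom {P P' : LabeledOrder T.Edge} {f : P.carrier ≃ P'.carrier}
    (hf : LabeledOrder.IsIsom f) {c : P.carrier} {S : Set P'.carrier} {R : Set T.Vertex}
    {e : H} {ts : List Turn} (h : IsLowArm P c (f ⁻¹' S) R e ts) :
    IsLowArm P' (f c) S R e ts := by
  obtain ⟨φ, h0, h1, h2, h3⟩ := h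
  refine ⟨f ∘ φ, congrArg f h0, fun m hm => ⟨(hf.2 _).trans (h1 m hm).1,
    (hf.1 _ _).2 (h1 m hm).2.1, (h1 m hm).2.2⟩, fun m n hm hn h => h2 m n hm hn (f.injective h),
    fun x hx hxc => ?_⟩
  obtain ⟨x, rfl⟩ := f.surjective x
  obtain ⟨m, hm, rfl⟩ := h3 x hx ((hf.1 _ _).1 hxc)
  exact ⟨m, hm, rfl⟩

lemma IsLowArm.comap {P P' : LabeledOrder T.Edge} {f : P.carrier ≃ P'.carrier}
    (hf : LabeledOrder.IsIsom f) {c : P.carrier} {c' : P'.carrier} {S : Set P.carrier}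
    {S' : Set P'.carrier} {R : Set T.Vertex} {e : H} {ts : List Turn}
    (h : IsLowArm P' c' S' R e ts) (hc : f c = c') (hS : ∀ x, f x ∈ S' ↔ x ∈ S) :
    IsLowArm P c S R e ts := by
  have hS' : f.symm ⁻¹' S = S' := by
    ext x
    rw [Set.mem_preimage, ← hS, f.apply_symm_apply]
  have := IsLowArm.of_isom (S := S) hf.symm (by rwa [hS'])
  rwa [← hc, f.symm_apply_apply] at this

/-- For a half that turns left immediately and so has nothing below `c`. -/
lemma isLowArm_of_eq_zero {P : LabeledOrder T.Edge} {c : P.carrier} {S : Set P.carrier}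
    {R : Set T.Vertex} {e : H} {ts : List Turn} (hts : ∀ m, T.IsLow R e ts m → m = 0)
    (hc : P.label c = T.edge e) (h : ∀ x ∈ S, ¬ P.le x c) : IsLowArm P c S R e ts := by
  refine ⟨fun _ => c, rfl, fun m hm => ?_, fun m n hm hn _ => (hts m hm).trans (hts n hn).symm,
    fun x hx hxc => absurd hxc (h x hx)⟩
  obtain rfl := hts m hm
  exact ⟨hc, P.refl c, fun h => absurd rfl h⟩

/-- Add an element at the top. -/
lemma IsLowArm.cons {P : LabeledOrder T.Edge} {c c' : P.carrier} {S S' : Set P.carrier}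
    {R : Set T.Vertex} {e : H} {ts : List Turn} (h : IsLowArm P c' S R (T.unrot e) ts)
    (hc : P.label c = T.edge e) (hle : P.le c' c) (hcS : c ∉ S') (hS : S ⊆ S') (hc' : c' ∈ S')
    (hx : ∀ x ∈ S', P.le x c → x = c' ∨ x ∈ S ∧ P.le x c') :
    IsLowArm P c S' R e (.right :: ts) := by
  obtain ⟨φ, h0, h1, h2, h3⟩ := h
  have hmem : ∀ m, T.IsLow R (T.unrot e) ts m → φ m ∈ S' := fun m hm => by
    cases m with
    | zero => rwa [h0]
    | succ m => exact hS ((h1 _ hm).2.2 (Nat.succ_ne_zero m))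
  refine ⟨fun m => match m with | 0 => c | m + 1 => φ m, rfl, ?_, ?_, ?_⟩
  · rintro (_ | m) hm
    · exact ⟨hc, P.refl c, fun h => absurd rfl h⟩
    · rw [isLow_right_cons_succ] at hm
      exact ⟨by simpa using (h1 m hm).1, P.trans _ _ _ (h1 m hm).2.1 hle, fun _ => hmem m hm⟩
  · rintro (_ | m) (_ | n) hm hn hmn
    · rfl
    · rw [isLow_right_cons_succ] at hn
      exact absurd (hmem n hn) (by simpa [← hmn] using hcS)
    · rw [isLow_right_cons_succ] at hm
      exact absurd (hmem m hm) (by simpa [hmn] using hcS)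
    · rw [isLow_right_cons_succ] at hm hn
      exact congrArg (· + 1) (h2 m n hm hn hmn)
  · intro x hxS hxc
    rcases hx x hxS hxc with rfl | ⟨hxS', hxc'⟩
    · exact ⟨1, isLow_right_cons_succ.2 (isLow_zero _ _ _), h0⟩
    · obtain ⟨m, hm, rfl⟩ := h3 x hxS' hxc'
      exact ⟨m + 1, isLow_right_cons_succ.2 hm, rfl⟩

/-- The isomorphisms and the other facts about an exchange relation `X` and an element `c` from
which the exchange relation follows. -/
structure IsResolution (P : LabeledOrder T.Edge) (γ : T.Edge) (X : T.Exchange) (c : P.carrier) :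
    Prop where
  label_iff : ∀ x, P.label x = γ ↔ x = c
  blue : (X.poset .blue).Iso (P.restrict fun x => ¬ P.le c x)
  red : (X.poset .red).Iso (P.restrict fun x => ¬ P.le x c)
  admissible : T.IsAdmissible X.reversed X.diagonal
  label_inj : ∀ x y, P.le x c → P.le y c → P.label x = P.label y → x = y
  isOrange : ∀ δ, X.IsOrange δ ↔ ∃ x, P.le x c ∧ P.label x = δ

lemma IsResolution.of_isom {P P' : LabeledOrder T.Edge} {f : P.carrier ≃ P'.carrier}
    (hf : LabeledOrder.IsIsom f) {γ : T.Edge} {X : T.Exchange} {c : P.carrier}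
    (h : IsResolution P γ X c) : IsResolution P' γ X (f c) where
  label_iff x := by
    obtain ⟨x, rfl⟩ := f.surjective x
    rw [hf.2, h.label_iff, f.apply_eq_iff_eq]
  blue := h.blue.trans (hf.iso_restrict fun x => not_congr (hf.1 c x).symm)
  red := h.red.trans (hf.iso_restrict fun x => not_congr (hf.1 x c).symm)
  admissible := h.admissible
  label_inj x y hx hy hxy := by
    obtain ⟨x, rfl⟩ := f.surjective x
    obtain ⟨y, rfl⟩ := f.surjective y
    rw [hf.1] at hx hy
    rw [hf.2, hf.2] at hxy
    rw [h.label_inj x y hx hy hxy]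
  isOrange δ := by
    rw [h.isOrange]
    constructor
    · rintro ⟨x, hx, rfl⟩
      exact ⟨f x, (hf.1 _ _).2 hx, hf.2 x⟩
    · rintro ⟨x, hx, rfl⟩
      obtain ⟨x, rfl⟩ := f.surjective x
      exact ⟨x, (hf.1 _ _).1 hx, (hf.2 x).symm⟩

/-- The low positions along the two halves of the diagonal enumerate the elements below `c`. So
distinct labels below `c` yield the injectivity conditions of `IsAdmissible` (the two halves share
only `c`, hence `m = n = 0` in `inj_both`), and the lamination criterion `exists_elementary_iff`
turns into a description of the labels below `c`. -/
lemma isResolution_of_arms {P : LabeledOrder T.Edge} {γ : T.Edge} {X : T.Exchange} {c : P.carrier}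
    {S₁ S₂ : Set P.carrier} (hc : P.label c = γ)
    (blue : (X.poset .blue).Iso (P.restrict fun x => ¬ P.le c x))
    (red : (X.poset .red).Iso (P.restrict fun x => ¬ P.le x c))
    (hlabel : ∀ x, P.label x = P.label c → x = c)
    (hinj : ∀ x y, P.le x c → P.le y c → P.label x = P.label y → x = y)
    (hS : Disjoint S₁ S₂) (h₁ : c ∉ S₁) (h₂ : c ∉ S₂) (hcov : ∀ x, x = c ∨ x ∈ S₁ ∨ x ∈ S₂)
    (arm₁ : IsLowArm P c S₁ X.reversed X.diagonal.e X.diagonal.fwd)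
    (arm₂ : IsLowArm P c S₂ X.reversed (T.twin X.diagonal.e) X.diagonal.bwd)
    (puncture : ∀ v ∈ X.reversed, T.IsPuncture v)
    (no_arc : ∀ d, ¬ T.IsBoundary d → T.vertex d ∈ X.reversed → T.vertex (T.next d) ∉ X.reversed)
    (avoids_fwd : T.Avoids X.reversed X.diagonal.e X.diagonal.fwd)
    (avoids_bwd : T.Avoids X.reversed (T.twin X.diagonal.e) X.diagonal.bwd) :
    IsResolution P γ X c := by
  obtain ⟨φ, hφ0, hφ, hφi, hφs⟩ := arm₁
  obtain ⟨ψ, hψ0, hψ, hψi, hψs⟩ := arm₂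
  rw [Set.disjoint_left] at hS
  have hadm : T.IsAdmissible X.reversed X.diagonal := by
    refine ⟨puncture, no_arc, avoids_fwd, avoids_bwd, fun m n hm hn h => ?_, fun m n hm hn h => ?_,
      fun m n hm hn h => ?_⟩
    · rw [← (hφ m hm).1, ← (hφ n hn).1] at h
      exact hφi m n hm hn (hinj _ _ (hφ m hm).2.1 (hφ n hn).2.1 h)
    · rw [← (hψ m hm).1, ← (hψ n hn).1] at h
      exact hψi m n hm hn (hinj _ _ (hψ m hm).2.1 (hψ n hn).2.1 h)
    · rw [← (hφ m hm).1, ← (hψ n hn).1] at h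
      have h' := hinj _ _ (hφ m hm).2.1 (hψ n hn).2.1 h
      by_cases hm0 : m = 0
      · by_cases hn0 : n = 0
        · exact ⟨hm0, hn0⟩
        · rw [hm0, hφ0] at h'
          exact absurd (h' ▸ (hψ n hn).2.2 hn0) h₂
      · have hmS := (hφ m hm).2.2 hm0
        by_cases hn0 : n = 0
        · rw [hn0, hψ0] at h'
          exact absurd (h' ▸ hmS) h₁
        · exact absurd (h' ▸ (hψ n hn).2.2 hn0) (hS hmS)
  refine ⟨fun x => ⟨fun h => hlabel x (h.trans hc.symm), fun h => h ▸ hc⟩, blue, red, hadm, hinj,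
    fun δ => ?_⟩
  rw [Exchange.IsOrange]
  refine (hadm.exists_elementary_iff (δ := δ)).trans ⟨?_, ?_⟩
  · rintro ⟨m, ⟨hm, rfl⟩ | ⟨hm, rfl⟩⟩
    · exact ⟨_, (hφ m hm).2.1, (hφ m hm).1⟩
    · exact ⟨_, (hψ m hm).2.1, (hψ m hm).1⟩
  · rintro ⟨x, hx, rfl⟩
    rcases hcov x with rfl | hxS | hxS
    · exact ⟨0, .inl ⟨isLow_zero _ _ _, by
        rw [← (hφ 0 (isLow_zero _ _ _)).1, hφ0]⟩⟩
    · obtain ⟨m, hm, rfl⟩ := hφs x hxS hx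
      exact ⟨m, .inl ⟨hm, (hφ m hm).1.symm⟩⟩
    · obtain ⟨m, hm, rfl⟩ := hψs x hxS hx
      exact ⟨m, .inr ⟨hm, (hψ m hm).1.symm⟩⟩

/-! ### Below a crossing -/

lemma replicate_prefix_iff {ts : List Turn} {m : ℕ} {t : Turn} :
    List.replicate m t <+: ts ↔ ∀ j < m, ts[j]? = some t := by
  induction m generalizing ts with
  | zero => simp
  | succ m ih =>
    cases ts with
    | nil =>
      simp only [List.replicate_succ, List.prefix_nil, reduceCtorEq, List.getElem?_nil, false_iff]
      exact fun h => h 0 (Nat.succ_pos m)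
    | cons u ts =>
      rw [List.replicate_succ, List.cons_prefix_cons, ih]
      constructor
      · rintro ⟨rfl, h⟩ (_ | j) hj
        · rfl
        · exact h j (by omega)
      · intro h
        exact ⟨by simpa using (h 0 (Nat.succ_pos m)).symm, fun j hj => by
          simpa using h (j + 1) (by omega)⟩

lemma isLow_drop_iff {g : H} {ts : List Turn} {k m : ℕ} (hk : k ≤ ts.length) {R : Set T.Vertex} :
    T.IsLow R (T.crossingAt g ts k) (ts.drop k) m ↔
      (k + m ≤ ts.length ∧ ∀ j < m, ts[k + j]? = some .right) ∨
      (k + m = ts.length + 1 ∧ (∀ j, k + j < ts.length → ts[k + j]? = some .right) ∧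
        T.vertex (T.prev (T.twin (T.lastCrossing g ts))) ∈ R) := by
  have hpre : ∀ m, List.replicate m Turn.right <+: ts.drop k ↔
      (k + m ≤ ts.length ∧ ∀ j < m, ts[k + j]? = some .right) := by
    intro m
    rw [replicate_prefix_iff]
    simp only [List.getElem?_drop]
    refine ⟨fun h => ⟨?_, h⟩, fun h => h.2⟩
    cases m with
    | zero => exact hk
    | succ m =>
      have := (List.getElem?_eq_some_iff.1 (h m (Nat.lt_succ_self m))).1
      omega
  rw [IsLow, hpre]
  refine or_congr Iff.rfl ⟨?_, ?_⟩
  · rintro ⟨n, rfl, h1, h2⟩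
    have hlen := drop_eq_replicate_length hk h1
    have h0 : List.replicate n Turn.right <+: ts.drop k := ⟨[], by simp [h1]⟩
    refine ⟨by omega, fun j hj => ((hpre n).1 h0).2 j (by omega), ?_⟩
    -- After the last right turn, `next` of one more `unrot` is the corner opposite to the last
    -- crossing, where the curve ends.
    rw [Function.iterate_succ_apply', ← T.crossingAt_right_run h0,
      T.crossingAt_drop g ts hk, ← hlen] at h2
    exact h2
  · rintro ⟨h1, h2, h3⟩
    refine ⟨ts.length - k, by omega, ?_, ?_⟩
    · have h4 := (hpre (ts.length - k)).2 ⟨by omega, fun j hj => h2 j (by omega)⟩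
      exact (h4.eq_of_length (by simp)).symm
    · have h4 := (hpre (ts.length - k)).2 ⟨by omega, fun j hj => h2 j (by omega)⟩
      obtain rfl : m = ts.length - k + 1 := by omega
      rw [Function.iterate_succ_apply', ← T.crossingAt_right_run h4,
        T.crossingAt_drop g ts hk, Nat.add_sub_cancel' hk]
      exact h3

/-- Going down from crossing `k` means following right turns. If they continue to a notched end, the
last crossing still has the bottom of the chain below it; this is the extra alternative in `IsLow`,
as notched ends are the marked points in `R`. -/
lemma isLowArm_after [Finite H] (he : ∀ h, T.edge h ≠ T.edge (T.next h)) {g : H} {ts : List Turn}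
    {s f : Tag} {k : ℕ} (hk : k ≤ ts.length) {R : Set T.Vertex}
    (hR : T.vertex (T.prev (T.twin (T.lastCrossing g ts))) ∈ R ↔ f = .notched) :
    IsLowArm (T.crossPoset g ts s f) (.inl ⟨k, Nat.lt_succ_of_le hk⟩) (after k) R
      (T.crossingAt g ts k) (ts.drop k) := by
  set b := chainSize (T.degree (T.prev (T.twin (T.lastCrossing g ts)))) f with hb
  have hb0 : f = .notched → 0 < b := by rintro rfl; exact T.degree_pos _
  have hb0' : 0 < b → f = .notched := by
    cases f
    · intro h; exact absurd h (lt_irrefl 0)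
    · exact fun _ => rfl
  have hb1 : b ≠ 1 := chainSize_ne_one (T.two_le_degree he _) f
  -- The last branch is a default value, never taken at a low position.
  let φ : ℕ → Fin (ts.length + 1) ⊕ (Fin (chainSize (T.degree (T.prev g)) s) ⊕ Fin b) := fun m =>
    if h : k + m < ts.length + 1 then .inl ⟨k + m, h⟩
    else if h : 0 < b then .inr (.inr ⟨0, h⟩) else .inl ⟨k, Nat.lt_succ_of_le hk⟩
  have hφ1 : ∀ m (h : k + m < ts.length + 1), φ m = .inl ⟨k + m, h⟩ := fun m h => dif_pos h
  have hφ2 : ∀ m (_ : ¬ k + m < ts.length + 1) (hb : 0 < b), φ m = .inr (.inr ⟨0, hb⟩) :=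
    fun m h hb => (dif_neg h).trans (dif_pos hb)
  have hlow : ∀ m, T.IsLow R (T.crossingAt g ts k) (ts.drop k) m →
      (∃ h : k + m < ts.length + 1, φ m = .inl ⟨k + m, h⟩ ∧ ∀ j < m, ts[k + j]? = some .right) ∨
      (k + m = ts.length + 1 ∧ ∃ h : 0 < b, φ m = .inr (.inr ⟨0, h⟩)) := by
    intro m hm
    rw [isLow_drop_iff hk, hR] at hm
    rcases hm with ⟨h1, h2⟩ | ⟨h1, h2, h3⟩
    · exact .inl ⟨Nat.lt_succ_of_le h1, hφ1 m _, h2⟩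
    · exact .inr ⟨h1, hb0 h3, hφ2 m (by omega) _⟩
  refine isLowArm_generate φ (hφ1 0 (Nat.lt_succ_of_le hk)) ?_ ?_ ?_ ?_ ?_ ?_
  · intro m hm
    rw [isLow_drop_iff hk, hR] at hm
    rcases hm with ⟨h1, h2⟩ | ⟨h1, h2, h3⟩
    · rw [hφ1 m (Nat.lt_succ_of_le h1), ← T.crossingAt_right_run (ts := ts.drop k),
        T.crossingAt_drop g ts hk]
      rw [replicate_prefix_iff]
      simpa using h2
    · rw [hφ2 m (by omega) (hb0 h3)]
      obtain ⟨n, rfl⟩ : ∃ n, m = n + 1 := ⟨m - 1, by omega⟩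
      rw [Function.iterate_succ_apply', ← T.crossingAt_right_run (ts := ts.drop k),
        T.crossingAt_drop g ts hk]
      · have : k + n = ts.length := by omega
        rw [this]
        change T.edge (T.rot (T.prev (T.twin (T.lastCrossing g ts)))) = _
        rw [rot, edge_twin, prev_prev]
        rfl
      · rw [replicate_prefix_iff]
        simpa using fun j hj => h2 j (by omega)
  · intro m hm
    rcases hlow _ hm with ⟨h1, h2, -⟩ | ⟨-, h1, h2⟩ <;> rw [h2]
    · change k < k + (m + 1); omega
    · trivial
  · intro m n hm hn hmn
    rcases hlow _ hm with ⟨h1, h2, -⟩ | ⟨h1, h1', h2⟩ <;>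
      rcases hlow _ hn with ⟨h3, h4, -⟩ | ⟨h3, h3', h4⟩ <;> rw [h2, h4] at hmn
    · simp only [Sum.inl.injEq, Fin.mk.injEq] at hmn; omega
    · cases hmn
    · cases hmn
    · omega
  · intro m hm
    rcases hlow _ hm with ⟨h1, h2, h3⟩ | ⟨h1, h1', h2⟩ <;> rw [h2, hφ1 m (by omega)]
    · exact .inr ⟨rfl, h3 m (Nat.lt_succ_self m)⟩
    · exact ⟨rfl, by change k + m + 1 = ts.length + 1; omega⟩
  · rintro (i | i | i) hi (j | j | j) hij
    · change k < i.val at hi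
      by_cases hj : k = j.val
      · exact .inr (congrArg Sum.inl (Fin.ext hj.symm))
      · refine .inl ?_
        change k < j.val
        rcases hij with ⟨h1, -⟩ | ⟨h1, -⟩ <;> omega
    · change k < i.val at hi
      have : i.val = 0 := hij.1
      omega
    · exact .inl trivial
    · exact hi.elim
    · exact hi.elim
    · exact hi.elim
    · have h1 : j.val + 1 = ts.length + 1 := hij.2
      by_cases hj : k = j.val
      · exact .inr (congrArg Sum.inl (Fin.ext hj.symm))
      · refine .inl ?_
        change k < j.val
        omega
    · exact hij.elim
    · exact .inl trivial
  · intro x hx m hm hxm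
    rcases hlow _ hm with ⟨h1, h2, h3⟩ | ⟨h1, h1', h2⟩ <;> rw [h2] at hxm
    · rcases x with i | i | i
      · change k < i.val at hx
        rcases hxm with ⟨h4, h5⟩ | ⟨h4, h5⟩
        · change i.val + 1 = k + m at h4
          have h6 := h3 (m - 1) (by omega)
          have h7 : k + (m - 1) = i.val := by omega
          rw [h7, h5] at h6
          simp at h6
        · change k + m + 1 = i.val at h4
          change ts[k + m]? = _ at h5
          have hi := i.2
          refine ⟨m + 1, (isLow_drop_iff hk).2 (.inl ⟨by omega, fun j hj => ?_⟩), ?_⟩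
          · rcases Nat.lt_succ_iff_lt_or_eq.1 hj with hj | rfl
            · exact h3 j hj
            · exact h5
          · rw [hφ1 (m + 1) (by omega)]
            exact congrArg Sum.inl (Fin.ext h4)
      · exact hx.elim
      · have h4 : i.val = 0 := hxm.1
        have h5 : k + m + 1 = ts.length + 1 := hxm.2
        have h6 : 0 < b := lt_of_le_of_lt (Nat.zero_le _) i.2
        refine ⟨m + 1, (isLow_drop_iff hk).2 (.inr ⟨by omega, fun j hj => h3 j (by omega),
          hR.2 (hb0' h6)⟩), ?_⟩
        rw [hφ2 (m + 1) (by omega) h6]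
        exact congrArg (Sum.inr ∘ Sum.inr) (Fin.ext h4.symm)
    · rcases x with i | i | i
      -- A crossing below the bottom of the chain would make the bottom also the top.
      · exact absurd hxm.2.symm hb1
      · exact hx.elim
      · exact absurd hxm (Nat.succ_ne_zero _)

end Triangulation

namespace Triangulation

variable {H : Type*} {T : Triangulation H}

/-! ### Exchange of crossing arcs -/

lemma Avoids.drop {R : Set T.Vertex} {g : H} {ts : List Turn} (h : T.Avoids R g ts) {k : ℕ}
    (hk : k ≤ ts.length) : T.Avoids R (T.crossingAt g ts k) (ts.drop k) := by
  intro j hj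
  rw [List.length_drop] at hj
  rw [T.crossingAt_drop g ts hk]
  exact h _ (by omega)

lemma Avoids.reverse {R : Set T.Vertex} {g : H} {ts : List Turn} (h : T.Avoids R g ts) :
    T.Avoids R (T.twin (T.lastCrossing g ts)) (ts.reverse.map Turn.flip) := by
  intro j hj
  rw [← length_reverse_flip] at hj
  rw [T.crossingAt_reverse g ts hj, twin_twin', isBoundary_twin]
  have := h (ts.length - j) (Nat.sub_le _ _)
  exact ⟨this.1, this.2.2, this.2.1⟩

lemma drop_reverse_flip {ts : List Turn} {k : ℕ} (hk : k ≤ ts.length) :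
    (ts.reverse.map Turn.flip).drop (ts.length - k) = (ts.take k).reverse.map Turn.flip := by
  rw [← List.map_drop, List.drop_reverse, Nat.sub_sub_self hk]

/-! ### The part of a poset before a crossing, by reversal of the curve -/

section Reverse

variable (T) (g : H) (ts : List Turn) (s f : Tag)

lemma crossPosetReverse_inl {k : ℕ} (hk : k ≤ ts.length) :
    T.crossPosetReverse g ts s f (.inl ⟨k, Nat.lt_succ_of_le hk⟩) =
      .inl ⟨ts.length - k, by rw [← length_reverse_flip]; omega⟩ := by
  refine congrArg Sum.inl (Fin.ext ?_)
  change ts.length + 1 - (k + 1) = ts.length - k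
  omega

lemma crossPosetReverse_mem_after {k : ℕ} (hk : k ≤ ts.length)
    (x : (T.crossPoset g ts s f).carrier) :
    T.crossPosetReverse g ts s f x ∈ after (ts.length - k) ↔ x ∈ before k := by
  rcases x with i | i | i
  · have hi := i.2
    change ts.length - k < ts.length + 1 - (i.val + 1) ↔ i.val < k
    omega
  · exact Iff.rfl
  · exact Iff.rfl

variable {g ts s f}

/-- Reversal takes crossing `k` to `ts.length - k` and what comes before it to what comes after it,
so `isLowerArm_after` applies to the reversed curve. -/
lemma isLowerArm_before [Finite H] {k : ℕ} (hk : k ≤ ts.length) :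
    (T.crossPoset g ts s f).IsLowerArm (.inl ⟨k, Nat.lt_succ_of_le hk⟩) (before k)
      (T.poset (T.fanSide .left (T.crossingAt g ts k) ((ts.take k).reverse.map Turn.flip) s)) := by
  have hk' : ts.length - k ≤ (ts.reverse.map Turn.flip).length := by
    rw [← length_reverse_flip]; omega
  have h := isLowerArm_after (T := T) (g := T.twin (T.lastCrossing g ts)) (s := f) (f := s) hk'
  rw [drop_reverse_flip hk, T.crossingAt_reverse g ts (Nat.sub_le _ _), Nat.sub_sub_self hk,
    twin_twin'] at h
  exact h.comap (T.isIsom_crossPosetReverse g ts s f) (T.crossPosetReverse_inl g ts s f hk)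
    (T.crossPosetReverse_mem_after g ts s f hk)

lemma isUpperArm_before [Finite H] {k : ℕ} (hk : k ≤ ts.length) :
    (T.crossPoset g ts s f).IsUpperArm (.inl ⟨k, Nat.lt_succ_of_le hk⟩) (before k)
      (T.poset (T.fanSide .right (T.crossingAt g ts k) ((ts.take k).reverse.map Turn.flip) s)) := by
  have hk' : ts.length - k ≤ (ts.reverse.map Turn.flip).length := by
    rw [← length_reverse_flip]; omega
  have h := isUpperArm_after (T := T) (g := T.twin (T.lastCrossing g ts)) (s := f) (f := s) hk'
  rw [drop_reverse_flip hk, T.crossingAt_reverse g ts (Nat.sub_le _ _), Nat.sub_sub_self hk,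
    twin_twin'] at h
  exact h.comap (T.isIsom_crossPosetReverse g ts s f) (T.crossPosetReverse_inl g ts s f hk)
    (T.crossPosetReverse_mem_after g ts s f hk)

lemma isLowArm_before [Finite H] (he : ∀ h, T.edge h ≠ T.edge (T.next h)) {k : ℕ}
    (hk : k ≤ ts.length) {R : Set T.Vertex} (hR : T.vertex (T.prev g) ∈ R ↔ s = .notched) :
    IsLowArm (T.crossPoset g ts s f) (.inl ⟨k, Nat.lt_succ_of_le hk⟩) (before k) R
      (T.twin (T.crossingAt g ts k)) ((ts.take k).reverse.map Turn.flip) := by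
  have hk' : ts.length - k ≤ (ts.reverse.map Turn.flip).length := by
    rw [← length_reverse_flip]; omega
  have h := isLowArm_after (T := T) he (g := T.twin (T.lastCrossing g ts)) (s := f) (f := s) hk'
    (R := R) (by rwa [T.lastCrossing_reverse, twin_twin'])
  rw [drop_reverse_flip hk, T.crossingAt_reverse g ts (Nat.sub_le _ _), Nat.sub_sub_self hk]
    at h
  exact h.comap (T.isIsom_crossPosetReverse g ts s f) (T.crossPosetReverse_inl g ts s f hk)
    (T.crossPosetReverse_mem_after g ts s f hk)

end Reverse

/-! ### Distinctness of labels, and the resolution at a crossing -/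

section Cross

variable {g : H} {ts : List Turn} {s f : Tag}

lemma exists_chainSize {n : ℕ} {t : Tag} (i : Fin (chainSize n t)) : t = .notched := by
  cases t
  · exact i.elim0
  · rfl

lemma val_lt_of_chainSize {n : ℕ} {t : Tag} (i : Fin (chainSize n t)) : i.val < n := by
  cases t
  · exact i.elim0
  · exact i.2

/-- As triangles have distinct vertices, an arc has only one end at a marked point, so different
ends at the puncture belong to different arcs. -/
lemma chain_label_injective (hv : ∀ h, T.vertex h ≠ T.vertex (T.next h)) {c : H}
    (hc : T.IsPuncture (T.vertex c)) {i j : ℕ} (hi : i < T.degree c) (hj : j < T.degree c)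
    (h : T.edge (T.rot^[i + 1] c) = T.edge (T.rot^[j + 1] c)) : i = j := by
  have h1 := hc.vertex_rot_iterate (i + 1)
  have h2 := hc.vertex_rot_iterate (j + 1)
  exact T.rot_iterate_inj hi hj
    (T.eq_of_edge_eq_of_vertex_eq hv (hc _ h1).1 h (h1.trans h2.symm))

lemma Tidy.crossing_ne (ht : T.Tidy ⟨.cross g ts, s, f⟩) {k : ℕ} (hk : k ≤ ts.length) {a : H}
    (ha : T.vertex a = T.vertex (T.prev g) ∨
      T.vertex a = T.vertex (T.prev (T.twin (T.lastCrossing g ts)))) :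
    T.edge (T.crossingAt g ts k) ≠ T.edge a := by
  intro h
  have h1 := ht.cross_ends _ (T.mem_crossingList.2 ⟨k, hk, rfl⟩)
  rw [h] at h1
  rcases ha with ha | ha
  · exact h1.1 ⟨a, rfl, ha⟩
  · exact h1.2 ⟨a, rfl, ha⟩

/-- No arc connects the two endpoints of a curve that crosses arcs. -/
lemma Tidy.no_connecting_arc (ht : T.Tidy ⟨.cross g ts, s, f⟩) {a b : H}
    (ha : T.vertex a = T.vertex (T.prev g)) (hab : ¬ T.IsBoundary a)
    (hb : T.vertex b = T.vertex (T.prev (T.twin (T.lastCrossing g ts)))) :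
    T.edge a ≠ T.edge b := by
  intro h
  rcases T.edge_eq_iff.1 h with rfl | rfl
  · exact ht.ends_ne (ha.symm.trans hb)
  · rw [T.vertex_twin hab] at hb
    exact ht.same_ends a hab ha hb

/-- Each condition of tidiness handles one kind of pair: two crossings by `cross_once`, a crossing
and a chain element by `cross_ends`, elements of one chain by `vertices_ne`, and elements of
different chains by `ends_ne` and `same_ends`. -/
lemma label_crossPoset_injective (hα : T.IsTaggedCurve ⟨.cross g ts, s, f⟩)
    (ht : T.Tidy ⟨.cross g ts, s, f⟩) : Function.Injective (T.crossPoset g ts s f).label := by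
  have hs : ∀ i : Fin (chainSize (T.degree (T.prev g)) s), T.IsPuncture (T.vertex (T.prev g)) :=
    fun i => hα.2.1 (exists_chainSize i)
  have hf : ∀ i : Fin (chainSize (T.degree (T.prev (T.twin (T.lastCrossing g ts)))) f),
      T.IsPuncture (T.vertex (T.prev (T.twin (T.lastCrossing g ts)))) :=
    fun i => hα.2.2 (exists_chainSize i)
  rintro (i | i | i) (j | j | j) hij
  · exact congrArg Sum.inl (Fin.ext (T.edge_crossingAt_inj ht.cross_once
      (Nat.le_of_lt_succ i.2) (Nat.le_of_lt_succ j.2) hij))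
  · exact absurd hij (ht.crossing_ne (Nat.le_of_lt_succ i.2)
      (.inl ((hs j).vertex_rot_iterate (j.val + 1))))
  · exact absurd hij (ht.crossing_ne (Nat.le_of_lt_succ i.2)
      (.inr ((hf j).vertex_rot_iterate (j.val + 1))))
  · exact absurd hij.symm (ht.crossing_ne (Nat.le_of_lt_succ j.2)
      (.inl ((hs i).vertex_rot_iterate (i.val + 1))))
  · exact congrArg (Sum.inr ∘ Sum.inl) (Fin.ext (chain_label_injective ht.vertices_ne (hs i)
      (val_lt_of_chainSize i) (val_lt_of_chainSize j) hij))
  · have h1 := (hs i).vertex_rot_iterate (i.val + 1)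
    exact absurd hij (ht.no_connecting_arc h1 ((hs i) _ h1).1
      ((hf j).vertex_rot_iterate (j.val + 1)))
  · exact absurd hij.symm (ht.crossing_ne (Nat.le_of_lt_succ j.2)
      (.inr ((hf i).vertex_rot_iterate (i.val + 1))))
  · have h1 := (hs j).vertex_rot_iterate (j.val + 1)
    exact absurd hij.symm (ht.no_connecting_arc h1 ((hs j) _ h1).1
      ((hf i).vertex_rot_iterate (i.val + 1)))
  · exact congrArg (Sum.inr ∘ Sum.inr) (Fin.ext (chain_label_injective ht.vertices_ne (hf i)
      (val_lt_of_chainSize i) (val_lt_of_chainSize j) hij))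

lemma avoids_of_tidy (hα : T.IsTaggedCurve ⟨.cross g ts, s, f⟩)
    (ht : T.Tidy ⟨.cross g ts, s, f⟩) {R : Set T.Vertex}
    (hR : ∀ v ∈ R, v = T.vertex (T.prev g) ∨
      v = T.vertex (T.prev (T.twin (T.lastCrossing g ts)))) : T.Avoids R g ts := by
  intro k hk
  exact ⟨hα.1 _ (T.mem_crossingList.2 ⟨k, hk, rfl⟩),
    fun h => ht.crossing_ne hk (hR _ h) rfl, fun h => ht.crossing_ne hk (hR _ h) (by simp)⟩

lemma eq_or_mem_after_or_mem_before {n a b k : ℕ} (hk : k < n)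
    (x : Fin n ⊕ (Fin a ⊕ Fin b)) : x = .inl ⟨k, hk⟩ ∨ x ∈ after k ∨ x ∈ before k := by
  rcases x with i | i | i
  · rcases lt_trichotomy k i.val with h | h | h
    · exact .inr (.inl h)
    · exact .inl (congrArg Sum.inl (Fin.ext h.symm))
    · exact .inr (.inr h)
  · exact .inr (.inr trivial)
  · exact .inr (.inl trivial)

lemma disjoint_after_before {n a b k : ℕ} :
    Disjoint (after k : Set (Fin n ⊕ (Fin a ⊕ Fin b))) (before k) := by
  rw [Set.disjoint_left]
  rintro (i | i | i) h h'
  · exact lt_asymm (show k < i.val from h) h'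
  · exact h
  · exact h'

/-- The exchange relation at a crossing. -/
lemma isResolution_crossing [Finite H] (hα : T.IsTaggedCurve ⟨.cross g ts, s, f⟩)
    (ht : T.Tidy ⟨.cross g ts, s, f⟩) {k : ℕ} (hk : k ≤ ts.length) {X : T.Exchange}
    (hX : X = { diagonal := T.diagonalAt g ts k
                reversed := {v | (s = .notched ∧ v = T.vertex (T.prev g)) ∨
                  (f = .notched ∧ v = T.vertex (T.prev (T.twin (T.lastCrossing g ts))))}
                arcs := fun hand =>
                  let D := T.diagonalAt g ts k
                  [T.fanSide hand (T.twin D.e) D.fwd f, T.fanSide hand D.e D.bwd s] }) :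
    IsResolution (T.crossPoset g ts s f) (T.edge (T.crossingAt g ts k)) X
      (.inl ⟨k, Nat.lt_succ_of_le hk⟩) := by
  have hne : T.vertex (T.prev g) ≠ T.vertex (T.prev (T.twin (T.lastCrossing g ts))) := ht.ends_ne
  have hR : ∀ v ∈ X.reversed, (s = .notched ∧ v = T.vertex (T.prev g)) ∨
      (f = .notched ∧ v = T.vertex (T.prev (T.twin (T.lastCrossing g ts)))) := by
    subst hX; exact fun v hv => hv
  have hav : T.Avoids X.reversed g ts :=
    avoids_of_tidy hα ht fun v hv => (hR v hv).imp And.right And.right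
  have hinj := label_crossPoset_injective hα ht
  have hp : ∀ v ∈ X.reversed, T.IsPuncture v := by
    intro v hv
    rcases hR v hv with ⟨h, rfl⟩ | ⟨h, rfl⟩
    · exact hα.2.1 h
    · exact hα.2.2 h
  -- The backward half of the diagonal is a final segment of the reversed curve.
  have hbwd := hav.reverse.drop (k := ts.length - k) (by rw [← length_reverse_flip]; omega)
  rw [drop_reverse_flip hk, T.crossingAt_reverse g ts (Nat.sub_le _ _), Nat.sub_sub_self hk] at hbwd
  have hc : (Sum.inl ⟨k, Nat.lt_succ_of_le hk⟩ : (T.crossPoset g ts s f).carrier) ∉ after k :=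
    lt_irrefl k
  have hc' : (Sum.inl ⟨k, Nat.lt_succ_of_le hk⟩ : (T.crossPoset g ts s f).carrier) ∉ before k :=
    lt_irrefl k
  have hcov : ∀ x : (T.crossPoset g ts s f).carrier,
      x = Sum.inl ⟨k, Nat.lt_succ_of_le hk⟩ ∨ x ∈ after k ∨ x ∈ before k :=
    eq_or_mem_after_or_mem_before (Nat.lt_succ_of_le hk)
  refine isResolution_of_arms (S₁ := after k) (S₂ := before k) rfl ?_ ?_
    (fun x hx => hinj hx) (fun x y _ _ h => hinj h) disjoint_after_before hc hc' hcov ?_ ?_ hp ?_ ?_ ?_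
  · subst hX
    exact (isLowerArm_after hk).iso_disjointUnion (isLowerArm_before T hk) disjoint_after_before
      hc hc' hcov
  · subst hX
    exact (isUpperArm_after hk).iso_disjointUnion (isUpperArm_before T hk) disjoint_after_before
      hc hc' hcov
  · subst hX
    exact isLowArm_after ht.edges_ne hk ⟨fun h => h.elim (fun h => absurd h.2.symm hne) And.left,
      fun h => .inr ⟨h, rfl⟩⟩
  · subst hX
    exact isLowArm_before T ht.edges_ne hk ⟨fun h => h.elim And.left (fun h => absurd h.2 hne),
      fun h => .inl ⟨h, rfl⟩⟩
  -- An arc between two reversed points would join the endpoints of `α`; by tidiness it would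
  -- coincide with `α`, which is impossible for a curve with crossings.
  · intro d hd h1 h2
    have hvd := ht.vertices_ne d
    rcases hR _ h1 with ⟨-, h3⟩ | ⟨-, h3⟩ <;> rcases hR _ h2 with ⟨-, h4⟩ | ⟨-, h4⟩
    · exact hvd (h3.trans h4.symm)
    · exact ht.same_ends d hd h3 h4
    · refine ht.same_ends (T.twin d) (by rwa [isBoundary_twin]) ?_ ?_
      · rwa [T.vertex_twin hd]
      · rwa [T.vertex_next_twin hd]
    · exact hvd (h3.trans h4.symm)
  · subst hX; exact hav.drop hk
  · subst hX; exact hbwd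

end Cross

end Triangulation

namespace Triangulation

variable {H : Type*} {T : Triangulation H}

/-! ### Exchange at a common end: the curve crosses arcs -/

lemma getElem?_replicate_append_cons {ts : List Turn} {t u : Turn} {m j : ℕ} :
    (List.replicate m t ++ u :: ts)[j]? =
      if j < m then some t else if j = m then some u else ts[j - (m + 1)]? := by
  split_ifs with h1 h2
  · rw [List.getElem?_append_left (by simpa), List.getElem?_replicate_of_lt h1]
  · subst h2; simp
  · rw [List.getElem?_append_right (by simp; omega), List.length_replicate]
    obtain ⟨i, hi⟩ : ∃ i, j - m = i + 1 := ⟨j - (m + 1), by omega⟩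
    rw [hi, List.getElem?_cons_succ]
    congr 1; omega

lemma Avoids.append {R : Set T.Vertex} {e : H} {us ts : List Turn} {t : Turn}
    (h : T.Avoids R e us) (h' : T.Avoids R (T.exit (T.twin (T.lastCrossing e us)) t) ts) :
    T.Avoids R e (us ++ t :: ts) := by
  intro k hk
  by_cases hk' : k ≤ us.length
  · rw [T.crossingAt_append_left _ _ _ hk']
    exact h k hk'
  · obtain ⟨j, rfl⟩ : ∃ j, k = us.length + (j + 1) := ⟨k - us.length - 1, by omega⟩
    rw [crossingAt_append_right, crossingAt_cons_succ]
    refine h' j ?_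
    simp at hk; omega

/-! ### Paths that circle a puncture and then move away -/

section Chain

variable {c : H} {d i : ℕ}

lemma lastCrossing_right_replicate (e : H) (n : ℕ) :
    T.lastCrossing e (List.replicate n .right) = T.unrot^[n] e := by
  rw [lastCrossing, List.length_replicate, T.crossingAt_right_run List.prefix_rfl]

lemma twin_lastCrossing_left_replicate (e : H) (n : ℕ) :
    T.twin (T.lastCrossing e (List.replicate n .left)) = T.rot^[n] (T.twin e) := by
  rw [lastCrossing, List.length_replicate, T.twin_crossingAt_left_run List.prefix_rfl]

/-- Going clockwise from the arc number `i` at a marked point, and then away from it. -/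
lemma exit_right_run (c : H) (i : ℕ) :
    T.exit (T.twin (T.lastCrossing (T.rot^[i + 1] c) (List.replicate i .right))) .left =
      T.next c := by
  rw [lastCrossing_right_replicate, T.unrot_iterate_rot_iterate_of_le (Nat.le_succ i)]
  simp [exit, rot]

/-- Going counterclockwise from the arc number `i` at a marked point, and then away from it. -/
lemma exit_left_run (c : H) {e : H} (he : T.twin e = T.rot^[i + 1] c) (hi : i < T.degree c) :
    T.exit (T.twin (T.lastCrossing e (List.replicate (T.degree c - 1 - i) .left))) .right =
      T.next c := by
  rw [twin_lastCrossing_left_replicate, he, ← Function.iterate_add_apply]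
  have : T.degree c - 1 - i + (i + 1) = T.degree c := by omega
  rw [this, rot_iterate_degree]
  rfl

lemma avoids_right_chain {R : Set T.Vertex} {i : ℕ}
    (h : ∀ j ≤ i, ¬ T.IsBoundary (T.rot^[j + 1] c) ∧ T.vertex (T.rot^[j + 1] c) ∉ R ∧
      T.vertex (T.twin (T.rot^[j + 1] c)) ∉ R) :
    T.Avoids R (T.rot^[i + 1] c) (List.replicate i .right) := by
  intro k hk
  rw [List.length_replicate] at hk
  rw [T.crossingAt_right_run (replicate_prefix_of_le hk List.prefix_rfl),
    T.unrot_iterate_rot_iterate_of_le (by omega)]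
  have := h (i - k) (Nat.sub_le _ _)
  rwa [show i - k + 1 = i + 1 - k by omega] at this

lemma avoids_left_chain {R : Set T.Vertex} {e : H} {i n : ℕ} (he : T.twin e = T.rot^[i + 1] c)
    (h : ∀ j ≤ n + i, ¬ T.IsBoundary (T.rot^[j + 1] c) ∧ T.vertex (T.rot^[j + 1] c) ∉ R ∧
      T.vertex (T.twin (T.rot^[j + 1] c)) ∉ R) :
    T.Avoids R e (List.replicate n .left) := by
  intro k hk
  rw [List.length_replicate] at hk
  have hp : List.replicate k Turn.left <+: List.replicate n .left :=
    ⟨List.replicate (n - k) .left, by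
      rw [List.replicate_append_replicate, Nat.add_sub_cancel' hk]⟩
  have h1 := T.twin_crossingAt_left_run (g := e) hp
  rw [he, ← Function.iterate_add_apply, ← add_assoc] at h1
  have h2 := h (k + i) (by omega)
  rw [← h1, isBoundary_twin, twin_twin'] at h2
  exact ⟨h2.1, h2.2.2, h2.2.1⟩

end Chain

/-! ### Arms at an element of the chain at the start of a curve -/

section CommonEnd

variable {g : H} {ts : List Turn} {f : Tag}

lemma crossRel_chain {n a b : ℕ} {i j : Fin a} (h : i.val ≤ j.val) :
    Relation.ReflTransGen (crossRel (n := n) (b := b) ts) (.inr (.inl i)) (.inr (.inl j)) := by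
  obtain ⟨m, hm⟩ := Nat.exists_eq_add_of_le h
  induction m generalizing j with
  | zero => obtain rfl : j = i := Fin.ext (by omega); exact .refl
  | succ m ih =>
    have hj := j.2
    refine .tail (ih (j := ⟨i.val + m, by omega⟩) (Nat.le_add_right _ _) rfl) ?_
    change i.val + m + 1 = j.val
    omega

/-- Deleting what is above chain element `i` leaves the lower part of the chain and everything else
of `P_α`. The blue arc crosses these lower ends in descending order (right turns), then turns left,
since the bottom of the chain lies below crossing `0`, and goes on like `α`. For `i = 0` the whole
chain disappears, together with the run of left turns at the start of `α`. -/
lemma isLowerArm_chain [Finite H] {i : ℕ} (hi : i < T.degree (T.prev g)) {e : H}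
    (he : T.twin e = T.rot^[i + 1] (T.prev g)) :
    (T.crossPoset g ts .notched f).IsLowerArm (.inr (.inl ⟨i, hi⟩)) {x | x ≠ .inr (.inl ⟨i, hi⟩)}
      (T.poset (T.fanSide .left e (List.replicate i .right ++ .left :: ts) f)) := by
  cases i with
  | zero =>
    have h := isLowerArm_after (T := T) (g := g) (s := .notched) (f := f) (Nat.zero_le ts.length)
    have hg : T.prev e = g := by
      rw [← T.twin_twin e, he]
      simp [rot]
    have hf : T.fanSide .left e (List.replicate 0 .right ++ .left :: ts) f =
        T.fanSide .left (T.twin g) ts f := by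
      rw [List.replicate_zero, List.nil_append, fanSide, hg]
    rw [crossingAt_zero, List.drop_zero, ← hf] at h
    -- The lower arm at crossing `0` is known. Replacing this crossing by the bottom of the chain
    -- only adds crossing `0` and the rest of the chain, all above that bottom.
    refine h.mono ?_ ?_ ?_
    · exact .single ⟨rfl, rfl⟩
    · rintro x hx rfl
      exact hx
    · rintro (j | j | j) hj hj'
      · refine .single ⟨rfl, ?_⟩
        change ¬ 0 < j.val at hj'
        omega
      · exact crossRel_chain (Nat.zero_le _)
      · exact absurd trivial hj'
  | succ i =>
    have hne : T.next e = T.rot^[i + 1] (T.prev g) := by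
      rw [← T.unrot_iterate_rot_iterate 1 (T.rot^[i + 1] (T.prev g)),
        ← Function.iterate_add_apply, show 1 + (i + 1) = i + 1 + 1 by omega, ← he]
      simp [unrot]
    have hf : T.fanSide .left e (List.replicate (i + 1) .right ++ .left :: ts) f =
        ⟨.cross (T.rot^[i + 1] (T.prev g)) (List.replicate i .right ++ .left :: ts), .plain, f⟩ := by
      rw [List.replicate_succ, List.cons_append, fanSide, hne]
    rw [hf]
    set us := List.replicate i Turn.right ++ .left :: ts with hus
    have hget : ∀ j, us[j]? = if j < i then some .right else if j = i then some .left
        else ts[j - (i + 1)]? := fun j => getElem?_replicate_append_cons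
    have hlen : us.length = i + 1 + ts.length := by simp [hus]; omega
    have hlast : T.lastCrossing (T.rot^[i + 1] (T.prev g)) us = T.lastCrossing g ts := by
      rw [hus, lastCrossing_append_cons, exit_right_run, next_prev]
    have hcr : ∀ j, T.crossingAt (T.rot^[i + 1] (T.prev g)) us (i + 1 + j) =
        T.crossingAt g ts j := by
      intro j
      have := T.crossingAt_append_right (T.rot^[i + 1] (T.prev g)) (List.replicate i .right)
        (.left :: ts) (j + 1)
      rw [List.length_replicate, crossingAt_cons_succ, exit_right_run, next_prev] at this
      rw [← this, hus]; congr 1; omega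
    have hcr' : ∀ j ≤ i, T.crossingAt (T.rot^[i + 1] (T.prev g)) us j =
        T.rot^[i - j + 1] (T.prev g) := by
      intro j hj
      rw [T.crossingAt_right_run ((replicate_prefix_of_le hj List.prefix_rfl).trans
        (List.prefix_append _ _)), T.unrot_iterate_rot_iterate_of_le (by omega)]
      congr 1; omega
    have hb : chainSize (T.degree (T.prev (T.twin
        (T.lastCrossing (T.rot^[i + 1] (T.prev g)) us)))) f =
        chainSize (T.degree (T.prev (T.twin (T.lastCrossing g ts)))) f := by rw [hlast]
    have hd : i + 1 < T.degree (T.prev g) := hi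
    -- The first `i + 1` crossings of the side are the chain elements `i, …, 0`; the later ones are
    -- the crossings of `α`.
    refine LabeledOrder.isLowerArm_generate (fun
      | .inl j => if h : j.val < i + 1 then .inr (.inl ⟨i - j.val, by
            change i - j.val < T.degree (T.prev g); omega⟩)
          else .inl ⟨j.val - (i + 1), by have := j.2; omega⟩
      | .inr (.inl j) => j.elim0
      | .inr (.inr j) => .inr (.inr ⟨j.val, j.2.trans_eq hb⟩)) ?_ ?_ ?_ ?_ ?_ ?_ ?_
    · rintro (j | j | j) (l | l | l) hjl
      all_goals try first | exact j.elim0 | exact l.elim0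
      · dsimp only at hjl
        split_ifs at hjl <;>
          simp only [Sum.inl.injEq, Sum.inr.injEq, Fin.mk.injEq] at hjl <;>
          exact congrArg Sum.inl (Fin.ext (by omega))
      · dsimp only at hjl; split_ifs at hjl; all_goals simp at hjl
      · dsimp only at hjl; split_ifs at hjl; all_goals simp at hjl
      · simp only [Sum.inr.injEq, Fin.mk.injEq] at hjl
        rw [Fin.ext hjl]
    · rintro (j | j | j)
      · dsimp only
        split_ifs
        · intro h
          have h1 : i - j.val = i + 1 := Fin.val_eq_of_eq (Sum.inl.inj (Sum.inr.inj h))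
          omega
        · intro h; cases h
      · exact j.elim0
      · intro h; cases h
    · rintro (j | j | j) hj
      · refine .inl ⟨.inl ⟨i + 1 + j.val, by have := j.2; omega⟩, ?_⟩
        simp; omega
      · by_cases h : j.val < i + 1
        · refine .inl ⟨.inl ⟨i - j.val, by omega⟩, ?_⟩
          dsimp only
          rw [dif_pos (by omega)]
          exact congrArg (Sum.inr ∘ Sum.inl) (Fin.ext (by change i - (i - j.val) = j.val; omega))
        · exact .inr (crossRel_chain (by change i + 1 ≤ j.val; omega))
      · exact .inl ⟨.inr (.inr ⟨j.val, j.2.trans_eq hb.symm⟩), rfl⟩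
    · rintro (j | j | j) (l | l | l) hjl
      all_goals try exact l.elim0
      · refine ⟨.inl ⟨i + 1 + j.val, by have := j.2; omega⟩, ?_⟩
        simp; omega
      · refine ⟨.inl ⟨i + 1 + j.val, by have := j.2; omega⟩, ?_⟩
        simp; omega
      · dsimp only at hjl
        split_ifs at hjl with h
        · have h1 : j.val + 1 = i - l.val := hjl
          refine ⟨.inl ⟨i - j.val, by omega⟩, ?_⟩
          dsimp only
          rw [dif_pos (by omega)]
          exact congrArg (Sum.inr ∘ Sum.inl) (Fin.ext (by change i - (i - j.val) = j.val; omega))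
        · have h1 : j.val = 0 := hjl.1
          refine ⟨.inl ⟨i, by omega⟩, ?_⟩
          dsimp only
          rw [dif_pos (by omega)]
          exact congrArg (Sum.inr ∘ Sum.inl) (Fin.ext (by change i - i = j.val; omega))
      · exact hjl.elim
      · exact ⟨.inr (.inr ⟨j.val, j.2.trans_eq hb.symm⟩), rfl⟩
      · exact ⟨.inr (.inr ⟨j.val, j.2.trans_eq hb.symm⟩), rfl⟩
    · rintro (j | j | j) (l | l | l) hjl
      all_goals try first | exact j.elim0 | exact l.elim0
      · refine .single ?_
        dsimp only
        rcases hjl with ⟨h1, h2⟩ | ⟨h1, h2⟩ <;> rw [hget] at h2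
        · by_cases h3 : j.val < i
          · simp [h3] at h2
          · by_cases h4 : j.val = i
            · rw [dif_pos (by omega), dif_neg (by omega)]
              exact ⟨by change i - j.val = 0; omega, by change l.val - (i + 1) = 0; omega⟩
            · rw [if_neg h3, if_neg h4] at h2
              rw [dif_neg (by omega), dif_neg (by omega)]
              exact .inl ⟨by change j.val - (i + 1) + 1 = l.val - (i + 1); omega, h2⟩
        · by_cases h3 : l.val < i
          · rw [dif_pos (by omega), dif_pos (by omega)]
            change i - j.val + 1 = i - l.val
            omega
          · by_cases h4 : l.val = i
            · simp [h4] at h2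
            · rw [if_neg h3, if_neg h4] at h2
              rw [dif_neg (by omega), dif_neg (by omega)]
              exact .inr ⟨by change l.val - (i + 1) + 1 = j.val - (i + 1); omega, h2⟩
      · refine .single ?_
        have h1 : j.val + 1 = us.length + 1 := hjl.1
        dsimp only
        rw [dif_neg (by omega)]
        exact ⟨by change j.val - (i + 1) + 1 = ts.length + 1; omega, hjl.2.trans hb⟩
      · refine .single ?_
        have h1 : l.val + 1 = us.length + 1 := hjl.2
        dsimp only
        rw [dif_neg (by omega)]
        exact ⟨hjl.1, by change l.val - (i + 1) + 1 = ts.length + 1; omega⟩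
      · exact .single hjl
    · rintro (j | j | j) (l | l | l) hjl
      all_goals try first | exact j.elim0 | exact l.elim0
      · refine .single ?_
        have hjj := j.2
        have hll := l.2
        dsimp only at hjl
        by_cases hj : j.val < i + 1 <;> by_cases hl : l.val < i + 1
        · rw [dif_pos hj, dif_pos hl] at hjl
          have h1 : i - j.val + 1 = i - l.val := hjl
          refine .inr ⟨by omega, ?_⟩
          rw [hget, if_pos (by omega)]
        · rw [dif_pos hj, dif_neg hl] at hjl
          have h1 : i - j.val = 0 := hjl.1
          have h2 : l.val - (i + 1) = 0 := hjl.2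
          refine .inl ⟨by omega, ?_⟩
          rw [hget, if_neg (by omega), if_pos (by omega)]
        -- A crossing is directly below the top of the chain only, and the top has been deleted.
        · rw [dif_neg hj, dif_pos hl] at hjl
          have h1 : i - l.val + 1 = T.degree (T.prev g) := hjl.2
          omega
        · rw [dif_neg hj, dif_neg hl] at hjl
          rcases hjl with ⟨h1, h2⟩ | ⟨h1, h2⟩
          · change j.val - (i + 1) + 1 = l.val - (i + 1) at h1
            refine .inl ⟨by omega, ?_⟩
            rw [hget, if_neg (by omega), if_neg (by omega)]
            exact h2
          · change l.val - (i + 1) + 1 = j.val - (i + 1) at h1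
            refine .inr ⟨by omega, ?_⟩
            rw [hget, if_neg (by omega), if_neg (by omega)]
            exact h2
      · refine .single ?_
        dsimp only at hjl
        split_ifs at hjl with hj
        · exact hjl.elim
        · have h1 : j.val - (i + 1) + 1 = ts.length + 1 := hjl.1
          exact ⟨by omega, hjl.2.trans hb.symm⟩
      · refine .single ?_
        dsimp only at hjl
        split_ifs at hjl with hj
        · exact hjl.elim
        · have h1 : l.val - (i + 1) + 1 = ts.length + 1 := hjl.2
          exact ⟨hjl.1, by omega⟩
      · exact .single hjl
    · rintro (j | j | j)
      · dsimp only
        by_cases hj : j.val < i + 1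
        · rw [dif_pos hj, hcr' _ (by omega)]
        · rw [dif_neg hj]
          have h1 := hcr (j.val - (i + 1))
          rw [show i + 1 + (j.val - (i + 1)) = j.val by omega] at h1
          rw [h1]
      · exact j.elim0
      · simp only [hlast]

/-- Dually, `l` elements of the chain lie above number `i`. The red arc crosses them in ascending
order (left turns) and then turns right, because crossing `0` lies below the top. For `l = 0` the
deleted element is the top itself, and crossing `0` goes with it. -/
lemma isUpperArm_chain [Finite H] {i l : ℕ} (hl : i + l + 1 = T.degree (T.prev g)) {e : H}
    (he : T.twin e = T.rot^[i + 1] (T.prev g)) :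
    (T.crossPoset g ts .notched f).IsUpperArm (.inr (.inl ⟨i, show i < T.degree (T.prev g) by omega⟩))
      {x | x ≠ .inr (.inl ⟨i, show i < T.degree (T.prev g) by omega⟩)}
      (T.poset (T.fanSide .right (T.twin e) (List.replicate l .left ++ .right :: ts) f)) := by
  cases l with
  | zero =>
    have h := isUpperArm_after (T := T) (g := g) (s := .notched) (f := f) (Nat.zero_le ts.length)
    have hg : T.next (T.twin e) = g := by
      rw [he, show i + 1 = T.degree (T.prev g) from hl, rot_iterate_degree, next_prev]
    have hf : T.fanSide .right (T.twin e) (List.replicate 0 .left ++ .right :: ts) f =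
        T.fanSide .right (T.twin g) ts f := by
      rw [List.replicate_zero, List.nil_append, fanSide, hg]
    rw [crossingAt_zero, List.drop_zero, ← hf] at h
    refine h.mono ?_ ?_ ?_
    · exact .single ⟨rfl, hl⟩
    · rintro x hx rfl
      exact hx
    · rintro (j | j | j) hj hj'
      · refine .single ⟨?_, hl⟩
        change ¬ 0 < j.val at hj'
        omega
      · have hjd : j.val < T.degree (T.prev g) := j.2
        exact crossRel_chain (by change j.val ≤ i; omega)
      · exact absurd trivial hj'
  | succ l =>
    set y := T.prev (T.twin e) with hy
    have hy' : T.twin y = T.rot^[i + 1 + 1] (T.prev g) := by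
      rw [Function.iterate_succ_apply', ← he]; rfl
    have hd : i + 1 < T.degree (T.prev g) := by omega
    have hexit := exit_left_run (T.prev g) hy' hd
    rw [show T.degree (T.prev g) - 1 - (i + 1) = l by omega, next_prev] at hexit
    have hf : T.fanSide .right (T.twin e) (List.replicate (l + 1) .left ++ .right :: ts) f =
        ⟨.cross y (List.replicate l .left ++ .right :: ts), .plain, f⟩ := by
      rw [List.replicate_succ, List.cons_append, fanSide]
    rw [hf]
    set us := List.replicate l Turn.left ++ .right :: ts with hus
    have hget : ∀ j, us[j]? = if j < l then some .left else if j = l then some .right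
        else ts[j - (l + 1)]? := fun j => getElem?_replicate_append_cons
    have hlen : us.length = l + 1 + ts.length := by simp [hus]; omega
    have hlast : T.lastCrossing y us = T.lastCrossing g ts := by
      rw [hus, lastCrossing_append_cons, hexit]
    have hcr : ∀ j, T.crossingAt y us (l + 1 + j) = T.crossingAt g ts j := by
      intro j
      have := T.crossingAt_append_right y (List.replicate l .left) (.right :: ts) (j + 1)
      rw [List.length_replicate, crossingAt_cons_succ, hexit] at this
      rw [← this, hus]; congr 1; omega
    have hcr' : ∀ j ≤ l, T.edge (T.crossingAt y us j) =
        T.edge (T.rot^[i + 1 + j + 1] (T.prev g)) := by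
      intro j hj
      have hp : List.replicate j Turn.left <+: us :=
        ⟨List.replicate (l - j) .left ++ .right :: ts, by
          rw [← List.append_assoc, List.replicate_append_replicate, Nat.add_sub_cancel' hj]⟩
      rw [← T.edge_twin, T.twin_crossingAt_left_run hp, hy', ← Function.iterate_add_apply]
      congr 2; omega
    have hb : chainSize (T.degree (T.prev (T.twin (T.lastCrossing y us)))) f =
        chainSize (T.degree (T.prev (T.twin (T.lastCrossing g ts)))) f := by rw [hlast]
    refine LabeledOrder.isUpperArm_generate (fun
      | .inl j => if h : j.val < l + 1 then .inr (.inl ⟨i + 1 + j.val, by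
            change i + 1 + j.val < T.degree (T.prev g); omega⟩)
          else .inl ⟨j.val - (l + 1), by have := j.2; omega⟩
      | .inr (.inl j) => j.elim0
      | .inr (.inr j) => .inr (.inr ⟨j.val, j.2.trans_eq hb⟩)) ?_ ?_ ?_ ?_ ?_ ?_ ?_
    · rintro (j | j | j) (k | k | k) hjk
      all_goals try first | exact j.elim0 | exact k.elim0
      · dsimp only at hjk
        split_ifs at hjk
        all_goals simp only [Sum.inl.injEq, Sum.inr.injEq, Fin.mk.injEq] at hjk
        all_goals exact congrArg Sum.inl (Fin.ext (by omega))
      · dsimp only at hjk; split_ifs at hjk; all_goals simp at hjk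
      · dsimp only at hjk; split_ifs at hjk; all_goals simp at hjk
      · simp only [Sum.inr.injEq, Fin.mk.injEq] at hjk
        rw [Fin.ext hjk]
    · rintro (j | j | j)
      · dsimp only
        split_ifs
        · intro h
          have h1 : i + 1 + j.val = i := Fin.val_eq_of_eq (Sum.inl.inj (Sum.inr.inj h))
          omega
        · intro h; cases h
      · exact j.elim0
      · intro h; cases h
    · rintro (j | j | j) hj
      · refine .inl ⟨.inl ⟨l + 1 + j.val, by have := j.2; omega⟩, ?_⟩
        simp; omega
      · have hjd : j.val < T.degree (T.prev g) := j.2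
        by_cases h : i < j.val
        · refine .inl ⟨.inl ⟨j.val - (i + 1), by omega⟩, ?_⟩
          dsimp only
          rw [dif_pos (by omega)]
          exact congrArg (Sum.inr ∘ Sum.inl)
            (Fin.ext (by change i + 1 + (j.val - (i + 1)) = j.val; omega))
        · exact .inr (crossRel_chain (by change j.val ≤ i; omega))
      · exact .inl ⟨.inr (.inr ⟨j.val, j.2.trans_eq hb.symm⟩), rfl⟩
    · rintro (j | j | j) (k | k | k) hjk
      all_goals try exact k.elim0
      · refine ⟨.inl ⟨l + 1 + j.val, by have := j.2; omega⟩, ?_⟩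
        simp; omega
      · refine ⟨.inl ⟨l + 1 + j.val, by have := j.2; omega⟩, ?_⟩
        simp; omega
      · have hjd : j.val < T.degree (T.prev g) := j.2
        have hij : i < j.val := by
          dsimp only at hjk
          split_ifs at hjk with h
          · have h1 : i + 1 + k.val + 1 = j.val := hjk
            omega
          · have h1 : j.val + 1 = T.degree (T.prev g) := hjk.2
            omega
        refine ⟨.inl ⟨j.val - (i + 1), by omega⟩, ?_⟩
        dsimp only
        rw [dif_pos (by omega)]
        exact congrArg (Sum.inr ∘ Sum.inl)
          (Fin.ext (by change i + 1 + (j.val - (i + 1)) = j.val; omega))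
      · exact hjk.elim
      · exact ⟨.inr (.inr ⟨j.val, j.2.trans_eq hb.symm⟩), rfl⟩
      · exact ⟨.inr (.inr ⟨j.val, j.2.trans_eq hb.symm⟩), rfl⟩
    · rintro (j | j | j) (k | k | k) hjk
      all_goals try first | exact j.elim0 | exact k.elim0
      · refine .single ?_
        dsimp only
        rcases hjk with ⟨h1, h2⟩ | ⟨h1, h2⟩ <;> rw [hget] at h2
        · by_cases h3 : j.val < l
          · rw [dif_pos (by omega), dif_pos (by omega)]
            change i + 1 + j.val + 1 = i + 1 + k.val
            omega
          · by_cases h4 : j.val = l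
            · simp [h4] at h2
            · rw [if_neg h3, if_neg h4] at h2
              rw [dif_neg (by omega), dif_neg (by omega)]
              exact .inl ⟨by change j.val - (l + 1) + 1 = k.val - (l + 1); omega, h2⟩
        · by_cases h3 : k.val < l
          · simp [h3] at h2
          · by_cases h4 : k.val = l
            · rw [dif_neg (by omega), dif_pos (by omega)]
              exact ⟨by change j.val - (l + 1) = 0; omega,
                by change i + 1 + k.val + 1 = T.degree (T.prev g); omega⟩
            · rw [if_neg h3, if_neg h4] at h2
              rw [dif_neg (by omega), dif_neg (by omega)]
              exact .inr ⟨by change k.val - (l + 1) + 1 = j.val - (l + 1); omega, h2⟩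
      · refine .single ?_
        have h1 : j.val + 1 = us.length + 1 := hjk.1
        dsimp only
        rw [dif_neg (by omega)]
        exact ⟨by change j.val - (l + 1) + 1 = ts.length + 1; omega, hjk.2.trans hb⟩
      · refine .single ?_
        have h1 : k.val + 1 = us.length + 1 := hjk.2
        dsimp only
        rw [dif_neg (by omega)]
        exact ⟨hjk.1, by change k.val - (l + 1) + 1 = ts.length + 1; omega⟩
      · exact .single hjk
    · rintro (j | j | j) (k | k | k) hjk
      all_goals try first | exact j.elim0 | exact k.elim0
      · refine .single ?_
        have hjj := j.2
        have hkk := k.2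
        dsimp only at hjk
        by_cases hj : j.val < l + 1 <;> by_cases hk : k.val < l + 1
        · rw [dif_pos hj, dif_pos hk] at hjk
          have h1 : i + 1 + j.val + 1 = i + 1 + k.val := hjk
          refine .inl ⟨by omega, ?_⟩
          rw [hget, if_pos (by omega)]
        · rw [dif_pos hj, dif_neg hk] at hjk
          have h1 : i + 1 + j.val = 0 := hjk.1
          omega
        · rw [dif_neg hj, dif_pos hk] at hjk
          have h1 : j.val - (l + 1) = 0 := hjk.1
          have h2 : i + 1 + k.val + 1 = T.degree (T.prev g) := hjk.2
          refine .inr ⟨by omega, ?_⟩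
          rw [hget, if_neg (by omega), if_pos (by omega)]
        · rw [dif_neg hj, dif_neg hk] at hjk
          rcases hjk with ⟨h1, h2⟩ | ⟨h1, h2⟩
          · change j.val - (l + 1) + 1 = k.val - (l + 1) at h1
            refine .inl ⟨by omega, ?_⟩
            rw [hget, if_neg (by omega), if_neg (by omega)]
            exact h2
          · change k.val - (l + 1) + 1 = j.val - (l + 1) at h1
            refine .inr ⟨by omega, ?_⟩
            rw [hget, if_neg (by omega), if_neg (by omega)]
            exact h2
      · refine .single ?_
        dsimp only at hjk
        split_ifs at hjk with hj
        · exact hjk.elim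
        · have h1 : j.val - (l + 1) + 1 = ts.length + 1 := hjk.1
          exact ⟨by omega, hjk.2.trans hb.symm⟩
      · refine .single ?_
        dsimp only at hjk
        split_ifs at hjk with hj
        · exact hjk.elim
        · have h1 : k.val - (l + 1) + 1 = ts.length + 1 := hjk.2
          exact ⟨hjk.1, by omega⟩
      · exact .single hjk
    · rintro (j | j | j)
      · dsimp only
        by_cases hj : j.val < l + 1
        · rw [dif_pos hj, hcr' _ (by omega)]
        · rw [dif_neg hj]
          have h1 := hcr (j.val - (l + 1))
          rw [show l + 1 + (j.val - (l + 1)) = j.val by omega] at h1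
          rw [h1]
      · exact j.elim0
      · simp only [hlast]

/-- The ends of arcs before the end number `i` in the chain at the start of a curve. -/
def chainBefore {n a b : ℕ} (i : ℕ) : Set (Fin n ⊕ (Fin a ⊕ Fin b)) :=
  {x | match x with
    | .inr (.inl j) => j.val < i
    | _ => False}

/-- Everything except the first `i + 1` elements of the chain at the start of a curve. -/
def chainRest {n a b : ℕ} (i : ℕ) : Set (Fin n ⊕ (Fin a ⊕ Fin b)) :=
  {x | match x with
    | .inr (.inl j) => i < j.val
    | _ => True}

/-- The path makes `i` right turns down the chain and then a left turn, so its low positions are the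
numbers up to `i`, whatever `R` is. -/
lemma isLowArm_chainBefore {R : Set T.Vertex} {i : ℕ} (hi : i < T.degree (T.prev g)) :
    IsLowArm (T.crossPoset g ts .notched f) (.inr (.inl ⟨i, hi⟩)) (chainBefore i) R
      (T.rot^[i + 1] (T.prev g)) (List.replicate i .right ++ .left :: ts) := by
  refine isLowArm_of_forall (fun m => .inr (.inl ⟨i - m, lt_of_le_of_lt (Nat.sub_le _ _) hi⟩)) rfl
    ?_ ?_ ?_ ?_ ?_
  · intro m hm
    rw [isLow_right_append_left] at hm
    change T.edge (T.rot^[i - m + 1] _) = _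
    rw [T.unrot_iterate_rot_iterate_of_le (by omega), show i - m + 1 = i + 1 - m by omega]
  · intro m hm
    rw [isLow_right_append_left] at hm
    change i - (m + 1) < i
    omega
  · intro m n hm hn hmn
    rw [isLow_right_append_left] at hm hn
    have h1 : i - m = i - n := Fin.val_eq_of_eq (Sum.inl.inj (Sum.inr.inj hmn))
    omega
  · intro m _
    exact crossRel_chain (by change i - (m + 1) ≤ i - m; omega)
  · rintro (j | j | j) hj -
    · exact hj.elim
    · change j.val < i at hj
      exact ⟨i - j.val, isLow_right_append_left.2 (Nat.sub_le _ _),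
        congrArg (Sum.inr ∘ Sum.inl) (Fin.ext (by change i - (i - j.val) = j.val; omega))⟩
    · exact hj.elim

/-- Outside the lower part of the chain, something lies below `c` only if `c` is the top (`l = 0`).
Then it is crossing `0` and what is below it along `α`. Otherwise the path turns left at once and
has no further low position. -/
lemma isLowArm_chainRest [Finite H] (hed : ∀ h, T.edge h ≠ T.edge (T.next h)) {R : Set T.Vertex}
    (hR : T.vertex (T.prev (T.twin (T.lastCrossing g ts))) ∈ R ↔ f = .notched) {i l : ℕ}
    (hl : i + l + 1 = T.degree (T.prev g)) {e : H} (he : T.twin e = T.rot^[i + 1] (T.prev g)) :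
    IsLowArm (T.crossPoset g ts .notched f)
      (.inr (.inl ⟨i, show i < T.degree (T.prev g) by omega⟩)) (chainRest i) R
      e (List.replicate l .left ++ .right :: ts) := by
  cases l with
  | zero =>
    have hg : T.unrot e = g := by
      rw [unrot, he, show i + 1 = T.degree (T.prev g) from hl, rot_iterate_degree, next_prev]
    have h := isLowArm_after hed (g := g) (s := .notched) (f := f) (Nat.zero_le ts.length) hR
    rw [crossingAt_zero, List.drop_zero] at h
    refine IsLowArm.cons (c' := (Sum.inl ⟨0, Nat.succ_pos _⟩ :
      (T.crossPoset g ts .notched f).carrier)) (S := after 0) (by rw [hg]; exact h) ?_ ?_ ?_ ?_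
      ?_ ?_
    · change T.edge (T.rot^[i + 1] (T.prev g)) = T.edge e
      rw [← he, edge_twin]
    · exact .single ⟨rfl, hl⟩
    · exact lt_irrefl i
    · rintro (j | j | j) hj
      · trivial
      · exact hj.elim
      · trivial
    · trivial
    -- Every way from here up to the top of the chain passes through crossing `0`.
    · have key : ∀ x, (T.crossPoset g ts .notched f).le x
          (.inr (.inl ⟨i, show i < T.degree (T.prev g) by omega⟩)) → x ∈ chainRest i →
          (T.crossPoset g ts .notched f).le x (.inl ⟨0, Nat.succ_pos _⟩) := by
        intro x hx
        induction hx using Relation.ReflTransGen.head_induction_on with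
        | refl => exact fun h => absurd h (lt_irrefl i)
        | @head x z hxz _ ih =>
          intro hxS
          rcases x with j | j | j <;> rcases z with k | k | k
          · exact .head hxz (ih trivial)
          · have h0 : j.val = 0 := hxz.1
            obtain rfl : j = ⟨0, Nat.succ_pos _⟩ := Fin.ext h0
            exact .refl
          · exact .head hxz (ih trivial)
          · exact .head hxz (ih trivial)
          · have hj : j.val < T.degree (T.prev g) := j.2
            have hj' : i < j.val := hxS
            omega
          · exact hxz.elim
          · exact .head hxz (ih trivial)
          · exact hxz.elim
          · exact .head hxz (ih trivial)
      rintro (j | j | j) hj hjc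
      · by_cases h0 : j.val = 0
        · exact .inl (congrArg Sum.inl (Fin.ext h0))
        · exact .inr ⟨Nat.pos_of_ne_zero h0, key _ hjc hj⟩
      · have hjd : j.val < T.degree (T.prev g) := j.2
        have hj' : i < j.val := hj
        omega
      · exact .inr ⟨trivial, key _ hjc hj⟩
  | succ l =>
    refine isLowArm_of_eq_zero (fun m hm => ?_) ?_ ?_
    · rw [List.replicate_succ, List.cons_append, isLow_left_cons] at hm
      exact hm
    · change T.edge (T.rot^[i + 1] (T.prev g)) = T.edge e
      rw [← he, edge_twin]
    · intro x hx hxc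
      -- As `c` is not the top, the set `chainRest i` is closed upward; since it does not contain
      -- `c`, nothing in it is below `c`.
      have key : ∀ x, (T.crossPoset g ts .notched f).le x
          (.inr (.inl ⟨i, show i < T.degree (T.prev g) by omega⟩)) → x ∉ chainRest i := by
        intro x hx
        induction hx using Relation.ReflTransGen.head_induction_on with
        | refl => exact lt_irrefl i
        | @head x z hxz _ ih =>
          intro hxS
          refine ih ?_
          rcases x with j | j | j <;> rcases z with k | k | k
          · trivial
          · have h1 : k.val + 1 = T.degree (T.prev g) := hxz.2
            change i < k.val
            omega
          · trivial
          · trivial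
          · have h1 : j.val + 1 = k.val := hxz
            change i < k.val
            have hj' : i < j.val := hxS
            omega
          · trivial
          · trivial
          · exact hxz.elim
          · trivial
      exact key x hxc hx

lemma eq_or_mem_chain {n a b i : ℕ} (hi : i < a) (x : Fin n ⊕ (Fin a ⊕ Fin b)) :
    x = .inr (.inl ⟨i, hi⟩) ∨ x ∈ chainRest i ∨ x ∈ chainBefore i := by
  rcases x with j | j | j
  · exact .inr (.inl trivial)
  · rcases lt_trichotomy i j.val with h | h | h
    · exact .inr (.inl h)
    · exact .inl (congrArg (Sum.inr ∘ Sum.inl) (Fin.ext h.symm))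
    · exact .inr (.inr h)
  · exact .inr (.inl trivial)

lemma disjoint_chainRest_chainBefore {n a b i : ℕ} :
    Disjoint (chainRest i : Set (Fin n ⊕ (Fin a ⊕ Fin b))) (chainBefore i) := by
  rw [Set.disjoint_left]
  rintro (j | j | j) h h'
  · exact h'
  · exact lt_asymm (show i < j.val from h) h'
  · exact h'

/-- The exchange relation at a common end, for a curve that crosses arcs; the common end is the
start of the curve. -/
lemma isResolution_common_start [Finite H] (hα : T.IsTaggedCurve ⟨.cross g ts, .notched, f⟩)
    (ht : T.Tidy ⟨.cross g ts, .notched, f⟩) {i l : ℕ} (hl : i + l + 1 = T.degree (T.prev g))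
    {e : H} (he : T.twin e = T.rot^[i + 1] (T.prev g)) {X : T.Exchange}
    (hX : X = { diagonal := ⟨e, List.replicate l .left ++ .right :: ts,
                  List.replicate i .right ++ .left :: ts⟩
                reversed := {v | f = .notched ∧
                  v = T.vertex (T.prev (T.twin (T.lastCrossing g ts)))}
                arcs := fun
                  | .left => [T.fanSide .left e (List.replicate i .right ++ .left :: ts) f]
                  | .right =>
                    [T.fanSide .right (T.twin e) (List.replicate l .left ++ .right :: ts) f] }) :
    IsResolution (T.crossPoset g ts .notched f) (T.edge e) X
      (.inr (.inl ⟨i, show i < T.degree (T.prev g) by omega⟩)) := by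
  have hi : i < T.degree (T.prev g) := by omega
  have hne : T.vertex (T.prev g) ≠ T.vertex (T.prev (T.twin (T.lastCrossing g ts))) := ht.ends_ne
  have hR : ∀ v ∈ X.reversed,
      f = .notched ∧ v = T.vertex (T.prev (T.twin (T.lastCrossing g ts))) := by
    subst hX; exact fun v hv => hv
  have hav : T.Avoids X.reversed g ts := avoids_of_tidy hα ht fun v hv => .inr (hR v hv).2
  have hinj := label_crossPoset_injective hα ht
  have hp : T.IsPuncture (T.vertex (T.prev g)) := hα.2.1 rfl
  -- The arcs at the shared puncture do not end at the other endpoint of `α`: no arc joins the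
  -- endpoints of a tidy curve with crossings.
  have hchain : ∀ j, ¬ T.IsBoundary (T.rot^[j + 1] (T.prev g)) ∧
      T.vertex (T.rot^[j + 1] (T.prev g)) ∉ X.reversed ∧
      T.vertex (T.twin (T.rot^[j + 1] (T.prev g))) ∉ X.reversed := by
    intro j
    have h1 := hp.vertex_rot_iterate (j + 1)
    have h2 := (hp _ h1).1
    exact ⟨h2, fun h => hne (h1.symm.trans (hR _ h).2),
      fun h => ht.no_connecting_arc h1 h2 (hR _ h).2 (T.edge_twin _).symm⟩
  have hc : T.edge (T.rot^[i + 1] (T.prev g)) = T.edge e := by rw [← he, edge_twin]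
  refine isResolution_of_arms (S₁ := chainRest i) (S₂ := chainBefore i) hc ?_ ?_
    (fun x hx => hinj hx) (fun x y _ _ h => hinj h) disjoint_chainRest_chainBefore (lt_irrefl i)
    (lt_irrefl i) (eq_or_mem_chain hi) ?_ ?_ ?_ ?_ ?_ ?_
  · subst hX
    exact (isLowerArm_chain hi he).iso_disjointUnion_empty
  · subst hX
    exact (isUpperArm_chain hl he).iso_disjointUnion_empty
  · subst hX
    exact isLowArm_chainRest ht.edges_ne (R := {v | f = .notched ∧
      v = T.vertex (T.prev (T.twin (T.lastCrossing g ts)))}) ⟨fun h => h.1, fun h => ⟨h, rfl⟩⟩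
      hl he
  · subst hX
    change IsLowArm _ _ _ _ (T.twin e) _
    rw [he]
    exact isLowArm_chainBefore hi
  · intro v hv
    obtain ⟨h, rfl⟩ := hR v hv
    exact hα.2.2 h
  · intro d _ h1 h2
    exact ht.vertices_ne d ((hR _ h1).2.trans (hR _ h2).2.symm)
  · have h1 := avoids_left_chain (n := l) he fun j _ => hchain j
    have h2 := exit_left_run (T.prev g) he hi
    rw [show T.degree (T.prev g) - 1 - i = l by omega, next_prev] at h2
    have h3 := h1.append (t := .right) (ts := ts) (by rwa [h2])
    subst hX
    exact h3
  · have h1 := avoids_right_chain (i := i) fun j _ => hchain j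
    have h2 := exit_right_run (T := T) (T.prev g) i
    rw [next_prev] at h2
    have h3 := h1.append (t := .left) (ts := ts) (by rwa [h2])
    subst hX
    change T.Avoids _ (T.twin e) _
    rw [he]
    exact h3

end CommonEnd

end Triangulation

namespace Triangulation

/-! ### Exchange at a common end: the curve coincides with an arc -/

section SideRel

variable {A : Type*} {d a b n m i : ℕ}

lemma crossRel_chain' {ts : List Turn} {j k : Fin b} (h : j.val ≤ k.val) :
    Relation.ReflTransGen (crossRel (n := n) (a := a) ts) (.inr (.inr j)) (.inr (.inr k)) := by
  obtain ⟨m, hm⟩ := Nat.exists_eq_add_of_le h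
  induction m generalizing k with
  | zero => obtain rfl : k = j := Fin.ext (by omega); exact .refl
  | succ m ih =>
    have hk := k.2
    refine .tail (ih (k := ⟨j.val + m, by omega⟩) (Nat.le_add_right _ _) rfl) ?_
    change j.val + m + 1 = k.val
    omega

lemma sideRel_chain {j k : Fin b} (h : j.val ≤ k.val) :
    Relation.ReflTransGen (sideRel (d := d) (a := a)) (.inr (.inr j)) (.inr (.inr k)) := by
  obtain ⟨m, hm⟩ := Nat.exists_eq_add_of_le h
  induction m generalizing k with
  | zero => obtain rfl : k = j := Fin.ext (by omega); exact .refl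
  | succ m ih =>
    have hk := k.2
    refine .tail (ih (k := ⟨j.val + m, by omega⟩) (Nat.le_add_right _ _) rfl) ?_
    change j.val + m + 1 = k.val
    omega

lemma sideRel_chain' {j k : Fin a} (h : j.val ≤ k.val) :
    Relation.ReflTransGen (sideRel (d := d) (b := b)) (.inr (.inl j)) (.inr (.inl k)) := by
  obtain ⟨m, hm⟩ := Nat.exists_eq_add_of_le h
  induction m generalizing k with
  | zero => obtain rfl : k = j := Fin.ext (by omega); exact .refl
  | succ m ih =>
    have hk := k.2
    refine .tail (ih (k := ⟨j.val + m, by omega⟩) (Nat.le_add_right _ _) rfl) ?_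
    change j.val + m + 1 = k.val
    omega

/-- The minimum, followed by the first chain. -/
def lowerChain (hn : n = 0 ∨ d = 2 ∧ n ≤ a + 1) (k : Fin n) : Fin d ⊕ (Fin a ⊕ Fin b) :=
  if h : k.val = 0 then .inl ⟨0, by have := k.2; omega⟩
  else .inr (.inl ⟨k.val - 1, by have := k.2; omega⟩)

lemma lowerChain_cases {hn : n = 0 ∨ d = 2 ∧ n ≤ a + 1} (k : Fin n) :
    (∃ (_ : k.val = 0) (h' : 0 < d), lowerChain (b := b) hn k = .inl ⟨0, h'⟩) ∨
      ∃ (_ : k.val ≠ 0) (h' : k.val - 1 < a),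
        lowerChain (b := b) hn k = .inr (.inl ⟨k.val - 1, h'⟩) := by
  by_cases h : k.val = 0
  · exact .inl ⟨h, _, dif_pos h⟩
  · exact .inr ⟨h, _, dif_neg h⟩

/-- The first chain without its first `o` elements, followed by the maximum. -/
def upperChain (o : ℕ) (hn : n = 0 ∨ d = 2 ∧ n + o = a + 1) (k : Fin n) :
    Fin d ⊕ (Fin a ⊕ Fin b) :=
  if h : k.val + o < a then .inr (.inl ⟨k.val + o, h⟩) else .inl ⟨1, by have := k.2; omega⟩

lemma upperChain_cases {o : ℕ} {hn : n = 0 ∨ d = 2 ∧ n + o = a + 1} (k : Fin n) :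
    (∃ (_ : k.val + o = a) (h' : 1 < d), upperChain (b := b) o hn k = .inl ⟨1, h'⟩) ∨
      ∃ (h : k.val + o < a), upperChain (b := b) o hn k = .inr (.inl ⟨k.val + o, h⟩) := by
  by_cases h : k.val + o < a
  · exact .inr ⟨h, dif_pos h⟩
  · have hk := k.2
    exact .inl ⟨by omega, by omega, dif_neg h⟩

/-- Above the bottom of the second chain are that chain, the maximum and, by the additional
relation, the coatom of the first chain. There remain the minimum and the first chain without its
coatom; nothing remains if the other end is plain (`d = 0`). -/
lemma isLowerArm_sideRel_zero (hb : 0 < b) (hd : d = 0 ∧ a = 0 ∧ n = 0 ∨ d = 2 ∧ n = a ∧ 0 < a)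
    (hn : n = 0 ∨ d = 2 ∧ n ≤ a + 1)
    {label : Fin d ⊕ (Fin a ⊕ Fin b) → A} {label' : Fin 0 ⊕ (Fin n ⊕ Fin 0) → A}
    (hl : ∀ k, label (lowerChain hn k) = label' (.inr (.inl k))) :
    LabeledOrder.IsLowerArm (.generate sideRel label) (.inr (.inr ⟨0, hb⟩))
      {x | x ≠ .inr (.inr ⟨0, hb⟩)} (.generate sideRel label') := by
  refine LabeledOrder.isLowerArm_generate (fun
      | .inl j => j.elim0
      | .inr (.inl k) => lowerChain hn k
      | .inr (.inr j) => j.elim0) ?_ ?_ ?_ ?_ ?_ ?_ ?_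
  · rintro (j | j | j) (k | k | k) hjk
    all_goals try first | exact j.elim0 | exact k.elim0
    dsimp only at hjk
    rcases lowerChain_cases (b := b) (hn := hn) j with ⟨h1, h1', h1''⟩ | ⟨h1, h1', h1''⟩ <;>
      rcases lowerChain_cases (b := b) (hn := hn) k with ⟨h2, h2', h2''⟩ | ⟨h2, h2', h2''⟩ <;>
      rw [h1'', h2''] at hjk <;> simp at hjk <;>
      exact congrArg (Sum.inr ∘ Sum.inl) (Fin.ext (by omega))
  · rintro (j | j | j)
    all_goals try exact j.elim0
    dsimp only
    rcases lowerChain_cases (b := b) (hn := hn) j with ⟨h1, h1', h1''⟩ | ⟨h1, h1', h1''⟩ <;>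
      rw [h1''] <;> intro h <;> cases h
  · rintro (j | j | j) hj
    · have hjd := j.2
      by_cases h : j.val = 0
      · refine .inl ⟨.inr (.inl ⟨0, by omega⟩), ?_⟩
        exact (dif_pos rfl).trans (congrArg Sum.inl (Fin.ext h.symm))
      · exact .inr (.single (by change j.val = 1; omega))
    · have hjd := j.2
      by_cases h : j.val + 1 < n
      · refine .inl ⟨.inr (.inl ⟨j.val + 1, h⟩), ?_⟩
        exact dif_neg (Nat.succ_ne_zero _)
      · exact .inr (.single ⟨rfl, by omega⟩)
    · exact .inr (sideRel_chain (Nat.zero_le _))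
  · rintro x (k | k | k) hxk
    all_goals try exact k.elim0
    dsimp only at hxk
    have hk := k.2
    rcases lowerChain_cases (b := b) (hn := hn) k with ⟨h1, h1', h1''⟩ | ⟨h1, h1', h1''⟩ <;>
      rw [h1''] at hxk <;> rcases x with j | j | j
    · exact absurd hxk.2 (by simp)
    · exact absurd hxk (by simp [sideRel])
    · exact absurd hxk (by simp [sideRel])
    · refine ⟨.inr (.inl ⟨0, by omega⟩), ?_⟩
      exact (dif_pos rfl).trans (congrArg Sum.inl (Fin.ext (show j.val = 0 from hxk).symm))
    · have hjk : j.val + 1 = k.val - 1 := hxk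
      refine ⟨.inr (.inl ⟨j.val + 1, by omega⟩), ?_⟩
      exact dif_neg (Nat.succ_ne_zero _)
    · have hjk : k.val - 1 + 1 = a := hxk.2
      omega
  · rintro (j | j | j) (k | k | k) hjk
    all_goals try first | exact j.elim0 | exact k.elim0
    have hjk' : j.val + 1 = k.val := hjk
    refine .single ?_
    dsimp only
    rcases lowerChain_cases (b := b) (hn := hn) j with ⟨h1, h1', h1''⟩ | ⟨h1, h1', h1''⟩ <;>
      rcases lowerChain_cases (b := b) (hn := hn) k with ⟨h2, h2', h2''⟩ | ⟨h2, h2', h2''⟩ <;>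
      rw [h1'', h2'']
    · omega
    · exact rfl
    · omega
    · change j.val - 1 + 1 = k.val - 1
      omega
  · rintro (j | j | j) (k | k | k) hjk
    all_goals try first | exact j.elim0 | exact k.elim0
    dsimp only at hjk
    rcases lowerChain_cases (b := b) (hn := hn) j with ⟨h1, h1', h1''⟩ | ⟨h1, h1', h1''⟩ <;>
      rcases lowerChain_cases (b := b) (hn := hn) k with ⟨h2, h2', h2''⟩ | ⟨h2, h2', h2''⟩ <;>
      rw [h1'', h2''] at hjk
    · exact absurd hjk.2 (by simp)
    · exact sideRel_chain' (by omega)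
    · exact absurd hjk (by simp [sideRel])
    · have : j.val - 1 + 1 = k.val - 1 := hjk
      exact .single (by change j.val + 1 = k.val; omega)
  · rintro (j | j | j)
    all_goals try exact j.elim0
    exact hl j

/-- Upside down: below the coatom of the second chain are that chain, the minimum and the atom of
the first chain, so the first chain loses its bottom (`o = 1`) and keeps the maximum. -/
lemma isUpperArm_sideRel_last {hi : i < b} (hib : i + 1 = b)
    (hd : d = 0 ∧ a = 0 ∧ n = 0 ∨ d = 2 ∧ n = a ∧ 0 < a)
    (hn : n = 0 ∨ d = 2 ∧ n + 1 = a + 1)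
    {label : Fin d ⊕ (Fin a ⊕ Fin b) → A} {label' : Fin 0 ⊕ (Fin 0 ⊕ Fin n) → A}
    (hl : ∀ k, label (upperChain 1 hn k) = label' (.inr (.inr k))) :
    LabeledOrder.IsUpperArm (.generate sideRel label) (.inr (.inr ⟨i, hi⟩))
      {x | x ≠ .inr (.inr ⟨i, hi⟩)} (.generate sideRel label') := by
  refine LabeledOrder.isUpperArm_generate (fun
      | .inl j => j.elim0
      | .inr (.inr k) => upperChain 1 hn k
      | .inr (.inl j) => j.elim0) ?_ ?_ ?_ ?_ ?_ ?_ ?_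
  · rintro (j | j | j) (k | k | k) hjk
    all_goals try first | exact j.elim0 | exact k.elim0
    dsimp only at hjk
    rcases upperChain_cases (b := b) (hn := hn) j with ⟨h1, h1', h1''⟩ | ⟨h1, h1''⟩ <;>
      rcases upperChain_cases (b := b) (hn := hn) k with ⟨h2, h2', h2''⟩ | ⟨h2, h2''⟩ <;>
      rw [h1'', h2''] at hjk <;> simp at hjk <;>
      exact congrArg (Sum.inr ∘ Sum.inr) (Fin.ext (by omega))
  · rintro (j | j | j)
    all_goals try exact j.elim0
    dsimp only
    rcases upperChain_cases (b := b) (hn := hn) j with ⟨h1, h1', h1''⟩ | ⟨h1, h1''⟩ <;>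
      rw [h1''] <;> intro h <;> cases h
  · rintro (j | j | j) hj
    · have hjd := j.2
      by_cases h : j.val = 0
      · exact .inr (.single h)
      · refine .inl ⟨.inr (.inr ⟨a - 1, by omega⟩), ?_⟩
        refine (dif_neg (by dsimp only; omega)).trans (congrArg Sum.inl (Fin.ext ?_))
        change 1 = j.val
        omega
    · have hjd := j.2
      by_cases h : j.val = 0
      · exact .inr (.single ⟨h, hib⟩)
      · refine .inl ⟨.inr (.inr ⟨j.val - 1, by omega⟩), ?_⟩
        refine (dif_pos (by dsimp only; omega)).trans (congrArg (Sum.inr ∘ Sum.inl) (Fin.ext ?_))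
        change j.val - 1 + 1 = j.val
        omega
    · exact .inr (sideRel_chain (by have := j.2; change j.val ≤ i; omega))
  · rintro x (k | k | k) hxk
    all_goals try exact k.elim0
    dsimp only at hxk
    have hk := k.2
    rcases upperChain_cases (b := b) (hn := hn) k with ⟨h1, h1', h1''⟩ | ⟨h1, h1''⟩ <;>
      rw [h1''] at hxk <;> rcases x with j | j | j
    · exact absurd hxk.1 (by simp)
    · exact absurd hxk (by simp [sideRel])
    · exact absurd hxk (by simp [sideRel])
    · refine ⟨.inr (.inr ⟨a - 1, by omega⟩), ?_⟩
      refine (dif_neg (by dsimp only; omega)).trans (congrArg Sum.inl (Fin.ext ?_))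
      exact (show j.val = 1 from hxk).symm
    · have hjk : k.val + 1 + 1 = j.val := hxk
      refine ⟨.inr (.inr ⟨j.val - 1, by omega⟩), ?_⟩
      refine (dif_pos (by dsimp only; omega)).trans (congrArg (Sum.inr ∘ Sum.inl) (Fin.ext ?_))
      change j.val - 1 + 1 = j.val
      omega
    · have hjk : k.val + 1 = 0 := hxk.1
      omega
  · rintro (j | j | j) (k | k | k) hjk
    all_goals try first | exact j.elim0 | exact k.elim0
    have hjk' : j.val + 1 = k.val := hjk
    have hk := k.2
    refine .single ?_
    dsimp only
    rcases upperChain_cases (b := b) (hn := hn) j with ⟨h1, h1', h1''⟩ | ⟨h1, h1''⟩ <;>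
      rcases upperChain_cases (b := b) (hn := hn) k with ⟨h2, h2', h2''⟩ | ⟨h2, h2''⟩ <;>
      rw [h1'', h2'']
    · omega
    · omega
    · exact rfl
    · change j.val + 1 + 1 = k.val + 1
      omega
  · rintro (j | j | j) (k | k | k) hjk
    all_goals try first | exact j.elim0 | exact k.elim0
    dsimp only at hjk
    rcases upperChain_cases (b := b) (hn := hn) j with ⟨h1, h1', h1''⟩ | ⟨h1, h1''⟩ <;>
      rcases upperChain_cases (b := b) (hn := hn) k with ⟨h2, h2', h2''⟩ | ⟨h2, h2''⟩ <;>
      rw [h1'', h2''] at hjk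
    · exact absurd hjk.1 (by simp)
    · exact absurd hjk (by simp [sideRel])
    · exact sideRel_chain (by omega)
    · have : j.val + 1 + 1 = k.val + 1 := hjk
      exact .single (by change j.val + 1 = k.val; omega)
  · rintro (j | j | j)
    all_goals try exact j.elim0
    exact hl j

/-- What remains of the second chain becomes the crossings of the blue arc, in descending order. The
minimum followed by the first chain becomes the chain at its end. Its bottom is below the last
crossing because it is the minimum, and its top is above the last crossing by the additional
relation between atom and coatom. -/
lemma isLowerArm_sideRel_succ (hi : i + 1 < b) {ts : List Turn} (hts : ts = List.replicate i .right)
    (hm : m = i + 1) (hd : d = 0 ∧ a = 0 ∧ n = 0 ∨ d = 2 ∧ n = a + 1 ∧ 0 < a)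
    (hn : n = 0 ∨ d = 2 ∧ n ≤ a + 1)
    {label : Fin d ⊕ (Fin a ⊕ Fin b) → A} {label' : Fin m ⊕ (Fin 0 ⊕ Fin n) → A}
    (hl' : ∀ j : Fin m, label (.inr (.inr ⟨i - j.val, by omega⟩)) = label' (.inl j))
    (hl : ∀ k, label (lowerChain hn k) = label' (.inr (.inr k))) :
    LabeledOrder.IsLowerArm (.generate sideRel label) (.inr (.inr ⟨i + 1, hi⟩))
      {x | x ≠ .inr (.inr ⟨i + 1, hi⟩)} (.generate (crossRel ts) label') := by
  have hget : ∀ j, ts[j]? = if j < i then some .right else none := by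
    intro j
    rw [hts, List.getElem?_replicate]
  refine LabeledOrder.isLowerArm_generate (fun
      | .inl j => .inr (.inr ⟨i - j.val, by omega⟩)
      | .inr (.inr k) => lowerChain hn k
      | .inr (.inl j) => j.elim0) ?_ ?_ ?_ ?_ ?_ ?_ ?_
  · rintro (j | j | j) (k | k | k) hjk
    all_goals try first | exact j.elim0 | exact k.elim0
    · simp only [Sum.inr.injEq, Fin.mk.injEq] at hjk
      exact congrArg Sum.inl (Fin.ext (by omega))
    · dsimp only at hjk
      rcases lowerChain_cases (b := b) (hn := hn) k with ⟨h2, h2', h2''⟩ | ⟨h2, h2', h2''⟩ <;>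
        rw [h2''] at hjk <;> simp at hjk
    · dsimp only at hjk
      rcases lowerChain_cases (b := b) (hn := hn) j with ⟨h2, h2', h2''⟩ | ⟨h2, h2', h2''⟩ <;>
        rw [h2''] at hjk <;> simp at hjk
    · dsimp only at hjk
      rcases lowerChain_cases (b := b) (hn := hn) j with ⟨h1, h1', h1''⟩ | ⟨h1, h1', h1''⟩ <;>
        rcases lowerChain_cases (b := b) (hn := hn) k with ⟨h2, h2', h2''⟩ | ⟨h2, h2', h2''⟩ <;>
        rw [h1'', h2''] at hjk <;> simp at hjk <;>
        exact congrArg (Sum.inr ∘ Sum.inr) (Fin.ext (by omega))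
  · rintro (j | j | j)
    · intro h
      have h1 : i - j.val = i + 1 := Fin.val_eq_of_eq (Sum.inr.inj (Sum.inr.inj h))
      omega
    · exact j.elim0
    · dsimp only
      rcases lowerChain_cases (b := b) (hn := hn) j with ⟨h1, h1', h1''⟩ | ⟨h1, h1', h1''⟩ <;>
        rw [h1''] <;> intro h <;> cases h
  · rintro (j | j | j) hj
    · have hjd := j.2
      by_cases h : j.val = 0
      · refine .inl ⟨.inr (.inr ⟨0, by omega⟩), ?_⟩
        exact (dif_pos rfl).trans (congrArg Sum.inl (Fin.ext h.symm))
      · exact .inr (.single (by change j.val = 1; omega))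
    · have hjd := j.2
      refine .inl ⟨.inr (.inr ⟨j.val + 1, by omega⟩), ?_⟩
      exact dif_neg (Nat.succ_ne_zero _)
    · by_cases h : j.val ≤ i
      · refine .inl ⟨.inl ⟨i - j.val, by omega⟩, ?_⟩
        exact congrArg (Sum.inr ∘ Sum.inr) (Fin.ext (by change i - (i - j.val) = j.val; omega))
      · exact .inr (sideRel_chain (by change i + 1 ≤ j.val; omega))
  · rintro x (k | k | k) hxk
    all_goals try exact k.elim0
    · rcases x with j | j | j
      · have hjd := j.2
        refine ⟨.inr (.inr ⟨0, by omega⟩), ?_⟩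
        exact (dif_pos rfl).trans (congrArg Sum.inl (Fin.ext (show j.val = 0 from hxk).symm))
      · have hjd := j.2
        refine ⟨.inr (.inr ⟨j.val + 1, by omega⟩), ?_⟩
        exact dif_neg (Nat.succ_ne_zero _)
      · have hjk : j.val + 1 = i - k.val := hxk
        refine ⟨.inl ⟨i - j.val, by omega⟩, ?_⟩
        exact congrArg (Sum.inr ∘ Sum.inr) (Fin.ext (by change i - (i - j.val) = j.val; omega))
    · dsimp only at hxk
      have hk := k.2
      rcases lowerChain_cases (b := b) (hn := hn) k with ⟨h1, h1', h1''⟩ | ⟨h1, h1', h1''⟩ <;>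
        rw [h1''] at hxk <;> rcases x with j | j | j
      · exact absurd hxk.2 (by simp)
      · exact absurd hxk (by simp [sideRel])
      · exact absurd hxk (by simp [sideRel])
      · refine ⟨.inr (.inr ⟨0, by omega⟩), ?_⟩
        exact (dif_pos rfl).trans (congrArg Sum.inl (Fin.ext (show j.val = 0 from hxk).symm))
      · have hjk : j.val + 1 = k.val - 1 := hxk
        refine ⟨.inr (.inr ⟨j.val + 1, by omega⟩), ?_⟩
        exact dif_neg (Nat.succ_ne_zero _)
      · have hjk : j.val = 0 := hxk.1
        refine ⟨.inl ⟨i, by omega⟩, ?_⟩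
        exact congrArg (Sum.inr ∘ Sum.inr) (Fin.ext (by change i - i = j.val; omega))
  · rintro (j | j | j) (k | k | k) hjk
    all_goals try first | exact j.elim0 | exact k.elim0
    · refine .single ?_
      change i - j.val + 1 = i - k.val
      rcases hjk with ⟨h1, h2⟩ | ⟨h1, h2⟩ <;> rw [hget] at h2 <;> split_ifs at h2
      · simp at h2
      · omega
    · have h1 : j.val + 1 = m := hjk.1
      have h2 : k.val + 1 = n := hjk.2
      refine .single ?_
      dsimp only
      rcases lowerChain_cases (b := b) (hn := hn) k with ⟨h3, h3', h3''⟩ | ⟨h3, h3', h3''⟩ <;>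
        rw [h3'']
      · omega
      · exact ⟨by change i - j.val = 0; omega, by change k.val - 1 + 1 = a; omega⟩
    · have h1 : j.val = 0 := hjk.1
      refine .single ?_
      dsimp only
      rcases lowerChain_cases (b := b) (hn := hn) j with ⟨h3, h3', h3''⟩ | ⟨h3, h3', h3''⟩ <;>
        rw [h3'']
      · exact rfl
      · omega
    · have hjk' : j.val + 1 = k.val := hjk
      refine .single ?_
      dsimp only
      rcases lowerChain_cases (b := b) (hn := hn) j with ⟨h1, h1', h1''⟩ | ⟨h1, h1', h1''⟩ <;>
        rcases lowerChain_cases (b := b) (hn := hn) k with ⟨h2, h2', h2''⟩ | ⟨h2, h2', h2''⟩ <;>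
        rw [h1'', h2'']
      · omega
      · exact rfl
      · omega
      · change j.val - 1 + 1 = k.val - 1
        omega
  · have hrun : ∀ {j k : Fin m}, j.val ≤ k.val → Relation.ReflTransGen
        (crossRel (a := 0) (b := n) ts) (.inl k) (.inl j) := by
      intro j k h
      have hk := k.2
      have := crossRel_right_run (a := 0) (b := n) (ts := ts) (n := m) (k := j.val)
        (m := k.val - j.val) (by omega) fun x hx => by rw [hget, if_pos (by omega)]
      rwa [show (⟨j.val + (k.val - j.val), by omega⟩ : Fin m) = k from Fin.ext (by simp; omega)]
        at this
    rintro (j | j | j) (k | k | k) hjk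
    all_goals try first | exact j.elim0 | exact k.elim0
    · have h1 : i - j.val + 1 = i - k.val := hjk
      exact hrun (by omega)
    · dsimp only at hjk
      rcases lowerChain_cases (b := b) (hn := hn) k with ⟨h3, h3', h3''⟩ | ⟨h3, h3', h3''⟩ <;>
        rw [h3''] at hjk
      · exact absurd hjk (by simp [sideRel])
      · have h1 : i - j.val = 0 := hjk.1
        have h2 : k.val - 1 + 1 = a := hjk.2
        exact .single ⟨by omega, by omega⟩
    · dsimp only at hjk
      rcases lowerChain_cases (b := b) (hn := hn) j with ⟨h3, h3', h3''⟩ | ⟨h3, h3', h3''⟩ <;>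
        rw [h3''] at hjk
      -- The minimum is directly below every chain element in `sideRel`, but in `crossRel` only
      -- below the last crossing; the run of right turns supplies the rest.
      · exact .head (show crossRel ts (.inr (.inr j)) (.inl (⟨i, by omega⟩ : Fin m)) from
          ⟨h3, hm.symm⟩) (hrun (by change k.val ≤ i; omega))
      · have h1 : i - k.val + 1 = b := hjk.2
        omega
    · dsimp only at hjk
      rcases lowerChain_cases (b := b) (hn := hn) j with ⟨h1, h1', h1''⟩ | ⟨h1, h1', h1''⟩ <;>
        rcases lowerChain_cases (b := b) (hn := hn) k with ⟨h2, h2', h2''⟩ | ⟨h2, h2', h2''⟩ <;>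
        rw [h1'', h2''] at hjk
      · exact absurd hjk.2 (by simp)
      · exact crossRel_chain' (by omega)
      · exact absurd hjk (by simp [sideRel])
      · have : j.val - 1 + 1 = k.val - 1 := hjk
        exact .single (by change j.val + 1 = k.val; omega)
  · rintro (j | j | j)
    · exact hl' j
    · exact j.elim0
    · exact hl j

/-- Dually, the rest of the second chain is crossed in ascending order, and the first chain followed
by the maximum is the chain at the end. The other additional relation puts its bottom below the last
crossing. -/
lemma isUpperArm_sideRel_of_lt {l : ℕ} {hi : i < b} (hib : i + 1 + (l + 1) = b) {ts : List Turn}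
    (hts : ts = List.replicate l .left)
    (hm : m = l + 1) (hd : d = 0 ∧ a = 0 ∧ n = 0 ∨ d = 2 ∧ n = a + 1 ∧ 0 < a)
    (hn : n = 0 ∨ d = 2 ∧ n + 0 = a + 1)
    {label : Fin d ⊕ (Fin a ⊕ Fin b) → A} {label' : Fin m ⊕ (Fin 0 ⊕ Fin n) → A}
    (hl' : ∀ j : Fin m, label (.inr (.inr ⟨i + 1 + j.val, by omega⟩)) = label' (.inl j))
    (hl : ∀ k, label (upperChain 0 hn k) = label' (.inr (.inr k))) :
    LabeledOrder.IsUpperArm (.generate sideRel label) (.inr (.inr ⟨i, hi⟩))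
      {x | x ≠ .inr (.inr ⟨i, hi⟩)} (.generate (crossRel ts) label') := by
  have hget : ∀ j, ts[j]? = if j < l then some .left else none := by
    intro j
    rw [hts, List.getElem?_replicate]
  refine LabeledOrder.isUpperArm_generate (fun
      | .inl j => .inr (.inr ⟨i + 1 + j.val, by omega⟩)
      | .inr (.inr k) => upperChain 0 hn k
      | .inr (.inl j) => j.elim0) ?_ ?_ ?_ ?_ ?_ ?_ ?_
  · rintro (j | j | j) (k | k | k) hjk
    all_goals try first | exact j.elim0 | exact k.elim0
    · simp only [Sum.inr.injEq, Fin.mk.injEq] at hjk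
      exact congrArg Sum.inl (Fin.ext (by omega))
    · dsimp only at hjk
      rcases upperChain_cases (b := b) (hn := hn) k with ⟨h2, h2', h2''⟩ | ⟨h2, h2''⟩ <;>
        rw [h2''] at hjk <;> simp at hjk
    · dsimp only at hjk
      rcases upperChain_cases (b := b) (hn := hn) j with ⟨h2, h2', h2''⟩ | ⟨h2, h2''⟩ <;>
        rw [h2''] at hjk <;> simp at hjk
    · dsimp only at hjk
      rcases upperChain_cases (b := b) (hn := hn) j with ⟨h1, h1', h1''⟩ | ⟨h1, h1''⟩ <;>
        rcases upperChain_cases (b := b) (hn := hn) k with ⟨h2, h2', h2''⟩ | ⟨h2, h2''⟩ <;>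
        rw [h1'', h2''] at hjk <;> simp at hjk <;>
        exact congrArg (Sum.inr ∘ Sum.inr) (Fin.ext (by omega))
  · rintro (j | j | j)
    · intro h
      have h1 : i + 1 + j.val = i := Fin.val_eq_of_eq (Sum.inr.inj (Sum.inr.inj h))
      omega
    · exact j.elim0
    · dsimp only
      rcases upperChain_cases (b := b) (hn := hn) j with ⟨h1, h1', h1''⟩ | ⟨h1, h1''⟩ <;>
        rw [h1''] <;> intro h <;> cases h
  · rintro (j | j | j) hj
    · have hjd := j.2
      by_cases h : j.val = 0
      · exact .inr (.single h)
      · refine .inl ⟨.inr (.inr ⟨a, by omega⟩), ?_⟩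
        refine (dif_neg (by dsimp only; omega)).trans (congrArg Sum.inl (Fin.ext ?_))
        change 1 = j.val
        omega
    · have hjd := j.2
      refine .inl ⟨.inr (.inr ⟨j.val, by omega⟩), ?_⟩
      exact dif_pos j.2
    · by_cases h : i < j.val
      · have hjd := j.2
        refine .inl ⟨.inl ⟨j.val - (i + 1), by omega⟩, ?_⟩
        exact congrArg (Sum.inr ∘ Sum.inr)
          (Fin.ext (by change i + 1 + (j.val - (i + 1)) = j.val; omega))
      · exact .inr (sideRel_chain (by change j.val ≤ i; omega))
  · rintro x (k | k | k) hxk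
    all_goals try exact k.elim0
    · rcases x with j | j | j
      · have hjd := j.2
        refine ⟨.inr (.inr ⟨a, by omega⟩), ?_⟩
        refine (dif_neg (by dsimp only; omega)).trans (congrArg Sum.inl (Fin.ext ?_))
        exact (show j.val = 1 from hxk).symm
      · have hjd := j.2
        refine ⟨.inr (.inr ⟨j.val, by omega⟩), ?_⟩
        exact dif_pos j.2
      · have hjk : i + 1 + k.val + 1 = j.val := hxk
        have hjd := j.2
        refine ⟨.inl ⟨j.val - (i + 1), by omega⟩, ?_⟩
        exact congrArg (Sum.inr ∘ Sum.inr)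
          (Fin.ext (by change i + 1 + (j.val - (i + 1)) = j.val; omega))
    · dsimp only at hxk
      have hk := k.2
      rcases upperChain_cases (b := b) (hn := hn) k with ⟨h1, h1', h1''⟩ | ⟨h1, h1''⟩ <;>
        rw [h1''] at hxk <;> rcases x with j | j | j
      · exact absurd hxk.1 (by simp)
      · exact absurd hxk (by simp [sideRel])
      · exact absurd hxk (by simp [sideRel])
      · refine ⟨.inr (.inr ⟨a, by omega⟩), ?_⟩
        refine (dif_neg (by dsimp only; omega)).trans (congrArg Sum.inl (Fin.ext ?_))
        exact (show j.val = 1 from hxk).symm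
      · have hjd := j.2
        refine ⟨.inr (.inr ⟨j.val, by omega⟩), ?_⟩
        exact dif_pos j.2
      · have hjk : j.val + 1 = b := hxk.2
        refine ⟨.inl ⟨l, by omega⟩, ?_⟩
        exact congrArg (Sum.inr ∘ Sum.inr) (Fin.ext (by change i + 1 + l = j.val; omega))
  · rintro (j | j | j) (k | k | k) hjk
    all_goals try first | exact j.elim0 | exact k.elim0
    · refine .single ?_
      change i + 1 + j.val + 1 = i + 1 + k.val
      rcases hjk with ⟨h1, h2⟩ | ⟨h1, h2⟩ <;> rw [hget] at h2 <;> split_ifs at h2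
      · omega
      · simp at h2
    · have h1 : j.val + 1 = m := hjk.1
      have h2 : k.val + 1 = n := hjk.2
      refine .single ?_
      dsimp only
      rcases upperChain_cases (b := b) (hn := hn) k with ⟨h3, h3', h3''⟩ | ⟨h3, h3''⟩ <;>
        rw [h3'']
      · exact rfl
      · omega
    · have h1 : j.val = 0 := hjk.1
      have h2 : k.val + 1 = m := hjk.2
      have hj := j.2
      refine .single ?_
      dsimp only
      rcases upperChain_cases (b := b) (hn := hn) j with ⟨h3, h3', h3''⟩ | ⟨h3, h3''⟩ <;>
        rw [h3'']
      · omega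
      · exact ⟨h1, by change i + 1 + k.val + 1 = b; omega⟩
    · have hjk' : j.val + 1 = k.val := hjk
      have hk := k.2
      refine .single ?_
      dsimp only
      rcases upperChain_cases (b := b) (hn := hn) j with ⟨h1, h1', h1''⟩ | ⟨h1, h1''⟩ <;>
        rcases upperChain_cases (b := b) (hn := hn) k with ⟨h2, h2', h2''⟩ | ⟨h2, h2''⟩ <;>
        rw [h1'', h2'']
      · omega
      · omega
      · exact rfl
      · exact hjk'
  · have hrun : ∀ {j k : Fin m}, j.val ≤ k.val → Relation.ReflTransGen
        (crossRel (a := 0) (b := n) ts) (.inl j) (.inl k) := by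
      intro j k h
      have hk := k.2
      have := crossRel_left_run (a := 0) (b := n) (ts := ts) (n := m) (k := j.val)
        (m := k.val - j.val) (by omega) fun x hx => by rw [hget, if_pos (by omega)]
      rwa [show (⟨j.val + (k.val - j.val), by omega⟩ : Fin m) = k from Fin.ext (by simp; omega)]
        at this
    rintro (j | j | j) (k | k | k) hjk
    all_goals try first | exact j.elim0 | exact k.elim0
    · have h1 : i + 1 + j.val + 1 = i + 1 + k.val := hjk
      exact hrun (by omega)
    · dsimp only at hjk
      have hk := k.2
      rcases upperChain_cases (b := b) (hn := hn) k with ⟨h3, h3', h3''⟩ | ⟨h3, h3''⟩ <;>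
        rw [h3''] at hjk
      · exact (hrun (k := ⟨l, by omega⟩) (by change j.val ≤ l; omega)).tail
          ⟨hm.symm, by omega⟩
      · have h1 : i + 1 + j.val = 0 := hjk.1
        omega
    · dsimp only at hjk
      rcases upperChain_cases (b := b) (hn := hn) j with ⟨h3, h3', h3''⟩ | ⟨h3, h3''⟩ <;>
        rw [h3''] at hjk
      · exact absurd hjk (by simp [sideRel])
      · have h1 : j.val = 0 := hjk.1
        have h2 : i + 1 + k.val + 1 = b := hjk.2
        exact .single ⟨h1, by omega⟩
    · dsimp only at hjk
      rcases upperChain_cases (b := b) (hn := hn) j with ⟨h1, h1', h1''⟩ | ⟨h1, h1''⟩ <;>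
        rcases upperChain_cases (b := b) (hn := hn) k with ⟨h2, h2', h2''⟩ | ⟨h2, h2''⟩ <;>
        rw [h1'', h2''] at hjk
      · exact absurd hjk.1 (by simp)
      · exact absurd hjk (by simp [sideRel])
      · exact crossRel_chain' (by omega)
      · exact .single hjk
  · rintro (j | j | j)
    · exact hl' j
    · exact j.elim0
    · exact hl j

end SideRel

end Triangulation

/-! ### The colored arcs when the curve coincides with an arc of the triangulation -/

namespace Triangulation

variable {H : Type*} {T : Triangulation H}

section Side

variable {h e : H} {s : Tag} {i l : ℕ}

/-- The two alternatives in the hypotheses on the sizes above: the other end is plain or notched. -/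
lemma size_zero_or (s : Tag) {d : ℕ} (hd : 2 ≤ d) :
    extremeSize s .notched = 0 ∧ chainSize (d - 1) s = 0 ∧ chainSize d s = 0 ∨
      extremeSize s .notched = 2 ∧ chainSize d s = chainSize (d - 1) s + 1 ∧
        0 < chainSize (d - 1) s := by
  cases s
  · exact .inl ⟨rfl, rfl, rfl⟩
  · refine .inr ⟨rfl, ?_, ?_⟩
    · change d = d - 1 + 1; omega
    · change 0 < d - 1; omega

/-- The blue arc reaches the source of `h` at the corner `unrot h`, just clockwise of `β`. Counted
from there, the ends start with `β` itself, which is the minimum, and continue with the first chain.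
-/
lemma isLowerArm_side [Finite H] (hd : 2 ≤ T.degree h) (hi : i < T.degree (T.twin h) - 1)
    (he : T.twin e = T.rot^[i + 1] (T.twin h)) :
    (T.sidePoset h s .notched).IsLowerArm (.inr (.inr ⟨i, hi⟩)) {x | x ≠ .inr (.inr ⟨i, hi⟩)}
      (T.poset (T.fanSide .left e (List.replicate i .right) s)) := by
  cases i with
  | zero =>
    have hpe : T.prev e = T.unrot h := by
      rw [← T.twin_twin e, he]
      simp [rot, unrot]
    have hf : T.poset (T.fanSide .left e (List.replicate 0 .right) s) =
        T.sidePoset (T.unrot h) s .plain := by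
      rw [← hpe]; rfl
    rw [hf]
    have hdu : T.degree (T.unrot h) - 1 = T.degree h - 1 := by rw [degree_unrot]
    cases s
    · exact isLowerArm_sideRel_zero hi (.inl ⟨rfl, rfl, rfl⟩) (.inl rfl) (fun k => k.elim0)
    · refine isLowerArm_sideRel_zero hi (.inr ⟨rfl, hdu, ?_⟩) (.inr ⟨rfl, ?_⟩) ?_
      · omega
      · exact hdu.le.trans (Nat.le_succ _)
      · intro k
        rcases lowerChain_cases (b := T.degree (T.twin h) - 1)
          (hn := .inr ⟨rfl, hdu.le.trans (Nat.le_succ _)⟩) k with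
          ⟨h1, h2, h3⟩ | ⟨h1, h2, h3⟩ <;> rw [h3]
        · change T.edge h = T.edge (T.rot^[k.val + 1] (T.unrot h))
          rw [h1, Function.iterate_succ_apply, rot_unrot]; rfl
        · change T.edge (T.rot^[k.val - 1 + 1] h) = T.edge (T.rot^[k.val + 1] (T.unrot h))
          rw [Function.iterate_succ_apply T.rot k.val, rot_unrot,
            Nat.sub_add_cancel (Nat.pos_of_ne_zero h1)]
  | succ i =>
    have hne : T.next e = T.rot^[i + 1] (T.twin h) := by
      rw [← T.unrot_iterate_rot_iterate 1 (T.rot^[i + 1] (T.twin h)),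
        ← Function.iterate_add_apply, show 1 + (i + 1) = i + 1 + 1 by omega, ← he]
      simp [unrot]
    have hf : T.poset (T.fanSide .left e (List.replicate (i + 1) .right) s) =
        T.crossPoset (T.rot^[i + 1] (T.twin h)) (List.replicate i .right) .plain s := by
      rw [← hne]; rfl
    rw [hf]
    have hcr : ∀ j ≤ i, T.crossingAt (T.rot^[i + 1] (T.twin h)) (List.replicate i .right) j =
        T.rot^[i - j + 1] (T.twin h) := by
      intro j hj
      rw [T.crossingAt_right_run (replicate_prefix_of_le hj List.prefix_rfl),
        T.unrot_iterate_rot_iterate_of_le (by omega)]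
      congr 1; omega
    have hlast : T.prev (T.twin (T.lastCrossing (T.rot^[i + 1] (T.twin h))
        (List.replicate i .right))) = T.unrot h := by
      rw [lastCrossing, List.length_replicate, hcr i le_rfl]
      simp [rot, unrot]
    have hn : chainSize (T.degree (T.prev (T.twin (T.lastCrossing (T.rot^[i + 1] (T.twin h))
        (List.replicate i .right))))) s = chainSize (T.degree h) s := by
      rw [hlast, degree_unrot]
    have hsz := size_zero_or s hd
    rw [← hn] at hsz
    have hn' : chainSize (T.degree (T.prev (T.twin (T.lastCrossing (T.rot^[i + 1] (T.twin h))
        (List.replicate i .right))))) s = 0 ∨ extremeSize s .notched = 2 ∧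
        chainSize (T.degree (T.prev (T.twin (T.lastCrossing (T.rot^[i + 1] (T.twin h))
        (List.replicate i .right))))) s ≤ chainSize (T.degree h - 1) s + 1 := by omega
    refine isLowerArm_sideRel_succ hi rfl (by simp) hsz hn' ?_ ?_
    · intro j
      have hj := j.2
      simp only [List.length_replicate] at hj
      change T.edge _ = T.edge _
      rw [hcr _ (by omega)]
    · intro k
      rcases lowerChain_cases (b := T.degree (T.twin h) - 1) (hn := hn') k with
        ⟨h1, h2, h3⟩ | ⟨h1, h2, h3⟩
      · refine (congrArg (T.sidePoset h s .notched).label h3).trans ?_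
        change T.edge h = T.edge (T.rot^[k.val + 1] _)
        generalize k.val = m at h1 ⊢
        rw [hlast, h1, Function.iterate_succ_apply, rot_unrot]; rfl
      · refine (congrArg (T.sidePoset h s .notched).label h3).trans ?_
        change T.edge (T.rot^[k.val - 1 + 1] h) = T.edge (T.rot^[k.val + 1] _)
        generalize k.val = m at h1 ⊢
        rw [hlast, Function.iterate_succ_apply T.rot m, rot_unrot,
          Nat.sub_add_cancel (Nat.pos_of_ne_zero h1)]

/-- If the red arc crosses arcs, it reaches the source of `h` at the corner `h`, and the ends
counted from there are the first chain and finally, after a full turn, `β`, which is the maximum. If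
it crosses nothing, it is the arc of `prev h`, the first of these ends, which is left out. -/
lemma isUpperArm_side [Finite H] (hd : 2 ≤ T.degree h) (hl : i + l + 2 = T.degree (T.twin h))
    (he : T.twin e = T.rot^[i + 1] (T.twin h)) :
    (T.sidePoset h s .notched).IsUpperArm
      (.inr (.inr ⟨i, show i < T.degree (T.twin h) - 1 by omega⟩))
      {x | x ≠ .inr (.inr ⟨i, show i < T.degree (T.twin h) - 1 by omega⟩)}
      (T.poset (T.fanSide .right (T.twin e) (List.replicate l .left) s)) := by
  -- This corner is one step short of a full turn around the target of `h`.
  have hnh : T.rot^[T.degree (T.twin h) - 1] (T.twin h) = T.next h := by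
    apply T.rot_injective
    rw [← Function.iterate_succ_apply' T.rot, Nat.succ_eq_add_one,
      show T.degree (T.twin h) - 1 + 1 = T.degree (T.twin h) by omega, rot_iterate_degree]
    simp [rot]
  cases l with
  | zero =>
    have hpe : T.next (T.twin e) = T.prev h := by
      rw [he, show i + 1 = T.degree (T.twin h) - 1 by omega, hnh, next_next]
    have hf : T.poset (T.fanSide .right (T.twin e) (List.replicate 0 .left) s) =
        T.sidePoset (T.prev h) .plain s := by
      rw [← hpe]; rfl
    rw [hf]
    have hdu : T.degree (T.twin (T.prev h)) - 1 = T.degree h - 1 := by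
      rw [← degree_rot T h]; rfl
    have hib : i + 1 = chainSize (T.degree (T.twin h) - 1) .notched := by
      change i + 1 = T.degree (T.twin h) - 1; omega
    cases s
    · exact isUpperArm_sideRel_last hib (.inl ⟨rfl, rfl, rfl⟩) (.inl rfl) (fun k => k.elim0)
    · refine isUpperArm_sideRel_last hib (.inr ⟨rfl, hdu, ?_⟩)
        (.inr ⟨rfl, congrArg (· + 1) hdu⟩) ?_
      · omega
      · intro k
        rcases upperChain_cases (b := T.degree (T.twin h) - 1) (o := 1)
          (hn := .inr ⟨rfl, congrArg (· + 1) hdu⟩) k with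
          ⟨h1, h2, h3⟩ | ⟨h1, h3⟩
        · refine (congrArg (T.sidePoset h .notched .notched).label h3).trans ?_
          change k.val + 1 = T.degree h - 1 at h1
          change T.edge h = T.edge (T.rot^[k.val + 1] (T.rot h))
          rw [← Function.iterate_succ_apply, Nat.succ_eq_add_one, h1,
            Nat.sub_add_cancel (by omega), rot_iterate_degree]
        · refine (congrArg (T.sidePoset h .notched .notched).label h3).trans ?_
          change T.edge (T.rot^[k.val + 1 + 1] h) = T.edge (T.rot^[k.val + 1] (T.rot h))
          rw [Function.iterate_succ_apply]
  | succ l =>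
    set y := T.prev (T.twin e) with hy
    have hy' : T.twin y = T.rot^[i + 1 + 1] (T.twin h) := by
      rw [Function.iterate_succ_apply', ← he]; rfl
    have hf : T.poset (T.fanSide .right (T.twin e) (List.replicate (l + 1) .left) s) =
        T.crossPoset y (List.replicate l .left) .plain s := rfl
    rw [hf]
    have hcr : ∀ j ≤ l, T.twin (T.crossingAt y (List.replicate l .left) j) =
        T.rot^[i + 1 + j + 1] (T.twin h) := by
      intro j hj
      have hp : List.replicate j Turn.left <+: List.replicate l .left :=
        ⟨List.replicate (l - j) .left, by
          rw [List.replicate_append_replicate, Nat.add_sub_cancel' hj]⟩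
      rw [T.twin_crossingAt_left_run hp, hy', ← Function.iterate_add_apply]
      congr 1; omega
    have hlast : T.prev (T.twin (T.lastCrossing y (List.replicate l .left))) = h := by
      rw [lastCrossing, List.length_replicate, hcr l le_rfl,
        show i + 1 + l + 1 = T.degree (T.twin h) - 1 by omega, hnh, prev_next]
    have hn : chainSize (T.degree (T.prev (T.twin (T.lastCrossing y
        (List.replicate l .left))))) s = chainSize (T.degree h) s := by
      rw [hlast]
    have hsz := size_zero_or s hd
    rw [← hn] at hsz
    have hn' : chainSize (T.degree (T.prev (T.twin (T.lastCrossing y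
        (List.replicate l .left))))) s = 0 ∨ extremeSize s .notched = 2 ∧
        chainSize (T.degree (T.prev (T.twin (T.lastCrossing y
        (List.replicate l .left))))) s + 0 = chainSize (T.degree h - 1) s + 1 := by omega
    have hib : i + 1 + (l + 1) = chainSize (T.degree (T.twin h) - 1) .notched := by
      change _ = T.degree (T.twin h) - 1; omega
    refine isUpperArm_sideRel_of_lt hib rfl (by simp) hsz hn' ?_ ?_
    · intro j
      have hj := j.2
      simp only [List.length_replicate] at hj
      change T.edge _ = T.edge _
      rw [← T.edge_twin (T.crossingAt _ _ _), hcr _ (by omega)]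
    · intro k
      rcases upperChain_cases (b := T.degree (T.twin h) - 1) (hn := hn') k with
        ⟨h1, h2, h3⟩ | ⟨h1, h3⟩
      · refine (congrArg (T.sidePoset h s .notched).label h3).trans ?_
        have hs : s = .notched := exists_chainSize k
        change T.edge h = T.edge (T.rot^[k.val + 1] _)
        subst hs
        change k.val = T.degree h - 1 at h1
        generalize k.val = m at h1 ⊢
        rw [hlast, h1, Nat.sub_add_cancel (by omega), rot_iterate_degree]
      · refine (congrArg (T.sidePoset h s .notched).label h3).trans ?_
        change T.edge (T.rot^[k.val + 1] h) = T.edge (T.rot^[k.val + 1] _)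
        generalize k.val = m
        rw [hlast]

end Side

end Triangulation

/-! ### Elements below `γ`, and the resolution, when the curve coincides with an arc -/

namespace Triangulation

variable {H : Type*} {T : Triangulation H}

lemma isLow_right_replicate {R : Set T.Vertex} {e : H} {n m : ℕ} :
    T.IsLow R e (List.replicate n .right) m ↔
      m ≤ n ∨ m = n + 1 ∧ T.vertex (T.next (T.unrot^[m] e)) ∈ R := by
  refine or_congr ⟨fun h => by simpa using h.length_le,
    fun h => replicate_prefix_of_le h List.prefix_rfl⟩ ⟨?_, ?_⟩
  · rintro ⟨k, rfl, h1, h2⟩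
    have := congrArg List.length h1
    simp only [List.length_replicate] at this
    exact ⟨by rw [this], h2⟩
  · rintro ⟨rfl, h2⟩
    exact ⟨n, rfl, rfl, h2⟩

section Side

variable {h e : H} {s : Tag} {i l : ℕ}

/-- The minimum and the ends of arcs before the end number `i` in the second chain. -/
def sideBefore {d a b : ℕ} (i : ℕ) : Set (Fin d ⊕ (Fin a ⊕ Fin b)) :=
  {x | match x with
    | .inl j => j.val = 0
    | .inr (.inl _) => False
    | .inr (.inr j) => j.val < i}

/-- Everything except the minimum and the first `i + 1` elements of the second chain. -/
def sideRest {d a b : ℕ} (i : ℕ) : Set (Fin d ⊕ (Fin a ⊕ Fin b)) :=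
  {x | match x with
    | .inl j => j.val = 1
    | .inr (.inl _) => True
    | .inr (.inr j) => i < j.val}

lemma disjoint_sideRest_sideBefore {d a b : ℕ} :
    Disjoint (sideRest i : Set (Fin d ⊕ (Fin a ⊕ Fin b))) (sideBefore i) := by
  rw [Set.disjoint_left]
  rintro (j | j | j) h h'
  · exact one_ne_zero (Eq.trans (Eq.symm h) h')
  · exact h'
  · exact lt_asymm (show i < j.val from h) h'

lemma eq_or_mem_side {d a b : ℕ} (hd : d ≤ 2) (hi : i < b) (x : Fin d ⊕ (Fin a ⊕ Fin b)) :
    x = .inr (.inr ⟨i, hi⟩) ∨ x ∈ sideRest i ∨ x ∈ sideBefore i := by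
  rcases x with j | j | j
  · rcases Nat.eq_zero_or_pos j.val with h | h
    · exact .inr (.inr h)
    · exact .inr (.inl (by change j.val = 1; omega))
  · exact .inr (.inl trivial)
  · rcases lt_trichotomy i j.val with h | h | h
    · exact .inr (.inl h)
    · exact .inl (congrArg (Sum.inr ∘ Sum.inr) (Fin.ext h.symm))
    · exact .inr (.inr h)

lemma extremeSize_le (s f : Tag) : extremeSize s f ≤ 2 := by
  cases s <;> cases f <;> decide

lemma exists_extremeSize {s f : Tag} (j : Fin (extremeSize s f)) : s = .notched ∧ f = .notched := by
  cases s <;> cases f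
  · exact j.elim0
  · exact j.elim0
  · exact j.elim0
  · exact ⟨rfl, rfl⟩

/-- The one entry from the first chain is its atom, and only below the coatom of the second chain.
-/
lemma sideRel_le {d a b : ℕ} {hi : i < b} {x : Fin d ⊕ (Fin a ⊕ Fin b)}
    (hx : Relation.ReflTransGen sideRel x (.inr (.inr ⟨i, hi⟩))) :
    (∃ h, x = .inl ⟨0, h⟩) ∨ (∃ j h, j ≤ i ∧ x = .inr (.inr ⟨j, h⟩)) ∨
      i + 1 = b ∧ ∃ h, x = .inr (.inl ⟨0, h⟩) := by
  induction hx using Relation.ReflTransGen.head_induction_on with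
  | refl => exact .inr (.inl ⟨i, hi, le_rfl, rfl⟩)
  | @head x z hxz _ ih =>
    rcases ih with ⟨h, rfl⟩ | ⟨j, h, hj, rfl⟩ | ⟨hib, h, rfl⟩ <;> rcases x with k | k | k
    · exact absurd hxz.2 (by simp)
    · exact absurd hxz (by simp [sideRel])
    · exact absurd hxz (by simp [sideRel])
    · exact .inl ⟨k.pos, congrArg Sum.inl (Fin.ext hxz)⟩
    · have h1 : k.val = 0 := hxz.1
      have h2 : j + 1 = b := hxz.2
      exact .inr (.inr ⟨by omega, k.pos, congrArg (Sum.inr ∘ Sum.inl) (Fin.ext h1)⟩)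
    · have h1 : k.val + 1 = j := hxz
      exact .inr (.inl ⟨k.val, k.2, by omega, rfl⟩)
    · exact .inl ⟨k.pos, congrArg Sum.inl (Fin.ext hxz)⟩
    · exact absurd hxz (Nat.succ_ne_zero _)
    · have h1 : k.val = 0 := hxz.1
      exact .inr (.inl ⟨k.val, k.2, by omega, rfl⟩)

/-- The run of right turns goes down the second chain and ends at the source of `h`. If `α` is
notched there, the spirals at this point are reversed, and the extra low position is `β`, the label
of the minimum. -/
lemma isLowArm_sideBefore (hb : ¬ T.IsBoundary h) {R : Set T.Vertex}
    (hR : T.vertex h ∈ R ↔ s = .notched) (hi : i < T.degree (T.twin h) - 1) :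
    IsLowArm (T.sidePoset h s .notched) (.inr (.inr ⟨i, hi⟩)) (sideBefore i) R
      (T.rot^[i + 1] (T.twin h)) (List.replicate i .right) := by
  have hlow : ∀ m, T.IsLow R (T.rot^[i + 1] (T.twin h)) (List.replicate i .right) m ↔
      m ≤ i ∨ m = i + 1 ∧ s = .notched := by
    intro m
    rw [isLow_right_replicate]
    refine or_congr Iff.rfl (and_congr_right ?_)
    rintro rfl
    rw [unrot_iterate_rot_iterate, T.vertex_next_twin hb, hR]
  have hs : s = .notched ↔ 0 < extremeSize s .notched := by cases s <;> simp [extremeSize]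
  -- Below the bottom of the second chain comes the minimum; if there is none, the value there is
  -- arbitrary.
  let φ : ℕ → (T.sidePoset h s .notched).carrier := fun m =>
    if h : i < m ∧ 0 < extremeSize s .notched then .inl ⟨0, h.2⟩
    else .inr (.inr ⟨i - m, lt_of_le_of_lt (Nat.sub_le _ _) hi⟩)
  have h1 : ∀ m ≤ i, φ m = .inr (.inr ⟨i - m, lt_of_le_of_lt (Nat.sub_le _ _) hi⟩) :=
    fun m hm => dif_neg fun h => absurd h.1 (by omega)
  have h2 : ∀ h : 0 < extremeSize s .notched, φ (i + 1) = .inl ⟨0, h⟩ :=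
    fun h => dif_pos ⟨Nat.lt_succ_self i, h⟩
  refine isLowArm_of_forall φ (h1 0 (Nat.zero_le _)) ?_ ?_ ?_ ?_ ?_
  · intro m hm
    rcases (hlow m).1 hm with hm | ⟨rfl, hm'⟩
    · refine (congrArg (T.sidePoset h s .notched).label (h1 m hm)).trans ?_
      change T.edge (T.rot^[i - m + 1] _) = _
      rw [T.unrot_iterate_rot_iterate_of_le (by omega), show i - m + 1 = i + 1 - m by omega]
    · refine (congrArg (T.sidePoset h s .notched).label (h2 (hs.1 hm'))).trans ?_
      rw [unrot_iterate_rot_iterate, edge_twin]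
      rfl
  · intro m hm
    rcases (hlow _).1 hm with hm | ⟨hm, hm'⟩
    · rw [h1 _ hm]
      change i - (m + 1) < i
      omega
    · rw [hm, h2 (hs.1 hm')]
      exact rfl
  · intro m n hm hn hmn
    rcases (hlow m).1 hm with hm | ⟨rfl, hm'⟩ <;> rcases (hlow n).1 hn with hn | ⟨rfl, hn'⟩
    · rw [h1 m hm, h1 n hn] at hmn
      have : i - m = i - n := Fin.val_eq_of_eq (Sum.inr.inj (Sum.inr.inj hmn))
      omega
    · rw [h1 m hm, h2 (hs.1 hn')] at hmn
      cases hmn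
    · rw [h1 n hn, h2 (hs.1 hm')] at hmn
      cases hmn
    · rfl
  · intro m hm
    rcases (hlow _).1 hm with hm | ⟨hm, hm'⟩
    · rw [h1 _ hm, h1 _ (by omega)]
      exact sideRel_chain (by change i - (m + 1) ≤ i - m; omega)
    · rw [hm, h2 (hs.1 hm'), h1 m (by omega)]
      exact .single rfl
  · rintro (j | j | j) hj -
    · have hj' := exists_extremeSize j
      exact ⟨i + 1, (hlow _).2 (.inr ⟨rfl, hj'.1⟩),
        (h2 j.pos).trans (congrArg Sum.inl (Fin.ext (Eq.symm hj)))⟩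
    · exact hj.elim
    · change j.val < i at hj
      refine ⟨i - j.val, (hlow _).2 (.inl (Nat.sub_le _ _)), (h1 _ (Nat.sub_le _ _)).trans ?_⟩
      exact congrArg (Sum.inr ∘ Sum.inr) (Fin.ext (by change i - (i - j.val) = j.val; omega))

/-- In this direction something is below `c` only if `c` is the coatom of its chain (`l = 0`) and
the other end is notched. It is the atom of the first chain, at the extra low position after a path
without turns. -/
lemma isLowArm_sideRest [Finite H] (hd : 2 ≤ T.degree h) {R : Set T.Vertex}
    (hR : T.vertex h ∈ R ↔ s = .notched) (hl : i + l + 2 = T.degree (T.twin h))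
    (he : T.twin e = T.rot^[i + 1] (T.twin h)) :
    IsLowArm (T.sidePoset h s .notched)
      (.inr (.inr ⟨i, show i < T.degree (T.twin h) - 1 by omega⟩)) (sideRest i) R e
      (List.replicate l .left) := by
  have hlabel : T.edge (T.rot^[i + 1] (T.twin h)) = T.edge e := by rw [← he, edge_twin]
  cases l with
  | zero =>
    have hue : T.unrot e = T.prev h := by
      have : T.rot (T.rot^[i + 1] (T.twin h)) = T.twin h := by
        rw [← Function.iterate_succ_apply' T.rot, Nat.succ_eq_add_one, hl, rot_iterate_degree]
      rw [← he] at this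
      have h1 := T.twin_injective this
      rw [unrot, ← T.next_prev (T.twin e), h1, next_next]
    have hlow : ∀ m, T.IsLow R e (List.replicate 0 .left) m ↔ m = 0 ∨ m = 1 ∧ s = .notched := by
      intro m
      refine (isLow_right_replicate (n := 0)).trans ?_
      rw [Nat.le_zero]
      refine or_congr Iff.rfl (and_congr_right ?_)
      rintro rfl
      rw [← hR]
      change T.vertex (T.next (T.unrot e)) ∈ R ↔ _
      rw [hue, next_prev]
    have hs : s = .notched ↔ 0 < chainSize (T.degree h - 1) s := by
      cases s
      · simp [chainSize]
      · simp only [chainSize, true_iff]; omega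
    let φ : ℕ → (T.sidePoset h s .notched).carrier := fun m =>
      if h' : 0 < m ∧ 0 < chainSize (T.degree h - 1) s then .inr (.inl ⟨0, h'.2⟩)
      else .inr (.inr ⟨i, show i < T.degree (T.twin h) - 1 by omega⟩)
    have h1 : φ 0 = .inr (.inr ⟨i, show i < T.degree (T.twin h) - 1 by omega⟩) :=
      dif_neg fun h => lt_irrefl _ h.1
    have h2 : ∀ h : 0 < chainSize (T.degree _ - 1) s, φ 1 = .inr (.inl ⟨0, h⟩) :=
      fun h => dif_pos ⟨Nat.one_pos, h⟩
    refine isLowArm_of_forall φ h1 ?_ ?_ ?_ ?_ ?_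
    · intro m hm
      rcases (hlow m).1 hm with rfl | ⟨rfl, hm'⟩
      · exact (congrArg (T.sidePoset h s .notched).label h1).trans hlabel
      · refine (congrArg (T.sidePoset h s .notched).label (h2 (hs.1 hm'))).trans ?_
        change T.edge (T.rot h) = T.edge (T.unrot e)
        rw [hue, rot, edge_twin]
    · intro m hm
      rcases (hlow _).1 hm with hm | ⟨hm, hm'⟩
      · exact absurd hm (Nat.succ_ne_zero m)
      · rw [hm, h2 (hs.1 hm')]
        trivial
    · intro m n hm hn hmn
      rcases (hlow m).1 hm with rfl | ⟨rfl, hm'⟩ <;> rcases (hlow n).1 hn with rfl | ⟨rfl, hn'⟩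
      · rfl
      · rw [h1, h2 (hs.1 hn')] at hmn
        cases hmn
      · rw [h1, h2 (hs.1 hm')] at hmn
        cases hmn
      · rfl
    · intro m hm
      rcases (hlow _).1 hm with hm | ⟨hm, hm'⟩
      · exact absurd hm (Nat.succ_ne_zero m)
      · obtain rfl : m = 0 := by omega
        rw [hm, h2 (hs.1 hm'), h1]
        exact .single ⟨rfl, by change i + 1 = T.degree (T.twin h) - 1; omega⟩
    · intro x hx hxc
      rcases sideRel_le hxc with ⟨h, rfl⟩ | ⟨j, h, hj, rfl⟩ | ⟨-, h, rfl⟩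
      · exact absurd hx zero_ne_one
      · exact absurd (show i < j from hx) (by omega)
      · exact ⟨1, (hlow 1).2 (.inr ⟨rfl, exists_chainSize ⟨0, h⟩⟩), h2 h⟩
  | succ l =>
    refine isLowArm_of_eq_zero (fun m hm => isLow_left_cons.1 hm) hlabel fun x hx hxc => ?_
    rcases sideRel_le hxc with ⟨h, rfl⟩ | ⟨j, h, hj, rfl⟩ | ⟨hib, h, rfl⟩
    · exact absurd hx zero_ne_one
    · exact absurd (show i < j from hx) (by omega)
    · change i + 1 = T.degree (T.twin _) - 1 at hib
      omega

/-- An arc number `j` at a puncture, counted from `c`, does not coincide with the arc of `c`. -/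
lemma IsPuncture.edge_rot_iterate_ne [Finite H] (hv : ∀ h, T.vertex h ≠ T.vertex (T.next h))
    {c : H} (hc : T.IsPuncture (T.vertex c)) {j : ℕ} (hj : j < T.degree c - 1) :
    T.edge (T.rot^[j + 1] c) ≠ T.edge c := by
  intro h
  have hd := T.degree_pos c
  have h1 := chain_label_injective hv hc (i := j) (j := T.degree c - 1) (by omega) (by omega) (by
    rw [h, Nat.sub_add_cancel hd, rot_iterate_degree])
  omega

/-- Only the minimum and the maximum can share a label. The chains stop short of a full turn and so
omit `β`; an arc in both chains would join the endpoints of `α` and, by tidiness, be `β`. -/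
lemma label_sidePoset_eq [Finite H] (hα : T.IsTaggedCurve ⟨.side h, s, .notched⟩)
    (ht : T.Tidy ⟨.side h, s, .notched⟩) {x y : (T.sidePoset h s .notched).carrier}
    (hxy : (T.sidePoset h s .notched).label x = (T.sidePoset h s .notched).label y) :
    x = y ∨ ∃ j k, x = .inl j ∧ y = .inl k := by
  have hb : ¬ T.IsBoundary h := hα.1
  have hp : T.IsPuncture (T.vertex (T.twin h)) := by
    rw [T.vertex_twin hb]; exact hα.2.2 rfl
  have hp' : ∀ j : Fin (chainSize (T.degree h - 1) s), T.IsPuncture (T.vertex h) :=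
    fun j => hα.2.1 (exists_chainSize j)
  have hA : ∀ j : Fin (chainSize (T.degree h - 1) s), T.edge (T.rot^[j.val + 1] h) ≠ T.edge h :=
    fun j => (hp' j).edge_rot_iterate_ne ht.vertices_ne (val_lt_of_chainSize j)
  have hB : ∀ j : Fin (T.degree (T.twin h) - 1),
      T.edge (T.rot^[j.val + 1] (T.twin h)) ≠ T.edge h := fun j => by
    have := hp.edge_rot_iterate_ne ht.vertices_ne j.2
    rwa [edge_twin] at this
  have hAB : ∀ (j : Fin (chainSize (T.degree h - 1) s)) (k : Fin (T.degree (T.twin h) - 1)),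
      T.edge (T.rot^[j.val + 1] h) ≠ T.edge (T.rot^[k.val + 1] (T.twin h)) := by
    intro j k hjk
    have h1 := (hp' j).vertex_rot_iterate (j.val + 1)
    have h2 := hp.vertex_rot_iterate (k.val + 1)
    have h3 := (hp' j _ h1).1
    rw [T.vertex_twin hb] at h2
    rcases T.edge_eq_iff.1 hjk with h4 | h4 <;> rw [h4] at h2
    · exact ht.ends_ne (h1.symm.trans h2)
    · rw [T.vertex_twin h3] at h2
      exact hA j (ht.same_ends _ h3 h1 h2).symm
  rcases x with j | j | j <;> rcases y with k | k | k
  · exact .inr ⟨j, k, rfl, rfl⟩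
  · exact absurd hxy.symm (hA k)
  · exact absurd hxy.symm (hB k)
  · exact absurd hxy (hA j)
  · have hj := val_lt_of_chainSize j
    have hk := val_lt_of_chainSize k
    exact .inl (congrArg (Sum.inr ∘ Sum.inl) (Fin.ext
      (chain_label_injective ht.vertices_ne (hp' j) (by omega) (by omega) hxy)))
  · exact absurd hxy (hAB j k)
  · exact absurd hxy (hB j)
  · exact absurd hxy.symm (hAB k j)
  · have hj : j.val < T.degree (T.twin h) - 1 := j.2
    have hk : k.val < T.degree (T.twin h) - 1 := k.2
    exact .inl (congrArg (Sum.inr ∘ Sum.inr) (Fin.ext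
      (chain_label_injective ht.vertices_ne hp (by omega) (by omega) hxy)))

/-- The exchange relation at a common end, for a curve that coincides with an arc. -/
lemma isResolution_common_side [Finite H] (hα : T.IsTaggedCurve ⟨.side h, s, .notched⟩)
    (ht : T.Tidy ⟨.side h, s, .notched⟩) (hl : i + l + 2 = T.degree (T.twin h))
    (he : T.twin e = T.rot^[i + 1] (T.twin h)) {X : T.Exchange}
    (hX : X = { diagonal := ⟨e, List.replicate l .left, List.replicate i .right⟩
                reversed := {v | s = .notched ∧ v = T.vertex h}
                arcs := fun
                  | .left => [T.fanSide .left e (List.replicate i .right) s]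
                  | .right => [T.fanSide .right (T.twin e) (List.replicate l .left) s] }) :
    IsResolution (T.sidePoset h s .notched) (T.edge e) X
      (.inr (.inr ⟨i, show i < T.degree (T.twin h) - 1 by omega⟩)) := by
  have hb : ¬ T.IsBoundary h := hα.1
  have hi : i < T.degree (T.twin h) - 1 := by omega
  have hd := T.two_le_degree ht.edges_ne h
  have hp : T.IsPuncture (T.vertex (T.twin h)) := by
    rw [T.vertex_twin hb]; exact hα.2.2 rfl
  have hR : ∀ v ∈ X.reversed, s = .notched ∧ v = T.vertex h := by
    subst hX; exact fun v hv => hv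
  have hR' : T.vertex h ∈ {v | s = .notched ∧ v = T.vertex h} ↔ s = .notched :=
    ⟨fun h => h.1, fun h => ⟨h, rfl⟩⟩
  have hne : T.vertex h ≠ T.vertex (T.twin h) := by
    rw [T.vertex_twin hb]; exact ht.ends_ne
  have hchain : ∀ j ≤ l + i, ¬ T.IsBoundary (T.rot^[j + 1] (T.twin h)) ∧
      T.vertex (T.rot^[j + 1] (T.twin h)) ∉ X.reversed ∧
      T.vertex (T.twin (T.rot^[j + 1] (T.twin h))) ∉ X.reversed := by
    intro j hj
    have h1 := hp.vertex_rot_iterate (j + 1)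
    have h2 := (hp _ h1).1
    refine ⟨h2, fun h => hne ((hR _ h).2.symm.trans h1), fun h => ?_⟩
    -- An arc from the shared puncture to the reversed endpoint would be the arc of `α`, which is
    -- met again only after a full turn.
    have h3 := ht.same_ends (T.twin (T.rot^[j + 1] (T.twin _)))
      (by rwa [isBoundary_twin]) (hR _ h).2 (by
        rw [T.vertex_next_twin h2, h1, T.vertex_twin hb]; rfl)
    rw [edge_twin] at h3
    refine hp.edge_rot_iterate_ne ht.vertices_ne (j := j) (by omega) ?_
    rw [edge_twin]
    exact h3.symm
  have hc : T.edge (T.rot^[i + 1] (T.twin h)) = T.edge e := by rw [← he, edge_twin]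
  refine isResolution_of_arms (S₁ := sideRest i) (S₂ := sideBefore i) hc ?_ ?_
    (fun x hx => ?_) (fun x y hxc hyc hxy => ?_) disjoint_sideRest_sideBefore (lt_irrefl i)
    (lt_irrefl i) (eq_or_mem_side (extremeSize_le _ _) hi) ?_ ?_ ?_ ?_ ?_ ?_
  · subst hX
    exact (isLowerArm_side hd hi he).iso_disjointUnion_empty
  · subst hX
    exact (isUpperArm_side hd hl he).iso_disjointUnion_empty
  · rcases label_sidePoset_eq hα ht hx with h | ⟨j, k, -, h⟩
    · exact h
    · cases h
  -- Of the two elements labeled `β`, only the minimum is below `c`.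
  · rcases label_sidePoset_eq hα ht hxy with h | ⟨j, k, rfl, rfl⟩
    · exact h
    · rcases sideRel_le hxc with ⟨h1, h1'⟩ | ⟨_, _, _, h1'⟩ | ⟨_, _, h1'⟩
      · rcases sideRel_le hyc with ⟨h2, h2'⟩ | ⟨_, _, _, h2'⟩ | ⟨_, _, h2'⟩
        · exact h1'.trans h2'.symm
        · cases h2'
        · cases h2'
      · cases h1'
      · cases h1'
  · subst hX
    exact isLowArm_sideRest hd hR' hl he
  · subst hX
    change IsLowArm _ _ _ _ (T.twin e) _
    rw [he]
    exact isLowArm_sideBefore hb hR' hi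
  · intro v hv
    obtain ⟨h, rfl⟩ := hR v hv
    exact hα.2.1 h
  · intro d _ h1 h2
    exact ht.vertices_ne d ((hR _ h1).2.trans (hR _ h2).2.symm)
  · have h1 := avoids_left_chain (n := l) he hchain
    subst hX
    exact h1
  · have h1 := avoids_right_chain (i := i) fun j hj => hchain j (by omega)
    subst hX
    change T.Avoids _ (T.twin e) _
    rw [he]
    exact h1

end Side

end Triangulation

namespace Triangulation

variable {H : Type*} {T : Triangulation H}

/-! ### Traversing a curve in the opposite direction -/

lemma IsTaggedCurve.start_reverse {α : TaggedCurve H} (hα : T.IsTaggedCurve α) :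
    T.start (T.reverse α).curve = T.finish α.curve := by
  obtain ⟨h | ⟨g, ts⟩, s, f⟩ := α
  · exact T.vertex_twin hα.1
  · rfl

lemma IsTaggedCurve.finish_reverse {α : TaggedCurve H} (hα : T.IsTaggedCurve α) :
    T.finish (T.reverse α).curve = T.start α.curve := by
  obtain ⟨h | ⟨g, ts⟩, s, f⟩ := α
  · exact T.vertex_next_twin hα.1
  · simp only [reverse, finish, start, T.lastCrossing_reverse, twin_twin']

lemma crossings_reverse (α : TaggedCurve H) :
    T.crossings (T.reverse α).curve = (T.crossings α.curve).reverse.map T.twin := by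
  obtain ⟨h | ⟨g, ts⟩, s, f⟩ := α
  · rfl
  · simp only [reverse, crossings, crossingList]
    refine List.ext_getElem (by simp) fun k h1 h2 => ?_
    simp only [List.length_map, List.length_range, List.length_reverse] at h1
    simp only [List.getElem_map, List.getElem_range, List.getElem_reverse, List.length_map,
      List.length_range]
    rw [T.crossingAt_reverse g ts (by omega)]
    congr 2

lemma map_edge_crossings_reverse (α : TaggedCurve H) :
    (T.crossings (T.reverse α).curve).map T.edge = ((T.crossings α.curve).map T.edge).reverse := by
  rw [crossings_reverse, List.map_map, ← List.map_reverse]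
  exact List.map_congr_left fun x _ => T.edge_twin x

lemma coincides_reverse {α : TaggedCurve H} {δ : T.Edge} :
    T.Coincides (T.reverse α).curve δ ↔ T.Coincides α.curve δ := by
  obtain ⟨h | ⟨g, ts⟩, s, f⟩ := α
  · simp only [reverse, Coincides, edge_twin]
  · exact Iff.rfl

lemma IsTaggedCurve.reverse {α : TaggedCurve H} (hα : T.IsTaggedCurve α) :
    T.IsTaggedCurve (T.reverse α) := by
  refine ⟨?_, fun h => hα.start_reverse ▸ hα.2.2 h, fun h => hα.finish_reverse ▸ hα.2.1 h⟩
  have hc := crossings_reverse (T := T) α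
  obtain ⟨h | ⟨g, ts⟩, s, f⟩ := α
  · exact fun h => hα.1 (T.isBoundary_twin.1 h)
  · intro x hx
    obtain ⟨y, hy, rfl⟩ := List.mem_map.1 ((show T.crossingList _ _ = _ from hc) ▸ hx)
    rw [isBoundary_twin]
    exact hα.1 y (List.mem_reverse.1 hy)

lemma Tidy.reverse {α : TaggedCurve H} (hα : T.IsTaggedCurve α) (ht : T.Tidy α) :
    T.Tidy (T.reverse α) where
  vertices_ne := ht.vertices_ne
  edges_ne := ht.edges_ne
  ends_ne := by
    rw [hα.start_reverse, hα.finish_reverse]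
    exact ht.ends_ne.symm
  cross_once := by
    rw [map_edge_crossings_reverse, List.nodup_reverse]
    exact ht.cross_once
  cross_ends x hx := by
    rw [crossings_reverse] at hx
    obtain ⟨y, hy, rfl⟩ := List.mem_map.1 hx
    rw [edge_twin, hα.start_reverse, hα.finish_reverse]
    exact (ht.cross_ends y (List.mem_reverse.1 hy)).symm
  same_ends h hb h1 h2 := by
    rw [coincides_reverse, ← edge_twin]
    rw [hα.start_reverse] at h1
    rw [hα.finish_reverse] at h2
    exact ht.same_ends _ (by rwa [isBoundary_twin]) ((T.vertex_twin hb).trans h2)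
      ((T.vertex_next_twin hb).trans h1)

/-! ### Antisymmetry -/

/-- If an arc connects two punctures at which only two arcs end, the surface is a sphere with three
punctures. -/
lemma not_isMarkedSurface_of_degree_eq_two (hv : ∀ h, T.vertex h ≠ T.vertex (T.next h))
    (he : ∀ h, T.edge h ≠ T.edge (T.next h)) {h : H} (hb : ¬ T.IsBoundary h)
    (h2 : T.degree h = 2) (h2' : T.degree (T.twin h) = 2) : ¬ T.IsMarkedSurface := by
  -- At a marked point with two ends, the two triangles meeting there are glued along both of their
  -- sides. Applied to both endpoints of the arc, this glues the two triangles along all three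
  -- sides.
  have key : ∀ a, T.degree a = 2 → T.twin (T.prev a) = T.next (T.twin a) := by
    intro a ha
    have := T.rot_iterate_degree a
    rw [ha] at this
    change T.twin (T.prev (T.twin (T.prev a))) = a at this
    rw [← T.next_prev (T.twin (T.prev a))]
    congr 1
    rw [← this, twin_twin']
    congr 2
    rw [this]
  obtain ⟨t, ht⟩ : ∃ t, t = T.twin h := ⟨_, rfl⟩
  have e1 : T.twin (T.prev h) = T.next t := ht ▸ key h h2
  have e2 : T.twin (T.prev t) = T.next h := by
    rw [ht, key _ h2', twin_twin']
  have e3 : T.twin (T.next h) = T.prev t := by rw [← e2, twin_twin']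
  have e4 : T.twin (T.next t) = T.prev h := by rw [← e1, twin_twin']
  have e5 : T.twin t = h := by rw [ht, twin_twin']
  have hedge : T.edge t = T.edge h := by rw [ht, edge_twin]
  have hnp : ∀ a, T.next a ≠ T.prev a := fun a h => T.next_ne (T.next a) h.symm
  have hpa : ∀ a, T.prev a ≠ a := fun a h => T.next_ne a (by
    have := congrArg T.next h
    rw [next_prev] at this
    exact this.symm)
  have n1 : t ≠ h := fun h' => hb (ht.symm.trans h')
  have n2 : t ≠ T.next h := fun h' => he h (h' ▸ hedge.symm)
  have n3 : t ≠ T.prev h := fun h' => he (T.prev h) (by rw [next_prev, ← h', hedge])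
  have n4 : T.next t ≠ h := fun h' => n3 (by rw [← h', prev_next])
  have n5 : T.next t ≠ T.next h := fun h' => n1 (by rw [← T.prev_next t, h', prev_next])
  have n6 : T.next t ≠ T.prev h := fun h' => n2 (by rw [← T.prev_next t, h', prev_prev])
  have n7 : T.prev t ≠ h := fun h' => n2 (by rw [← h', next_prev])
  have n8 : T.prev t ≠ T.next h := fun h' => n3 (by rw [← T.next_prev t, h', next_next])
  have n9 : T.prev t ≠ T.prev h := fun h' => n1 (by rw [← T.next_prev t, h', next_prev])
  rintro ⟨hconn, -, hsphere⟩
  -- The six sides of the two triangles are closed under `next` and `twin`, so by connectedness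
  -- there are no others.
  have huniv : (Set.univ : Set H) = {h, T.next h, T.prev h, t, T.next t, T.prev t} := by
    have hnS : ∀ a ∈ ({h, T.next h, T.prev h, t, T.next t, T.prev t} : Set H),
        T.next a ∈ ({h, T.next h, T.prev h, t, T.next t, T.prev t} : Set H) := by
      rintro a (rfl | rfl | rfl | rfl | rfl | rfl) <;> simp [next_next]
    have htS : ∀ a ∈ ({h, T.next h, T.prev h, t, T.next t, T.prev t} : Set H),
        T.twin a ∈ ({h, T.next h, T.prev h, t, T.next t, T.prev t} : Set H) := by
      rintro a (rfl | rfl | rfl | rfl | rfl | rfl) <;> simp [e1, e2, e3, e4, e5, ← ht]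
    have hS : ∀ a b, Relation.EqvGen (fun a b => b = T.next a ∨ b = T.twin a) a b →
        (a ∈ ({h, T.next h, T.prev h, t, T.next t, T.prev t} : Set H) ↔
          b ∈ ({h, T.next h, T.prev h, t, T.next t, T.prev t} : Set H)) := by
      intro a b hab
      induction hab with
      | rel a b hab =>
        rcases hab with rfl | rfl
        · refine ⟨hnS a, fun h => ?_⟩
          have := hnS _ (hnS _ h)
          rwa [next_next, prev_next] at this
        · refine ⟨htS a, fun h => ?_⟩
          have := htS _ h
          rwa [twin_twin'] at this
      | refl => exact Iff.rfl
      | symm _ _ _ ih => exact ih.symm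
      | trans _ _ _ _ _ ih ih' => exact ih.trans ih'
    ext a
    simp only [Set.mem_univ, true_iff]
    exact (hS h a (hconn h a)).1 (Set.mem_insert _ _)
  have hmem : ∀ a, a = h ∨ a = T.next h ∨ a = T.prev h ∨ a = t ∨ a = T.next t ∨ a = T.prev t :=
    fun a => (huniv ▸ Set.mem_univ a :)
  have hbd : ∀ a, ¬ T.IsBoundary a := by
    intro a
    rcases hmem a with rfl | rfl | rfl | rfl | rfl | rfl <;> rw [IsBoundary]
    · exact hb
    · rw [e3]; exact n8
    · rw [e1]; exact n6
    · rw [e5]; exact n1.symm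
    · rw [e4]; exact n6.symm
    · rw [e2]; exact n8.symm
  refine hsphere ⟨hbd, ?_, ?_⟩
  · rw [← Set.ncard_univ, huniv]
    rw [Set.ncard_insert_of_notMem, Set.ncard_insert_of_notMem, Set.ncard_insert_of_notMem,
      Set.ncard_insert_of_notMem, Set.ncard_insert_of_notMem, Set.ncard_singleton]
    all_goals simp [n1.symm, n2.symm, n3.symm, n4.symm, n5.symm, n6.symm, n7.symm, n8.symm, n9.symm,
      hnp, (hpa _).symm, (T.next_ne _).symm]
  · have hV : (Set.univ : Set T.Vertex) =
        {T.vertex h, T.vertex (T.next h), T.vertex (T.prev h)} := by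
      ext v
      obtain ⟨a, rfl⟩ : ∃ a, T.vertex a = v := Quot.exists_rep v
      simp only [Set.mem_univ, Set.mem_insert_iff, Set.mem_singleton_iff, true_iff]
      rcases hmem a with rfl | rfl | rfl | rfl | rfl | rfl
      · exact .inl rfl
      · exact .inr (.inl rfl)
      · exact .inr (.inr rfl)
      · refine .inr (.inl ?_)
        rw [ht, T.vertex_twin hb]
      · refine .inl ?_
        rw [ht, T.vertex_next_twin hb]
      · refine .inr (.inr ?_)
        rw [← T.vertex_next_twin (hbd (T.prev t)), e2, next_next]
    rw [← Set.ncard_univ, hV, Set.ncard_eq_three]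
    refine ⟨_, _, _, hv h, ?_, ?_, rfl⟩
    · have := hv (T.prev h)
      rw [next_prev] at this
      exact this.symm
    · exact hv (T.next h)

/-- The restriction on the surface is needed only for a doubly notched arc of `T` whose chains both
have one element: then each of these elements would be below the other. -/
lemma isPoset_poset [Finite H] (hT : T.IsMarkedSurface) {α : TaggedCurve H}
    (hα : T.IsTaggedCurve α) (ht : T.Tidy α) : (T.poset α).IsPoset := by
  obtain ⟨h | ⟨g, ts⟩, s, f⟩ := α
  · refine isPoset_sideRel ?_ _
    rintro ⟨h1, h2⟩
    cases s
    · exact absurd h1 zero_ne_one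
    · cases f
      · exact absurd h2 zero_ne_one
      · change T.degree h - 1 = 1 at h1
        change T.degree (T.twin h) - 1 = 1 at h2
        exact not_isMarkedSurface_of_degree_eq_two ht.vertices_ne ht.edges_ne hα.1 (by omega)
          (by omega) hT
  · exact isPoset_crossRel (chainSize_ne_one (T.two_le_degree ht.edges_ne _) _)
      (chainSize_ne_one (T.two_le_degree ht.edges_ne _) _) _

/-! ### The crossings of the loop around a common end -/

lemma twin_crossingAt_loop_side {h : H} {n k : ℕ} (hk : k ≤ n) :
    T.twin (T.crossingAt (T.prev (T.twin h)) (List.replicate n .left) k) =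
      T.rot^[k + 1] (T.twin h) := by
  have hp : List.replicate k Turn.left <+: List.replicate n .left :=
    ⟨List.replicate (n - k) .left, by
      rw [List.replicate_append_replicate, Nat.add_sub_cancel' hk]⟩
  rw [T.twin_crossingAt_left_run hp, Function.iterate_succ_apply]
  rfl

lemma twin_crossingAt_loop_cross {g : H} {ts us : List Turn} {n j : ℕ} (hj : j ≤ n) :
    T.twin (T.crossingAt g (ts ++ .right :: (List.replicate n .left ++ .right :: us))
      (ts.length + (j + 1))) = T.rot^[j + 1] (T.prev (T.twin (T.lastCrossing g ts))) := by
  have hp : List.replicate j Turn.left <+: List.replicate n .left ++ .right :: us :=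
    ⟨List.replicate (n - j) .left ++ .right :: us, by
      rw [← List.append_assoc, List.replicate_append_replicate, Nat.add_sub_cancel' hj]⟩
  rw [crossingAt_append_right, crossingAt_cons_succ, T.twin_crossingAt_left_run hp,
    Function.iterate_succ_apply, rot, prev_prev]
  rfl

/-- The loop runs along `α`, around the puncture, and back along `α`; outside the turn around the
puncture it crosses only arcs that `α` crosses. -/
lemma edge_crossingAt_loop_cross [Finite H] {g : H} {ts : List Turn} {k : ℕ} {n : ℕ}
    (hn : n + 1 = T.degree (T.prev (T.twin (T.lastCrossing g ts))))
    (hk : k ≤ (ts ++ Turn.right :: (List.replicate n Turn.left ++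
      Turn.right :: ts.reverse.map Turn.flip)).length) :
    (∃ j ≤ n, k = ts.length + (j + 1)) ∨
      T.edge (T.crossingAt g (ts ++ .right :: (List.replicate n .left ++
        .right :: ts.reverse.map Turn.flip)) k) ∈ (T.crossingList g ts).map T.edge := by
  simp only [List.length_append, List.length_cons, List.length_replicate, List.length_map,
    List.length_reverse] at hk
  rcases Nat.lt_or_ge ts.length k with h | h
  · obtain ⟨j, rfl⟩ : ∃ j, k = ts.length + (j + 1) := ⟨k - ts.length - 1, by omega⟩
    rcases Nat.lt_or_ge n j with hj | hj
    · right
      obtain ⟨m, rfl⟩ : ∃ m, j = n + (m + 1) := ⟨j - n - 1, by omega⟩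
      have h1 := T.crossingAt_append_right (T.exit (T.twin (T.lastCrossing g ts)) .right)
        (List.replicate n .left) (.right :: ts.reverse.map Turn.flip) (m + 1)
      have h2 : T.exit (T.twin (T.lastCrossing (T.exit (T.twin (T.lastCrossing g ts)) .right)
          (List.replicate n .left))) .right = T.twin (T.lastCrossing g ts) := by
        rw [twin_lastCrossing_left_replicate]
        have h3 := T.rot_iterate_degree (T.prev (T.twin (T.lastCrossing g ts)))
        rw [← hn, Function.iterate_succ_apply, rot, prev_prev] at h3
        change T.next (T.rot^[n] (T.twin (T.next _))) = _
        rw [h3, next_prev]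
      rw [List.length_replicate, crossingAt_cons_succ, h2,
        T.crossingAt_reverse g ts (by omega)] at h1
      rw [crossingAt_append_right, crossingAt_cons_succ, h1, edge_twin]
      exact List.mem_map_of_mem (T.mem_crossingList.2 ⟨_, Nat.sub_le _ _, rfl⟩)
    · exact .inl ⟨j, hj, rfl⟩
  · right
    rw [T.crossingAt_append_left _ _ _ h]
    exact List.mem_map_of_mem (T.mem_crossingList.2 ⟨k, h, rfl⟩)

end Triangulation

namespace Triangulation

variable {H : Type*} {T : Triangulation H}

/-! ### The exchange relation -/

lemma IsResolution.of_iso {P P' : LabeledOrder T.Edge} {γ : T.Edge} {X : T.Exchange} {c : P.carrier}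
    (h : IsResolution P γ X c) (hP : P.Iso P') : ∃ c', IsResolution P' γ X c' := by
  obtain ⟨f, hf⟩ := hP
  exact ⟨f c, h.of_isom hf⟩

open scoped Classical in
-- The labeling is a bijection from the elements below `c` to the orange arcs.
lemma IsResolution.yhatOrange_eq [Finite H] {P : LabeledOrder T.Edge} {γ : T.Edge} {X : T.Exchange}
    {c : P.carrier} (h : IsResolution P γ X c) :
    X.yhatOrange = ∏ e : P.carrier with P.le e c, T.yhat (P.label e) := by
  rw [Exchange.yhatOrange]
  symm
  refine Finset.prod_nbij P.label ?_ ?_ ?_ fun _ _ => rfl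
  · intro x hx
    simp only [Finset.mem_filter, Finset.mem_univ, true_and] at hx ⊢
    exact (h.isOrange _).2 ⟨x, hx, rfl⟩
  · intro x hx y hy hxy
    simp only [Finset.coe_filter, Finset.mem_univ, true_and, Set.mem_ofPred_eq] at hx hy
    exact h.label_inj x y hx hy hxy
  · intro δ hδ
    simp only [Finset.coe_filter, Finset.mem_univ, true_and, Set.mem_ofPred_eq] at hδ
    obtain ⟨x, hx, rfl⟩ := (h.isOrange δ).1 hδ
    exact ⟨x, by simpa using hx, rfl⟩

/-- The facts about an arc `γ` that has an endpoint in common with `α`, where the two are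
exchangeable. -/
lemma Tidy.of_hasEndpoint_finish {α : TaggedCurve H} (ht : T.Tidy α) {γ : T.Edge}
    (hex : T.Exchangeable α γ) {v : T.Vertex} (hv : v = T.start α.curve ∨ v = T.finish α.curve)
    (hγ : T.HasEndpoint γ v) :
    γ ∉ (T.crossings α.curve).map T.edge ∧ ¬ T.Coincides α.curve γ := by
  have h1 : γ ∉ (T.crossings α.curve).map T.edge := by
    intro h
    obtain ⟨x, hx, rfl⟩ := List.mem_map.1 h
    rcases hv with rfl | rfl
    · exact (ht.cross_ends x hx).1 hγ
    · exact (ht.cross_ends x hx).2 hγ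
  refine ⟨h1, ?_⟩
  rcases hex with ⟨⟨k, hk, -⟩, -⟩ | ⟨-, h, -⟩
  · exact absurd (List.mem_of_getElem? hk) h1
  · exact h

/-- Seen from the crossing at end number `j` of the puncture, `n - j` left turns are ahead. Behind,
the `j` left turns and the right turn that began the circuit appear with the other hand. -/
lemma diagonalAt_loop_cross {g : H} {ts us : List Turn} {n j : ℕ} (hj : j ≤ n) :
    T.diagonalAt g (ts ++ .right :: (List.replicate n .left ++ us)) (ts.length + (j + 1)) =
      ⟨T.crossingAt g (ts ++ .right :: (List.replicate n .left ++ us)) (ts.length + (j + 1)),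
        List.replicate (n - j) .left ++ us,
        List.replicate j .right ++ .left :: ts.reverse.map Turn.flip⟩ := by
  rw [diagonalAt]
  congr 1
  · rw [List.drop_append, List.drop_eq_nil_of_le (by omega), Nat.add_sub_cancel_left,
      List.drop_succ_cons, List.drop_append_of_le_length (by simpa), List.drop_replicate,
      List.nil_append]
  · rw [List.take_append, List.take_of_length_le (by omega), Nat.add_sub_cancel_left,
      List.take_succ_cons, List.take_append_of_le_length (by simpa), List.take_replicate,
      min_eq_left hj]
    simp [Turn.flip]

lemma exists_isResolution_common_end [Finite H] {α : TaggedCurve H} (hα : T.IsTaggedCurve α)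
    (ht : T.Tidy α) (hn : α.finishTag = .notched) {γ : T.Edge}
    (hγ : γ ∉ (T.crossings α.curve).map T.edge) {g : H} {ts : List Turn} {k : ℕ}
    (hl : T.loopAroundFinish α.curve = (g, ts)) (hk : k ≤ ts.length)
    (hk' : T.edge (T.crossingAt g ts k) = γ) {X : T.Exchange}
    (hX : X = { diagonal := T.diagonalAt g ts k
                reversed := {v | α.startTag = .notched ∧ v = T.start α.curve}
                arcs := fun hand =>
                  let D := T.diagonalAt g ts k
                  match hand with
                  | .left => [T.fanSide .left D.e D.bwd α.startTag]
                  | .right => [T.fanSide .right (T.twin D.e) D.fwd α.startTag] }) :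
    ∃ c, IsResolution (T.poset α) γ X c := by
  obtain ⟨h | ⟨g₀, ts₀⟩, s, f⟩ := α
  · obtain rfl : f = .notched := hn
    simp only [loopAroundFinish, Prod.mk.injEq] at hl
    obtain ⟨rfl, rfl⟩ := hl
    subst hk'
    have hd := T.two_le_degree ht.edges_ne (T.twin h)
    rw [List.length_replicate] at hk
    have hD : T.diagonalAt (T.prev (T.twin h)) (List.replicate (T.degree (T.twin h) - 2) .left) k =
        ⟨T.crossingAt (T.prev (T.twin h)) (List.replicate (T.degree (T.twin h) - 2) .left) k,
          List.replicate (T.degree (T.twin h) - 2 - k) .left, List.replicate k .right⟩ := by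
      simp only [diagonalAt, List.take_replicate, List.drop_replicate, List.reverse_replicate,
        List.map_replicate, Turn.flip, min_eq_left hk]
    rw [hD] at hX
    refine ⟨_, isResolution_common_side hα ht (i := k)
      (l := T.degree (T.twin h) - 2 - k) (by omega) (T.twin_crossingAt_loop_side hk)
      (hX.trans ?_)⟩
    congr 1
  · obtain rfl : f = .notched := hn
    simp only [loopAroundFinish, Prod.mk.injEq] at hl
    obtain ⟨rfl, rfl⟩ := hl
    have hd := T.degree_pos (T.prev (T.twin (T.lastCrossing g₀ ts₀)))
    rcases edge_crossingAt_loop_cross (T := T) (g := g₀) (Nat.sub_add_cancel hd) hk with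
      ⟨j, hj, rfl⟩ | h1
    · subst hk'
      have hr := hα.finish_reverse
      rw [diagonalAt_loop_cross hj] at hX
      -- The resolution for curves with crossings has the shared puncture at the start, so it is
      -- used for the reversed curve.
      have h1 := isResolution_common_start hα.reverse (ht.reverse hα) (i := j)
        (l := T.degree (T.prev (T.twin (T.lastCrossing g₀ ts₀))) - 1 - j) (by omega)
        (twin_crossingAt_loop_cross hj) (hX.trans (by
          congr 1
          change _ = {v | s = .notched ∧
            v = T.finish (T.reverse ⟨.cross g₀ ts₀, s, .notched⟩).curve}
          rw [hr]))
      exact h1.of_iso (T.poset_iso_reverse ⟨.cross g₀ ts₀, s, .notched⟩).symm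
    · exact absurd (hk' ▸ h1) hγ

/-- The loop meets the ends at the puncture one after the other, and `γ` has one of these ends. -/
lemma exists_loop_crossing [Finite H] {α : TaggedCurve H} (hα : T.IsTaggedCurve α)
    (ht : T.Tidy α) {γ : T.Edge} (hγ : T.HasEndpoint γ (T.finish α.curve))
    (hc : ¬ T.Coincides α.curve γ) :
    ∃ g ts k, T.loopAroundFinish α.curve = (g, ts) ∧ k ≤ ts.length ∧
      T.edge (T.crossingAt g ts k) = γ := by
  obtain ⟨a, rfl, ha⟩ := hγ
  obtain ⟨h | ⟨g, ts⟩, s, f⟩ := α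
  · have hd := T.two_le_degree ht.edges_ne (T.twin h)
    obtain ⟨j, hj, rfl⟩ := IsPuncture.exists_rot_iterate (a := a) (c := T.twin h)
      (by rw [ha, T.vertex_twin hα.1]; rfl)
    -- The end whose number is the degree minus one belongs to the arc of `α`, which the loop does
    -- not cross.
    have hj' : j ≤ T.degree (T.twin h) - 2 := by
      by_contra hj'
      obtain rfl : j = T.degree (T.twin h) - 1 := by omega
      refine hc ?_
      change T.edge h = _
      rw [Nat.sub_add_cancel (by omega), rot_iterate_degree, edge_twin]
    refine ⟨_, _, j, rfl, by simpa using hj', ?_⟩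
    rw [← T.edge_twin, twin_crossingAt_loop_side hj']
  · obtain ⟨j, hj, rfl⟩ := IsPuncture.exists_rot_iterate (a := a)
      (c := T.prev (T.twin (T.lastCrossing g ts))) ha
    refine ⟨_, _, ts.length + (j + 1), rfl, ?_, ?_⟩
    · simp; omega
    · rw [← T.edge_twin, twin_crossingAt_loop_cross (by omega)]

lemma exists_isExchange [Finite H] {α : TaggedCurve H} (hα : T.IsTaggedCurve α) (ht : T.Tidy α)
    {γ : T.Edge} (hex : T.Exchangeable α γ) : ∃ X, T.IsExchange α γ X := by
  have hend : ∀ α', (α' = α ∨ α' = T.reverse α) → T.IsTaggedCurve α' → T.Tidy α' →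
      T.HasEndpoint γ (T.finish α'.curve) → α'.finishTag = .notched →
      ¬ T.Coincides α'.curve γ → ∃ X, T.IsExchange α γ X := by
    intro α' h hα' ht' hp hn hc
    obtain ⟨g, ts, k, hl, hk, hγ⟩ := exists_loop_crossing hα' ht' hp hc
    exact ⟨_, .common_end α' h hp hn g ts k hl hk hγ⟩
  rcases hex with ⟨⟨k, hk, -⟩, -⟩ | ⟨-, hc, ⟨hp, hn, -⟩ | ⟨hp, hn, -⟩⟩
  · obtain ⟨h | ⟨g, ts⟩, s, f⟩ := α
    · simp [crossings] at hk
    · obtain ⟨hk1, hk2⟩ := List.getElem?_eq_some_iff.1 hk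
      simp only [crossings, crossingList, List.length_map, List.length_range] at hk1
      simp only [crossings, crossingList, List.getElem_map, List.getElem_range] at hk2
      exact ⟨_, .crossing g ts k rfl (Nat.le_of_lt_succ hk1) hk2⟩
  · exact hend _ (.inr rfl) hα.reverse (ht.reverse hα) (hα.finish_reverse ▸ hp) hn
      (fun h => hc (coincides_reverse.1 h))
  · exact hend _ (.inl rfl) hα ht hp hn hc

/-- An arc sharing an endpoint with a tidy `α` is not crossed by `α`; so for a common end, the given
crossing of the loop with `γ` must be one at the puncture. If that puncture is the start of `α`, the
result is transported back from the reversed curve. -/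
lemma IsExchange.exists_isResolution [Finite H] {α : TaggedCurve H} (hα : T.IsTaggedCurve α)
    (ht : T.Tidy α) {γ : T.Edge} (hex : T.Exchangeable α γ) {X : T.Exchange}
    (hX : T.IsExchange α γ X) : ∃ c, IsResolution (T.poset α) γ X c := by
  cases hX with
  | crossing g ts k hc hk hγ =>
    obtain ⟨c, s, f⟩ := α
    obtain rfl : c = .cross g ts := hc
    subst hγ
    exact ⟨_, isResolution_crossing hα ht hk rfl⟩
  | common_end α' h hp hn g ts k hl hk hγ =>
    rcases h with rfl | rfl
    · exact exists_isResolution_common_end hα ht hn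
        (ht.of_hasEndpoint_finish hex (.inr rfl) hp).1 hl hk hγ rfl
    · rw [hα.finish_reverse] at hp
      have h1 := (ht.of_hasEndpoint_finish hex (.inl rfl) hp).1
      obtain ⟨c, hc⟩ := exists_isResolution_common_end hα.reverse (ht.reverse hα) hn
        (by rwa [map_edge_crossings_reverse, List.mem_reverse]) hl hk hγ rfl
      exact hc.of_iso (T.poset_iso_reverse α).symm

end Triangulation

end TidyExchange

open TidyExchange

open scoped Classical in
theorem proposition3p1 {H : Type*} [Finite H] (T : Triangulation H) (hT : T.IsMarkedSurface)
    (α : TaggedCurve H) (hα : T.IsTaggedCurve α) (htidy : T.Tidy α)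
    (γ : T.Edge) (hγ : T.IsArc γ) (hex : T.Exchangeable α γ) :
    (T.poset α).IsPoset ∧
    (∃ X, T.IsExchange α γ X) ∧
    ∀ X : T.Exchange, T.IsExchange α γ X →
      -- the choice of colors conforms to the convention, and each elementary lamination
      -- contributes at most once
      (X.IsOrange γ ∧ ∀ d, ¬ T.IsBoundary d →
        X.laminationCrossings .red d = ∅ ∧ (X.laminationCrossings .blue d).Subsingleton) ∧
      ∃ eγ : (T.poset α).carrier,
        (∀ e, (T.poset α).label e = γ ↔ e = eγ) ∧
        (X.poset .blue).Iso ((T.poset α).restrict fun e => ¬ (T.poset α).le eγ e) ∧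
        (X.poset .red).Iso ((T.poset α).restrict fun e => ¬ (T.poset α).le e eγ) ∧
        X.yhatOrange =
          ∏ e : (T.poset α).carrier with (T.poset α).le e eγ, T.yhat ((T.poset α).label e) ∧
        (X.poset .blue).F T.yhat =
          ∑ I : Finset (T.poset α).carrier with (T.poset α).IsIdeal I ∧ eγ ∉ I,
            (T.poset α).weight T.yhat I ∧
        X.yhatOrange * (X.poset .red).F T.yhat =
          ∑ I : Finset (T.poset α).carrier with (T.poset α).IsIdeal I ∧ eγ ∈ I,
            (T.poset α).weight T.yhat I ∧
        (T.poset α).F T.yhat =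
          (X.poset .blue).F T.yhat + X.yhatOrange * (X.poset .red).F T.yhat := by
  refine ⟨Triangulation.isPoset_poset hT hα htidy, Triangulation.exists_isExchange hα htidy hex,
    fun X hX => ?_⟩
  obtain ⟨c, hc⟩ := hX.exists_isResolution hα htidy hex
  have hblue := LabeledOrder.F_of_iso_not_above T.yhat hc.blue
  have hred := LabeledOrder.F_of_iso_not_below T.yhat hc.red
  rw [← hc.yhatOrange_eq] at hred
  refine ⟨⟨(hc.isOrange γ).2 ⟨c, (T.poset α).refl c, (hc.label_iff c).2 rfl⟩,
    fun d hd => ⟨hc.admissible.elementary_right hd, hc.admissible.subsingleton hd⟩⟩,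
    c, hc.label_iff, hc.blue, hc.red, hc.yhatOrange_eq, hblue, hred, ?_⟩
  rw [hblue, hred]
  exact LabeledOrder.F_eq_add _ _ _
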